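/- Let $V:\mathbb R\to\mathbb R$ be a real analytic function with $\lim_{x\to\pm\infty}V(x)/(|x|+1)=+\infty$. For a Borel probability measure $\mu$ on $\mathbb R$ put $$I_V(\mu)=\tfrac12\iint\log|t-s|^{-1}\,d\mu(t)d\mu(s)+\tfrac12\iint\log|e^t-e^s|^{-1}\,d\mu(t)d\mu(s)+\int V\,d\mu ,$$ understood as $\iint k^V\,d\mu\,d\mu\in(-\infty,+\infty]$ with $k^V(t,s)=\tfrac12\log|t-s|^{-1}+\tfrac12\log|e^t-e^s|^{-1}+\tfrac12V(t)+\tfrac12V(s)$, $k^V(t,t)=+\infty$. Suppose that $V$ is one-cut regular, that is, that there is a probability measure $d\mu_V(x)=\psi_V(x)\,dx$ such that, for some real $a<b$ and $\ell$, 1. $\operatorname{supp}\mu_V=[a,b]$, and $\psi_V(x)>0$ for $x\in(a,b)$; 2. $\lim_{x\to a_+}\psi_V(x)/\sqrt{x-a}$ and $\lim_{x\to b_-}\psi_V(x)/\sqrt{b-x}$ exist, are finite, and are different from $0$; 3. for every real $x$ the integrals in $U(x)=\int\log|t-x|^{-1}d\mu_V(t)+\int\log|e^t-e^x|^{-1}d\mu_V(t)+V(x)$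 converge absolutely, $U(x)+\ell=0$ for $x\in[a,b]$, and $U(x)+\ell>0$ for $x\in\mathbb R\setminus[a,b]$. Then $\mu_V$ is the equilibrium measure of $V$: it is the unique minimizer of $I_V$ among all Borel probability measures on $\mathbb R$. For every $n\ge1$ there are unique monic real polynomials $p^{(n)}_n$ and $q^{(n)}_n$ of degree $n$ with $$\int_{\mathbb R}p^{(n)}_n(x)e^{kx}e^{-nV(x)}dx=0,\qquad \int_{\mathbb R}x^kq^{(n)}_n(e^x)e^{-nV(x)}dx=0\qquad(k=0,\dots,n-1),$$ and $p^{(n)}_n(x)$ and $q^{(n)}_n(e^x)$ have each exactly $n$ distinct real zeros, $z_1,\dots,z_n$ and $\hat z_1,\dots,\hat z_n$ respectively. As $n\to\infty$, the normalized zero counting measures $$\mu_n=\frac1n\sum_{j=1}^n\delta_{z_j},\qquad \hat\mu_n=\frac1n\sum_{j=1}^n\delta_{\hat z_j}$$ both converge weakly to $\mu_V$. -/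

import Mathlib

open MeasureTheory Filter Topology Polynomial

noncomputable section

/-- The growth condition: `V(x) / (|x| + 1) → +∞` as `x → ±∞`. -/
def HasSuperlinearGrowth (V : ℝ → ℝ) : Prop :=
  Tendsto (fun x => V x / (|x| + 1)) atTop atTop ∧
    Tendsto (fun x => V x / (|x| + 1)) atBot atTop

/-- The symmetric kernel
`k^V(t,s) = ½ log|t-s|⁻¹ + ½ log|e^t-e^s|⁻¹ + ½ V(t) + ½ V(s)`,
with its value `+∞` on the diagonal. -/
def energyKernel (V : ℝ → ℝ) (t s : ℝ) : EReal :=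
  if t = s then ⊤
  else ((1 / 2 * Real.log (|t - s|⁻¹) + 1 / 2 * Real.log (|Real.exp t - Real.exp s|⁻¹)
    + 1 / 2 * V t + 1 / 2 * V s : ℝ) : EReal)

/-- The energy
`I_V(μ) = ½ ∬ log|t-s|⁻¹ dμdμ + ½ ∬ log|e^t-e^s|⁻¹ dμdμ + ∫ V dμ = ∬ k^V dμdμ ∈ (-∞, +∞]`,
as the integral of the positive part of `k^V` minus the integral of its negative part. For a
continuous `V` of superlinear growth the kernel is bounded below, so that the second integral is
finite. -/
def energy (V : ℝ → ℝ) (μ : ProbabilityMeasure ℝ) : EReal :=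
  ((∫⁻ x : ℝ × ℝ, (energyKernel V x.1 x.2).toENNReal
      ∂((μ : Measure ℝ).prod (μ : Measure ℝ)) : ENNReal) : EReal)
    - ((∫⁻ x : ℝ × ℝ, (-energyKernel V x.1 x.2).toENNReal
      ∂((μ : Measure ℝ).prod (μ : Measure ℝ)) : ENNReal) : EReal)

/-- `μ` minimizes the energy `I_V` among all Borel probability measures on `ℝ`. -/
def IsEquilibriumMeasure (V : ℝ → ℝ) (μ : ProbabilityMeasure ℝ) : Prop :=
  ∀ ν : ProbabilityMeasure ℝ, energy V μ ≤ energy V ν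

/-- The left-hand side of the variational conditions, without the constant:
`∫ log|t-x|⁻¹ dμ(t) + ∫ log|e^t-e^x|⁻¹ dμ(t) + V(x)`. -/
def effectivePotential (V : ℝ → ℝ) (μ : ProbabilityMeasure ℝ) (x : ℝ) : ℝ :=
  (∫ t, Real.log (|t - x|⁻¹) ∂(μ : Measure ℝ))
    + (∫ t, Real.log (|Real.exp t - Real.exp x|⁻¹) ∂(μ : Measure ℝ)) + V x

/-- `V` is a one-cut regular external field, and `μ` is a measure that shows it. -/
structure IsOneCutRegularWith (V : ℝ → ℝ) (μ : ProbabilityMeasure ℝ) : Prop where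
  analytic : AnalyticOnNhd ℝ V Set.univ
  growth : HasSuperlinearGrowth V
  /-- The logarithmic integrals in the variational conditions converge. -/
  integrable_log : ∀ x : ℝ,
    Integrable (fun t => Real.log (|t - x|⁻¹)) (μ : Measure ℝ) ∧
    Integrable (fun t => Real.log (|Real.exp t - Real.exp x|⁻¹)) (μ : Measure ℝ)
  exists_density : ∃ (a b l : ℝ) (ψ : ℝ → ℝ),
    a < b ∧ Measurable ψ ∧ (∀ x, 0 ≤ ψ x) ∧
    (μ : Measure ℝ) = volume.withDensity (fun x => ENNReal.ofReal (ψ x)) ∧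
    (μ : Measure ℝ).support = Set.Icc a b ∧
    (∀ x ∈ Set.Ioo a b, 0 < ψ x) ∧
    (∃ c : ℝ, c ≠ 0 ∧ Tendsto (fun x => ψ x / Real.sqrt (x - a)) (𝓝[>] a) (𝓝 c)) ∧
    (∃ c : ℝ, c ≠ 0 ∧ Tendsto (fun x => ψ x / Real.sqrt (b - x)) (𝓝[<] b) (𝓝 c)) ∧
    (∀ x ∈ Set.Icc a b, effectivePotential V μ x + l = 0) ∧
    (∀ x, x ∉ Set.Icc a b → 0 < effectivePotential V μ x + l)

/-- `P` is the type II multiple orthogonal polynomial `p_j^{(n)}`: monic of degree `j`, with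
`∫ P(x) e^{kx} e^{-nV(x)} dx = 0` for `k = 0, …, j-1`. -/
def IsTypeTwoPolynomial (V : ℝ → ℝ) (n j : ℕ) (P : ℝ[X]) : Prop :=
  P.Monic ∧ P.natDegree = j ∧
    ∀ k < j, ∫ x : ℝ, P.eval x * Real.exp (k * x) * Real.exp (-(n * V x)) = 0

/-- `Q` is the dual polynomial `q_j^{(n)}`: monic of degree `j`, with
`∫ x^k Q(e^x) e^{-nV(x)} dx = 0` for `k = 0, …, j-1`. -/
def IsDualPolynomial (V : ℝ → ℝ) (n j : ℕ) (Q : ℝ[X]) : Prop :=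
  Q.Monic ∧ Q.natDegree = j ∧
    ∀ k < j, ∫ x : ℝ, x ^ k * Q.eval (Real.exp x) * Real.exp (-(n * V x)) = 0

/-- `z 0, …, z (n-1)` are distinct, and they are exactly the real zeros of `f`. -/
def EnumeratesZeros {n : ℕ} (f : ℝ → ℝ) (z : Fin n → ℝ) : Prop :=
  Function.Injective z ∧ Set.range z = {x | f x = 0}

/-- The normalized counting measure `(1/n) ∑ δ_{z_j}` of `n` points. -/
def countingMeasure {n : ℕ} (z : Fin n → ℝ) : FiniteMeasure ℝ :=
  (n : NNReal)⁻¹ • ∑ j, (diracProba (z j)).toFiniteMeasure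

end

/-!
The equilibrium measure and the zeros are both controlled by the regularized logarithm
`softLog y u = log |u + i y|` with `y > 0`, which is continuous and bounded below. Two facts about
it carry the proof.

*Positive definiteness* (`diffEnergy_nonneg`, `diffEnergy_antitone`). For measures of equal mass
the quadratic form of `-softLog y` at `α - β` is nonnegative and decreases in `y`: minus its
`y`-derivative is the form of the Cauchy kernel, a superposition of `cos ((t - s) ξ)` with
positive weights, and it tends to `0` as `y → ∞`.

*One-sided bounds suffice* (`tendsto_integral_of_softPotential_le`). If the potentials at height
`y` of probability measures `ν n` are asymptotically at most those of a compactly supported `μ`,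
then `ν n → μ`. Over a long centred interval, the potential of a unit mass has the smallest
integral when the mass is at the centre, and a hardly larger one when it is in a bounded set. So
the potentials cannot stay below that of `μ` on average, and the difference tends to `0` in the
mean. Differences of potentials at the heights `2 ε` and `ε` are convolutions with an approximate
identity.

Let `I = ½ (∫ V dμ - l)`, the energy of `μ`. Expanding the regularized energy of a probability
measure `ν` about `μ`, the linear term is almost nonnegative by the Euler–Lagrange conditions
(`exists_neg_le_regPotential`, by Dini's theorem), and the quadratic term is nonnegative. Keeping
the quadratic term and pairing `ν - μ` with a small multiple `T (δ_x - δ_R)`, where `R` is far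
away, gives `EulerLagrange.exists_regEnergy_ge`: for `φ = id` or `φ = exp`, if `X` denotes the
excess of the potential of `φ_* ν` over that of `φ_* μ` at the point `x + i y`, then the energy of
`ν` is at least `I + T (X - τ) + κ ∫ |t| dν`, uniformly in `ν`. A measure of energy at most `I`
thus has `X ≤ τ` for every `τ > 0`, and it is `μ` (`EulerLagrange.eq_of_energy_le`).

The polynomials come from the biorthogonal ensemble with density
`det (x_i^j) det (e^{j x_i}) ∏ e^{-n V(x_j)} ≥ 0`. By Laplace expansion the average of
`∏ (X - φ(x_j))` is orthogonal to the lower powers of `χ`, where `{φ, χ} = {id, exp}` (`exists_monic_orthogonal`); both families are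
treated at once. A sign change argument gives uniqueness and `n` distinct zeros
(`le_card_zeros_of_orthogonal`). Up to a factor `e^{O(n)}`, the density is at most `exp (-n² E)`,
with `E` the regularized energy of the empirical measure, and the partition function is at least
`exp (-n² (I + o(1)))`, by Jensen's inequality. With the variational inequality for the empirical
measure, the average of `|∏ (x + i y - φ(x_j))|` is at most `exp (n (U + o(1)))`, where `U` is the
potential of `φ_* μ` at `x + i y` (`EulerLagrange.eventually_integral_prod_norm_le`). This bounds
the orthogonal polynomial off the real axis, hence the potential of its zeros, and the one-sided
criterion applies.
-/

/-! ### The regularized logarithm -/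

/-- The regularized logarithm `log |u + i y| = ½ log (u² + y²)`. -/
noncomputable def softLog (y u : ℝ) : ℝ := 1 / 2 * Real.log (u ^ 2 + y ^ 2)

lemma softLog_arg_pos {y : ℝ} (hy : 0 < y) (u : ℝ) : 0 < u ^ 2 + y ^ 2 := by positivity

@[fun_prop]
lemma continuous_softLog {y : ℝ} (hy : 0 < y) : Continuous (softLog y) := by
  unfold softLog
  exact continuous_const.mul
    (Continuous.log (by fun_prop) fun u => (softLog_arg_pos hy u).ne')

lemma softLog_neg (y u : ℝ) : softLog y (-u) = softLog y u := by simp [softLog]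

lemma softLog_zero (y : ℝ) : softLog y 0 = Real.log y := by
  simp [softLog, Real.log_pow]

lemma hasDerivAt_softLog {y : ℝ} (hy : 0 < y) (u : ℝ) :
    HasDerivAt (softLog y) (u / (u ^ 2 + y ^ 2)) u := by
  have h1 : HasDerivAt (fun u : ℝ => u ^ 2 + y ^ 2) (2 * u) u := by
    simpa using (hasDerivAt_pow 2 u).add_const (y ^ 2)
  exact ((h1.log (softLog_arg_pos hy u).ne').const_mul (1 / 2 : ℝ)).congr_deriv (by ring)

lemma hasDerivAt_softLog_left {y : ℝ} (hy : 0 < y) (u : ℝ) :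
    HasDerivAt (fun y => softLog y u) (y / (y ^ 2 + u ^ 2)) y := by
  have h1 : HasDerivAt (fun y : ℝ => u ^ 2 + y ^ 2) (2 * y) y := by
    simpa using (hasDerivAt_pow 2 y).const_add (u ^ 2)
  exact ((h1.log (softLog_arg_pos hy u).ne').const_mul (1 / 2 : ℝ)).congr_deriv
    (by rw [add_comm (y ^ 2)]; ring)

lemma softLog_le_softLog_of_abs_le {y u v : ℝ} (hy : 0 < y) (h : |u| ≤ |v|) :
    softLog y u ≤ softLog y v := by
  have := sq_le_sq.2 h
  have := Real.log_le_log (softLog_arg_pos hy u) (by linarith : u ^ 2 + y ^ 2 ≤ v ^ 2 + y ^ 2)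
  unfold softLog; linarith

lemma softLog_mono_left {y y' : ℝ} (hy : 0 < y) (h : y ≤ y') (u : ℝ) :
    softLog y u ≤ softLog y' u := by
  have h2 : y ^ 2 ≤ y' ^ 2 := by gcongr
  have := Real.log_le_log (softLog_arg_pos hy u) (by linarith : u ^ 2 + y ^ 2 ≤ u ^ 2 + y' ^ 2)
  unfold softLog; linarith

lemma log_le_softLog {y : ℝ} (hy : 0 < y) (u : ℝ) : Real.log y ≤ softLog y u := by
  rw [← softLog_zero y]
  exact softLog_le_softLog_of_abs_le hy (by simp)

lemma log_abs_le_softLog {y u : ℝ} (hu : u ≠ 0) : Real.log |u| ≤ softLog y u := by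
  have h : Real.log |u| = 1 / 2 * Real.log (u ^ 2) := by
    rw [← sq_abs, Real.log_pow]; push_cast; ring
  have := Real.log_le_log (by positivity : 0 < u ^ 2)
    (by nlinarith [sq_nonneg y] : u ^ 2 ≤ u ^ 2 + y ^ 2)
  rw [h]; unfold softLog; linarith

lemma softLog_le_log_add {y : ℝ} (hy : 0 < y) (u : ℝ) : softLog y u ≤ Real.log (|u| + y) := by
  have h : Real.log (|u| + y) = 1 / 2 * Real.log ((|u| + y) ^ 2) := by
    rw [Real.log_pow]; push_cast; ring
  have := Real.log_le_log (softLog_arg_pos hy u)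
    (by nlinarith [sq_abs u, abs_nonneg u] : u ^ 2 + y ^ 2 ≤ (|u| + y) ^ 2)
  rw [h]; unfold softLog; linarith

lemma log_one_add_abs_sub_le (t s : ℝ) :
    Real.log (1 + |t - s|) ≤ Real.log (1 + |t|) + Real.log (1 + |s|) := by
  rw [← Real.log_mul (by positivity) (by positivity)]
  apply Real.log_le_log (by positivity)
  nlinarith [abs_sub t s, abs_nonneg t, abs_nonneg s, mul_nonneg (abs_nonneg t) (abs_nonneg s)]

lemma log_one_add_abs_nonneg (t : ℝ) : 0 ≤ Real.log (1 + |t|) :=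
  Real.log_nonneg (by linarith [abs_nonneg t])

lemma log_one_add_abs_le (t : ℝ) : Real.log (1 + |t|) ≤ |t| := by
  have := Real.log_le_sub_one_of_pos (by positivity : 0 < 1 + |t|)
  linarith

lemma abs_softLog_sub_le {y : ℝ} (hy : 0 < y) (t s : ℝ) :
    |softLog y (t - s)| ≤
      |Real.log y| + Real.log (1 + y) + Real.log (1 + |t|) + Real.log (1 + |s|) := by
  have h0 := log_le_softLog hy (t - s)
  have h1 := softLog_le_log_add hy (t - s)
  have h2 := log_one_add_abs_sub_le t s
  have h3 : Real.log (|t - s| + y) ≤ Real.log (1 + y) + Real.log (1 + |t - s|) := by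
    rw [← Real.log_mul (by positivity) (by positivity)]
    apply Real.log_le_log (by positivity)
    nlinarith [abs_nonneg (t - s)]
  have h4 := Real.log_nonneg (by linarith : 1 ≤ 1 + y)
  have h5 := log_one_add_abs_nonneg t
  have h6 := log_one_add_abs_nonneg s
  rw [abs_le]
  constructor
  · linarith [neg_abs_le (Real.log y)]
  · linarith [abs_nonneg (Real.log y)]

lemma abs_softLog_sub_softLog_le {y : ℝ} (hy : 0 < y) (u v : ℝ) :
    |softLog y u - softLog y v| ≤ 1 / y * |u - v| := by
  have := Convex.norm_image_sub_le_of_norm_hasDerivWithin_le (s := Set.univ) (C := 1 / y)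
    (fun x _ => (hasDerivAt_softLog hy x).hasDerivWithinAt) (fun x _ => ?_) convex_univ
    (Set.mem_univ v) (Set.mem_univ u)
  · simpa using this
  · rw [Real.norm_eq_abs, abs_div, abs_of_pos (softLog_arg_pos hy x),
      div_le_div_iff₀ (softLog_arg_pos hy x) hy]
    nlinarith [sq_abs x, sq_nonneg (|x| - y), abs_nonneg x]

/-! ### Positive definiteness of the logarithmic kernel -/

/-- The logarithmic moment condition under which the mutual energies below are finite. -/
def HasLogMoment (α : Measure ℝ) : Prop := Integrable (fun t => Real.log (1 + |t|)) α

lemma HasLogMoment.integrable_softLog {α : Measure ℝ} [IsFiniteMeasure α] (hα : HasLogMoment α)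
    {y : ℝ} (hy : 0 < y) (x : ℝ) : Integrable (fun t => softLog y (x - t)) α := by
  refine Integrable.mono' ((integrable_const (|Real.log y| + Real.log (1 + y) +
    Real.log (1 + |x|))).add hα) ?_ (ae_of_all _ fun t => ?_)
  · exact ((continuous_softLog hy).comp (by fun_prop)).aestronglyMeasurable
  · simpa using abs_softLog_sub_le hy x t

lemma HasLogMoment.integrable_softLog_prod {α β : Measure ℝ} [IsFiniteMeasure α]
    [IsFiniteMeasure β] (hα : HasLogMoment α) (hβ : HasLogMoment β) {y : ℝ} (hy : 0 < y) :
    Integrable (fun p : ℝ × ℝ => softLog y (p.1 - p.2)) (α.prod β) := by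
  have h1 : Integrable (fun p : ℝ × ℝ => Real.log (1 + |p.1|)) (α.prod β) := hα.comp_fst β
  have h2 : Integrable (fun p : ℝ × ℝ => Real.log (1 + |p.2|)) (α.prod β) := hβ.comp_snd α
  refine Integrable.mono' (((integrable_const (|Real.log y| + Real.log (1 + y))).add h1).add h2)
    ?_ (ae_of_all _ fun p => ?_)
  · exact ((continuous_softLog hy).comp (by fun_prop)).aestronglyMeasurable
  · simpa using abs_softLog_sub_le hy p.1 p.2

/-- The mutual energy `∬ log |t - s + i y| dα(t) dβ(s)`. -/
noncomputable def mutualEnergy (y : ℝ) (α β : Measure ℝ) : ℝ :=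
  ∫ p : ℝ × ℝ, softLog y (p.1 - p.2) ∂(α.prod β)

/-- The regularized logarithmic energy of the signed measure `α - β`. -/
noncomputable def diffEnergy (y : ℝ) (α β : Measure ℝ) : ℝ :=
  -mutualEnergy y α α + 2 * mutualEnergy y α β - mutualEnergy y β β

lemma integral_exp_neg_mul_cos {a : ℝ} (ha : 0 < a) (d : ℝ) :
    ∫ ξ in Set.Ioi (0 : ℝ), Real.exp (-a * ξ) * Real.cos (d * ξ) = a / (a ^ 2 + d ^ 2) := by
  have hc : ((-a + d * Complex.I : ℂ)).re < 0 := by simpa using ha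
  have h := integral_exp_mul_complex_Ioi hc 0
  have hi := integrableOn_exp_mul_complex_Ioi hc 0
  have h2 := congrArg Complex.re h
  have e := integral_re hi
  simp only [RCLike.re_to_complex] at e
  rw [← e] at h2
  convert h2 using 1
  · refine integral_congr_ae (ae_of_all _ fun ξ => ?_)
    simp [Complex.exp_re]
  · have : (a ^ 2 + d ^ 2) ≠ 0 := by positivity
    simp [Complex.div_re, Complex.normSq_apply]
    field_simp

lemma integrable_exp_neg_mul_cos {a : ℝ} (ha : 0 < a) {γ : Measure (ℝ × ℝ)} [IsFiniteMeasure γ] :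
    Integrable (fun q : (ℝ × ℝ) × ℝ => Real.exp (-a * q.2) * Real.cos ((q.1.1 - q.1.2) * q.2))
      (γ.prod (volume.restrict (Set.Ioi (0 : ℝ)))) := by
  have h1 : Integrable (fun ξ : ℝ => Real.exp (-a * ξ)) (volume.restrict (Set.Ioi (0 : ℝ))) :=
    exp_neg_integrableOn_Ioi 0 ha
  refine Integrable.mono' (h1.comp_snd γ) ?_ (ae_of_all _ fun q => ?_)
  · exact Continuous.aestronglyMeasurable (by fun_prop)
  · rw [Real.norm_eq_abs, abs_mul, Real.abs_exp]
    exact mul_le_of_le_one_right (Real.exp_pos _).le (Real.abs_cos_le_one _)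

lemma integrable_cos_mul (α : Measure ℝ) [IsFiniteMeasure α] (ξ : ℝ) :
    Integrable (fun t => Real.cos (t * ξ)) α :=
  Integrable.of_bound (C := 1) (Continuous.aestronglyMeasurable (by fun_prop))
    (ae_of_all _ fun t => by simpa using Real.abs_cos_le_one _)

lemma integrable_sin_mul (α : Measure ℝ) [IsFiniteMeasure α] (ξ : ℝ) :
    Integrable (fun t => Real.sin (t * ξ)) α :=
  Integrable.of_bound (C := 1) (Continuous.aestronglyMeasurable (by fun_prop))
    (ae_of_all _ fun t => by simpa using Real.abs_sin_le_one _)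

lemma integral_cos_sub_mul (α β : Measure ℝ) [IsFiniteMeasure α] [IsFiniteMeasure β] (ξ : ℝ) :
    ∫ p : ℝ × ℝ, Real.cos ((p.1 - p.2) * ξ) ∂(α.prod β) =
      (∫ t, Real.cos (t * ξ) ∂α) * (∫ t, Real.cos (t * ξ) ∂β) +
      (∫ t, Real.sin (t * ξ) ∂α) * (∫ t, Real.sin (t * ξ) ∂β) := by
  rw [← integral_prod_mul, ← integral_prod_mul, ← integral_add]
  · refine integral_congr_ae (ae_of_all _ fun p => ?_)
    simp only [sub_mul, Real.cos_sub]
  · exact (integrable_cos_mul α ξ).mul_prod (integrable_cos_mul β ξ)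
  · exact (integrable_sin_mul α ξ).mul_prod (integrable_sin_mul β ξ)

/-- The Cauchy energy `∬ a / (a² + (t - s)²) dα(t) dβ(s)`. -/
noncomputable def cauchyEnergy (a : ℝ) (α β : Measure ℝ) : ℝ :=
  ∫ p : ℝ × ℝ, a / (a ^ 2 + (p.1 - p.2) ^ 2) ∂(α.prod β)

/-- Fourier representation of the Cauchy energy. -/
lemma cauchyEnergy_eq {a : ℝ} (ha : 0 < a) (α β : Measure ℝ) [IsFiniteMeasure α]
    [IsFiniteMeasure β] :
    Integrable (fun ξ => Real.exp (-a * ξ) *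
      ((∫ t, Real.cos (t * ξ) ∂α) * (∫ t, Real.cos (t * ξ) ∂β) +
      (∫ t, Real.sin (t * ξ) ∂α) * (∫ t, Real.sin (t * ξ) ∂β)))
      (volume.restrict (Set.Ioi (0 : ℝ))) ∧
    cauchyEnergy a α β = ∫ ξ in Set.Ioi (0 : ℝ), Real.exp (-a * ξ) *
      ((∫ t, Real.cos (t * ξ) ∂α) * (∫ t, Real.cos (t * ξ) ∂β) +
      (∫ t, Real.sin (t * ξ) ∂α) * (∫ t, Real.sin (t * ξ) ∂β)) := by
  have hi := integrable_exp_neg_mul_cos ha (γ := α.prod β)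
  have key : ∀ ξ : ℝ, ∫ p : ℝ × ℝ, Real.exp (-a * ξ) * Real.cos ((p.1 - p.2) * ξ) ∂(α.prod β) =
      Real.exp (-a * ξ) * ((∫ t, Real.cos (t * ξ) ∂α) * (∫ t, Real.cos (t * ξ) ∂β) +
      (∫ t, Real.sin (t * ξ) ∂α) * (∫ t, Real.sin (t * ξ) ∂β)) := fun ξ => by
    rw [integral_const_mul, integral_cos_sub_mul]
  refine ⟨?_, ?_⟩
  · have := hi.integral_prod_right
    simpa only [key] using this
  · simp only [cauchyEnergy, ← integral_exp_neg_mul_cos ha, ← key]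
    exact integral_integral_swap hi

lemma cauchyEnergy_nonneg {a : ℝ} (ha : 0 < a) (α β : Measure ℝ) [IsFiniteMeasure α]
    [IsFiniteMeasure β] :
    0 ≤ cauchyEnergy a α α - 2 * cauchyEnergy a α β + cauchyEnergy a β β := by
  obtain ⟨i1, e1⟩ := cauchyEnergy_eq ha α α
  obtain ⟨i2, e2⟩ := cauchyEnergy_eq ha α β
  obtain ⟨i3, e3⟩ := cauchyEnergy_eq ha β β
  rw [e1, e2, e3, ← integral_const_mul, ← integral_sub i1 (i2.const_mul 2)]
  refine (integral_add (i1.sub (i2.const_mul 2)) i3).le.trans' ?_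
  refine integral_nonneg fun ξ => ?_
  have : 0 ≤ Real.exp (-a * ξ) * (((∫ t, Real.cos (t * ξ) ∂α) - (∫ t, Real.cos (t * ξ) ∂β)) ^ 2 +
      ((∫ t, Real.sin (t * ξ) ∂α) - (∫ t, Real.sin (t * ξ) ∂β)) ^ 2) := by positivity
  simp only [Pi.zero_apply, Pi.sub_apply]
  calc (0 : ℝ) ≤ _ := this
    _ = _ := by ring

lemma integral_cauchyKernel {ε S : ℝ} (hε : 0 < ε) (hS : ε ≤ S) (d : ℝ) :
    ∫ a in ε..S, a / (a ^ 2 + d ^ 2) = softLog S d - softLog ε d := by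
  have hpos : ∀ a ∈ Set.uIcc ε S, 0 < a := fun a ha => by
    rw [Set.uIcc_of_le hS] at ha; exact hε.trans_le ha.1
  refine intervalIntegral.integral_eq_sub_of_hasDerivAt
    (fun a ha => hasDerivAt_softLog_left (hpos a ha) d) ?_
  refine ContinuousOn.intervalIntegrable fun a ha => ?_
  have := hpos a ha
  exact ContinuousAt.continuousWithinAt (by
    refine ContinuousAt.div (by fun_prop) (by fun_prop) (by positivity))

lemma mutualEnergy_sub_mutualEnergy {ε S : ℝ} (hε : 0 < ε) (hS : ε ≤ S) {α β : Measure ℝ}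
    [IsFiniteMeasure α] [IsFiniteMeasure β] (hα : HasLogMoment α) (hβ : HasLogMoment β) :
    IntervalIntegrable (fun a => cauchyEnergy a α β) volume ε S ∧
    mutualEnergy S α β - mutualEnergy ε α β = ∫ a in ε..S, cauchyEnergy a α β := by
  have hi : Integrable (fun q : (ℝ × ℝ) × ℝ => q.2 / (q.2 ^ 2 + (q.1.1 - q.1.2) ^ 2))
      ((α.prod β).prod (volume.restrict (Set.Ioc ε S))) := by
    have hb : ∀ᵐ q ∂((α.prod β).prod (volume.restrict (Set.Ioc ε S))), q.2 ∈ Set.Ioc ε S :=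
      Measure.quasiMeasurePreserving_snd.ae (ae_restrict_mem measurableSet_Ioc)
    refine Integrable.of_bound (C := 1 / ε) (Measurable.aestronglyMeasurable (by fun_prop)) ?_
    filter_upwards [hb] with q hq
    have hq0 : 0 < q.2 := hε.trans hq.1
    rw [Real.norm_eq_abs, abs_of_nonneg (by positivity),
      div_le_div_iff₀ (by positivity) hε]
    nlinarith [hq.1, sq_nonneg (q.1.1 - q.1.2)]
  refine ⟨?_, ?_⟩
  · rw [intervalIntegrable_iff_integrableOn_Ioc_of_le hS]
    exact hi.integral_prod_right
  · unfold mutualEnergy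
    rw [← integral_sub (hα.integrable_softLog_prod hβ (hε.trans_le hS))
      (hα.integrable_softLog_prod hβ hε), intervalIntegral.integral_of_le hS]
    simp only [← integral_cauchyKernel hε hS, intervalIntegral.integral_of_le hS]
    exact integral_integral_swap hi

/-- The regularized energy of `α - β` decreases with the regularization parameter. -/
lemma diffEnergy_antitone {ε S : ℝ} (hε : 0 < ε) (hS : ε ≤ S) {α β : Measure ℝ}
    [IsFiniteMeasure α] [IsFiniteMeasure β] (hα : HasLogMoment α) (hβ : HasLogMoment β) :
    diffEnergy S α β ≤ diffEnergy ε α β := by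
  obtain ⟨i1, e1⟩ := mutualEnergy_sub_mutualEnergy hε hS hα hα
  obtain ⟨i2, e2⟩ := mutualEnergy_sub_mutualEnergy hε hS hα hβ
  obtain ⟨i3, e3⟩ := mutualEnergy_sub_mutualEnergy hε hS hβ hβ
  have h : 0 ≤ ∫ a in ε..S, (cauchyEnergy a α α - 2 * cauchyEnergy a α β + cauchyEnergy a β β) :=
    intervalIntegral.integral_nonneg hS fun a ha => cauchyEnergy_nonneg (hε.trans_le ha.1) α β
  rw [intervalIntegral.integral_add (i1.sub (i2.const_mul 2)) i3,
    intervalIntegral.integral_sub i1 (i2.const_mul 2), intervalIntegral.integral_const_mul,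
    ← e1, ← e2, ← e3] at h
  unfold diffEnergy
  linarith

lemma softLog_sub_log {S : ℝ} (hS : 0 < S) (d : ℝ) :
    softLog S d - Real.log S = 1 / 2 * Real.log (1 + d ^ 2 / S ^ 2) := by
  have : d ^ 2 + S ^ 2 = S ^ 2 * (1 + d ^ 2 / S ^ 2) := by field_simp; ring
  rw [softLog, this, Real.log_mul (by positivity) (by positivity), Real.log_pow]
  push_cast; ring

/-- For large `S` the function `softLog S` is asymptotically the constant `log S`. -/
lemma tendsto_mutualEnergy_sub_log {α β : Measure ℝ}
    [IsFiniteMeasure α] [IsFiniteMeasure β] (hα : HasLogMoment α) (hβ : HasLogMoment β) :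
    Tendsto (fun S => mutualEnergy S α β - α.real Set.univ * β.real Set.univ * Real.log S) atTop
      (𝓝 0) := by
  have h1 : Integrable (fun p : ℝ × ℝ => Real.log (1 + |p.1|)) (α.prod β) := hα.comp_fst β
  have h2 : Integrable (fun p : ℝ × ℝ => Real.log (1 + |p.2|)) (α.prod β) := hβ.comp_snd α
  have key : Tendsto (fun S : ℝ => ∫ p : ℝ × ℝ, (softLog S (p.1 - p.2) - Real.log S) ∂(α.prod β))
      atTop (𝓝 (∫ p : ℝ × ℝ, (0 : ℝ) ∂(α.prod β))) := by
    refine tendsto_integral_filter_of_dominated_convergence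
      (fun p => Real.log (1 + |p.1|) + Real.log (1 + |p.2|)) ?_ ?_ (h1.add h2) ?_
    · filter_upwards [eventually_gt_atTop 0] with S hS
      exact (((continuous_softLog hS).comp (by fun_prop)).sub continuous_const).aestronglyMeasurable
    · filter_upwards [eventually_ge_atTop 1] with S hS
      refine ae_of_all _ fun p => ?_
      have hS0 : 0 < S := by linarith
      have hn := log_le_softLog hS0 (p.1 - p.2)
      rw [Real.norm_eq_abs, abs_of_nonneg (by linarith)]
      refine le_trans ?_ (log_one_add_abs_sub_le p.1 p.2)
      have h3 := softLog_le_log_add hS0 (p.1 - p.2)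
      have h4 : Real.log (|p.1 - p.2| + S) ≤ Real.log S + Real.log (1 + |p.1 - p.2|) := by
        rw [← Real.log_mul (by positivity) (by positivity)]
        apply Real.log_le_log (by positivity)
        nlinarith [abs_nonneg (p.1 - p.2)]
      linarith
    · refine ae_of_all _ fun p => ?_
      have : Tendsto (fun S : ℝ => 1 / 2 * Real.log (1 + (p.1 - p.2) ^ 2 / S ^ 2)) atTop
          (𝓝 (1 / 2 * Real.log (1 + 0))) := by
        refine Tendsto.const_mul _ (Tendsto.log ?_ (by norm_num))
        exact tendsto_const_nhds.add (tendsto_const_nhds.div_atTop (tendsto_pow_atTop two_ne_zero))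
      simp only [add_zero, Real.log_one, mul_zero] at this
      refine this.congr' ?_
      filter_upwards [eventually_gt_atTop 0] with S hS
      rw [softLog_sub_log hS]
  simp only [integral_zero] at key
  refine key.congr' ?_
  filter_upwards [eventually_gt_atTop 0] with S hS
  rw [integral_sub (hα.integrable_softLog_prod hβ hS) (integrable_const _), integral_const,
    mutualEnergy, smul_eq_mul, ← Set.univ_prod_univ, measureReal_prod_prod]

/-- The kernel `-log |t - s + i y|` is positive definite on signed measures of total mass zero: the
energy decreases in `y`, and it tends to zero as `y → ∞`. -/
lemma diffEnergy_nonneg {y : ℝ} (hy : 0 < y) {α β : Measure ℝ}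
    [IsFiniteMeasure α] [IsFiniteMeasure β] (hα : HasLogMoment α) (hβ : HasLogMoment β)
    (hm : α Set.univ = β Set.univ) : 0 ≤ diffEnergy y α β := by
  have hm' : α.real Set.univ = β.real Set.univ := by simp [measureReal_def, hm]
  have t1 := tendsto_mutualEnergy_sub_log hα hα
  have t2 := tendsto_mutualEnergy_sub_log hα hβ
  have t3 := tendsto_mutualEnergy_sub_log hβ hβ
  have t : Tendsto (fun S => diffEnergy S α β) atTop (𝓝 0) := by
    have := (t1.neg.add (t2.const_mul 2)).sub t3
    simp only [neg_zero, mul_zero, add_zero, sub_zero] at this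
    refine this.congr fun S => ?_
    rw [diffEnergy, hm']; ring
  refine le_of_tendsto t ?_
  filter_upwards [eventually_ge_atTop y] with S hS using diffEnergy_antitone hy hS hα hβ

/-! ### Weak convergence from one-sided bounds on logarithmic potentials -/

lemma integral_softLog_sub {y : ℝ} (hy : 0 < y) (R t : ℝ) :
    ∫ x in -R..R, softLog y (x - t) = (∫ x in -R..R, softLog y x) +
      ∫ s in 0..t, (softLog y (R + s) - softLog y (R - s)) := by
  have hc := continuous_softLog hy
  have hi : ∀ a b : ℝ, IntervalIntegrable (softLog y) volume a b :=
    fun a b => hc.intervalIntegrable a b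
  have e1 : ∫ s in 0..t, softLog y (R + s) = ∫ s in R..R + t, softLog y s := by
    simp
  have e2 : ∫ s in 0..t, softLog y (R - s) = ∫ s in R - t..R, softLog y s := by
    simp
  have e3 : ∫ s in R..R + t, softLog y s = ∫ s in -R - t..-R, softLog y s := by
    have := intervalIntegral.integral_comp_neg (a := R) (b := R + t) (softLog y)
    simp only [softLog_neg] at this
    rw [this, neg_add, sub_eq_add_neg]
  have e0 : ∫ s in 0..t, (softLog y (R + s) - softLog y (R - s)) =
      (∫ s in 0..t, softLog y (R + s)) - ∫ s in 0..t, softLog y (R - s) :=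
    intervalIntegral.integral_sub
      ((hc.comp (continuous_const.add continuous_id)).intervalIntegrable _ _)
      ((hc.comp (continuous_const.sub continuous_id)).intervalIntegrable _ _)
  rw [intervalIntegral.integral_comp_sub_right, e0, e1, e2, e3,
    ← intervalIntegral.integral_add_adjacent_intervals (hi (-R - t) (-R)) (hi (-R) (R - t)),
    ← intervalIntegral.integral_add_adjacent_intervals (hi (-R) (R - t)) (hi (R - t) R)]
  ring

lemma integral_softLog_add_sub_abs (y R t : ℝ) :
    ∫ s in 0..t, (softLog y (R + s) - softLog y (R - s)) =
      ∫ s in 0..|t|, (softLog y (R + s) - softLog y (R - s)) := by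
  rcases abs_choice t with h | h
  · rw [h]
  · rw [h]
    have := intervalIntegral.integral_comp_neg (a := 0) (b := t)
      (fun s => softLog y (R + s) - softLog y (R - s))
    simp only [neg_zero] at this
    rw [intervalIntegral.integral_symm (-t) 0, ← this, ← intervalIntegral.integral_neg]
    congr 1
    funext s
    rw [sub_neg_eq_add, ← sub_eq_add_neg]
    ring

/-- Among all translates, the average of `softLog y` over a centred interval is smallest for the
trivial one. -/
lemma integral_softLog_le_integral_softLog_sub {y R : ℝ} (hy : 0 < y) (hR : 0 ≤ R) (t : ℝ) :
    ∫ x in -R..R, softLog y x ≤ ∫ x in -R..R, softLog y (x - t) := by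
  rw [integral_softLog_sub hy, integral_softLog_add_sub_abs]
  have : 0 ≤ ∫ s in 0..|t|, (softLog y (R + s) - softLog y (R - s)) := by
    refine intervalIntegral.integral_nonneg (abs_nonneg t) fun s hs => ?_
    have : softLog y (R - s) ≤ softLog y (R + s) :=
      softLog_le_softLog_of_abs_le hy (abs_le_abs (by linarith [hs.1]) (by linarith [hs.1]))
    linarith
  linarith

lemma softLog_sub_softLog_le_div {y u v : ℝ} (hy : 0 < y) (hu : u ≠ 0) (huv : u ^ 2 ≤ v ^ 2) :
    softLog y v - softLog y u ≤ 1 / 2 * ((v ^ 2 - u ^ 2) / u ^ 2) := by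
  have h1 := softLog_arg_pos hy u
  have h2 := softLog_arg_pos hy v
  have h : Real.log (v ^ 2 + y ^ 2) - Real.log (u ^ 2 + y ^ 2) ≤ (v ^ 2 - u ^ 2) / u ^ 2 := by
    rw [← Real.log_div h2.ne' h1.ne']
    refine (Real.log_le_sub_one_of_pos (by positivity)).trans ?_
    rw [div_sub_one h1.ne']
    have : 0 < u ^ 2 := by positivity
    calc (v ^ 2 + y ^ 2 - (u ^ 2 + y ^ 2)) / (u ^ 2 + y ^ 2) = (v ^ 2 - u ^ 2) / (u ^ 2 + y ^ 2) := by
          ring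
      _ ≤ _ := by
        apply div_le_div_of_nonneg_left (by linarith) this
        nlinarith [sq_nonneg y]
  unfold softLog; linarith

/-- The gain under a bounded translation is small when the interval is long. -/
lemma integral_softLog_sub_le {y R B t : ℝ} (hy : 0 < y) (hBR : B < R) (ht : |t| ≤ B) :
    ∫ x in -R..R, softLog y (x - t) ≤ (∫ x in -R..R, softLog y x) + 2 * B ^ 2 * R / (R - B) ^ 2 := by
  have hB : 0 ≤ B := (abs_nonneg t).trans ht
  have hRB : 0 < R - B := by linarith
  rw [integral_softLog_sub hy, integral_softLog_add_sub_abs]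
  have : ‖∫ s in 0..|t|, (softLog y (R + s) - softLog y (R - s))‖ ≤
      2 * B * R / (R - B) ^ 2 * |(|t| - 0)| := by
    refine intervalIntegral.norm_integral_le_of_norm_le_const fun s hs => ?_
    rw [Set.uIoc_of_le (abs_nonneg t)] at hs
    have hs0 := hs.1
    have hsB := hs.2.trans ht
    have h1 : softLog y (R - s) ≤ softLog y (R + s) :=
      softLog_le_softLog_of_abs_le hy (abs_le_abs (by linarith) (by linarith))
    rw [Real.norm_eq_abs, abs_of_nonneg (by linarith)]
    refine (softLog_sub_softLog_le_div hy (by linarith) (by nlinarith)).trans ?_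
    have h3 : 0 < R - s := by linarith
    rw [← mul_div_assoc, div_le_div_iff₀ (by positivity) (by positivity)]
    have h4 : (R - B) ^ 2 ≤ (R - s) ^ 2 := by gcongr
    have h5 : 1 / 2 * ((R + s) ^ 2 - (R - s) ^ 2) ≤ 2 * B * R := by nlinarith
    exact mul_le_mul h5 h4 (by positivity) (by nlinarith)
  rw [sub_zero, abs_abs] at this
  have h2 := (le_abs_self _).trans this
  have h3 : 2 * B * R / (R - B) ^ 2 * |t| ≤ 2 * B * R / (R - B) ^ 2 * B := by
    gcongr
    have : 0 ≤ R := by linarith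
    positivity
  have h4 : 2 * B * R / (R - B) ^ 2 * B = 2 * B ^ 2 * R / (R - B) ^ 2 := by ring
  linarith

/-- The regularized logarithmic potential `x ↦ ∫ log |x - t + i y| dα(t)`. -/
noncomputable def softPotential (y : ℝ) (α : Measure ℝ) (x : ℝ) : ℝ := ∫ t, softLog y (x - t) ∂α

lemma abs_softPotential_sub_le {y : ℝ} (hy : 0 < y) {α : Measure ℝ} [IsProbabilityMeasure α]
    (hα : HasLogMoment α) (x x' : ℝ) :
    |softPotential y α x - softPotential y α x'| ≤ 1 / y * |x - x'| := by
  unfold softPotential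
  rw [← integral_sub (hα.integrable_softLog hy x) (hα.integrable_softLog hy x')]
  have := norm_integral_le_of_norm_le_const (μ := α)
    (f := fun t => softLog y (x - t) - softLog y (x' - t)) (C := 1 / y * |x - x'|)
    (ae_of_all _ fun t => ?_)
  · simpa using this
  · have := abs_softLog_sub_softLog_le hy (x - t) (x' - t)
    simpa using this

lemma continuous_softPotential {y : ℝ} (hy : 0 < y) {α : Measure ℝ} [IsProbabilityMeasure α]
    (hα : HasLogMoment α) : Continuous (softPotential y α) := by
  have : LipschitzWith (Real.toNNReal (1 / y)) (softPotential y α) :=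
    LipschitzWith.of_dist_le_mul fun x x' => by
      rw [Real.dist_eq, Real.dist_eq, Real.coe_toNNReal _ (by positivity)]
      exact abs_softPotential_sub_le hy hα x x'
  exact this.continuous

lemma integrable_mul_softLog_prod {y : ℝ} (hy : 0 < y) {α : Measure ℝ} [IsProbabilityMeasure α]
    (hα : HasLogMoment α) {f : ℝ → ℝ} {S : ℝ} {M : ℝ} (hf : Measurable f) (hM : ∀ x, |f x| ≤ M) :
    Integrable (fun p : ℝ × ℝ => f p.1 * softLog y (p.1 - p.2))
      ((volume.restrict (Set.Ioc (-S) S)).prod α) := by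
  have hβ : HasLogMoment (volume.restrict (Set.Ioc (-S) S)) := by
    have : Continuous fun t : ℝ => Real.log (1 + |t|) :=
      Continuous.log (by fun_prop) fun t => by positivity
    exact (this.integrableOn_Icc (a := -S) (b := S)).mono_set Set.Ioc_subset_Icc_self
  refine (hβ.integrable_softLog_prod hα hy).bdd_mul (c := M) ?_ (ae_of_all _ fun p => ?_)
  · exact (hf.comp measurable_fst).aestronglyMeasurable
  · exact hM p.1

lemma integral_mul_softPotential {y : ℝ} (hy : 0 < y) {α : Measure ℝ} [IsProbabilityMeasure α]
    (hα : HasLogMoment α) {f : ℝ → ℝ} {S : ℝ} {M : ℝ} (hf : Measurable f) (hM : ∀ x, |f x| ≤ M)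
    (hS : 0 ≤ S) :
    Integrable (fun t => ∫ x in -S..S, f x * softLog y (x - t)) α ∧
    ∫ x in -S..S, f x * softPotential y α x = ∫ t, (∫ x in -S..S, f x * softLog y (x - t)) ∂α := by
  have hi := integrable_mul_softLog_prod hy hα (S := S) hf hM
  have hS' : -S ≤ S := by linarith
  simp only [intervalIntegral.integral_of_le hS', softPotential]
  refine ⟨hi.integral_prod_right, ?_⟩
  simp only [← integral_const_mul]
  exact integral_integral_swap (f := fun x t => f x * softLog y (x - t)) hi

/-- Over a long interval, the potential of a compactly supported `μ` is on average at most the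
potential of any other probability measure, up to a small error. -/
lemma integral_softPotential_sub_le {y R B : ℝ} (hy : 0 < y) {μ ν : Measure ℝ}
    [IsProbabilityMeasure μ] [IsProbabilityMeasure ν] (hB : 0 ≤ B) (hμB : ∀ᵐ t ∂μ, |t| ≤ B)
    (hμ : HasLogMoment μ) (hν : HasLogMoment ν) (hBR : B < R) :
    ∫ x in -R..R, (softPotential y μ x - softPotential y ν x) ≤
      2 * B ^ 2 * R / (R - B) ^ 2 := by
  have hR : 0 ≤ R := hB.trans hBR.le
  obtain ⟨i1, e1⟩ := integral_mul_softPotential hy hμ (f := fun _ => 1) (M := 1) (S := R)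
    measurable_const (by simp) hR
  obtain ⟨i2, e2⟩ := integral_mul_softPotential hy hν (f := fun _ => 1) (M := 1) (S := R)
    measurable_const (by simp) hR
  simp only [one_mul] at i1 i2 e1 e2
  rw [intervalIntegral.integral_sub ((continuous_softPotential hy hμ).intervalIntegrable _ _)
    ((continuous_softPotential hy hν).intervalIntegrable _ _), e1, e2]
  have h1 : ∫ t, (∫ x in -R..R, softLog y (x - t)) ∂μ ≤
      ∫ t, ((∫ x in -R..R, softLog y x) + 2 * B ^ 2 * R / (R - B) ^ 2) ∂μ := by
    refine integral_mono_ae i1 (integrable_const _) ?_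
    filter_upwards [hμB] with t ht using integral_softLog_sub_le hy hBR ht
  have h2 : ∫ t, (∫ x in -R..R, softLog y x) ∂ν ≤ ∫ t, (∫ x in -R..R, softLog y (x - t)) ∂ν :=
    integral_mono (integrable_const _) i2 fun t =>
      integral_softLog_le_integral_softLog_sub hy hR t
  simp only [integral_const, probReal_univ, one_smul] at h1 h2
  linarith

section Convergence

variable {ν : ℕ → Measure ℝ} [∀ n, IsProbabilityMeasure (ν n)] {μ : Measure ℝ}
  [IsProbabilityMeasure μ]

lemma tendsto_integral_negPart_softPotential_sub {y : ℝ} (hy : 0 < y)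
    (hμ : HasLogMoment μ) (hν : ∀ n, HasLogMoment (ν n))
    (h : ∀ x τ, 0 < τ → ∀ᶠ n in atTop, softPotential y (ν n) x ≤ softPotential y μ x + τ)
    {R : ℝ} (hR : 0 ≤ R) :
    Tendsto (fun n => ∫ x in -R..R, max 0 (softPotential y (ν n) x - softPotential y μ x))
      atTop (𝓝 0) := by
  have key : Tendsto (fun n => ∫ x in -R..R,
      max 0 (softPotential y (ν n) x - softPotential y μ x)) atTop
      (𝓝 (∫ x in -R..R, (0 : ℝ))) := by
    refine intervalIntegral.tendsto_integral_filter_of_dominated_convergence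
      (fun _ => 1 + 2 * (1 / y * R)) ?_ ?_ (by simp) ?_
    · refine Eventually.of_forall fun n => Continuous.aestronglyMeasurable ?_
      have h1 := continuous_softPotential hy (hν n)
      have h2 := continuous_softPotential hy hμ
      fun_prop
    · filter_upwards [h 0 1 one_pos] with n hn
      refine ae_of_all _ fun x hx => ?_
      rw [Set.uIoc_of_le (by linarith)] at hx
      have hx' : |x - 0| ≤ R := by rw [sub_zero]; exact abs_le.2 ⟨hx.1.le, hx.2⟩
      have h1 := abs_softPotential_sub_le hy (hν n) x 0
      have h2 := abs_softPotential_sub_le hy hμ x 0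
      have h3 : 1 / y * |x - 0| ≤ 1 / y * R := by gcongr
      rw [Real.norm_eq_abs, abs_of_nonneg (le_max_left _ _)]
      have h4 : 0 ≤ 1 / y * R := by positivity
      refine max_le (by linarith) ?_
      linarith [(abs_le.1 h1).2, (abs_le.1 h2).1]
    · refine ae_of_all _ fun x _ => ?_
      rw [Metric.tendsto_atTop]
      intro τ hτ
      obtain ⟨N, hN⟩ := eventually_atTop.1 (h x (τ / 2) (by positivity))
      refine ⟨N, fun n hn => ?_⟩
      rw [Real.dist_eq, sub_zero, abs_of_nonneg (le_max_left _ _)]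
      exact max_lt hτ (by linarith [hN n hn])
  simpa using key

lemma tendsto_mul_div_sq (B M : ℝ) :
    Tendsto (fun R : ℝ => M * (2 * B ^ 2 * R / (R - B) ^ 2)) atTop (𝓝 0) := by
  have h1 : Tendsto (fun R : ℝ => R - B) atTop atTop := tendsto_atTop_add_const_right _ _ tendsto_id
  have h2 : Tendsto (fun R : ℝ => M * (2 * B ^ 2 * ((1 + B * (R - B)⁻¹) * (R - B)⁻¹))) atTop
      (𝓝 (M * (2 * B ^ 2 * ((1 + B * 0) * 0)))) := by
    have := h1.inv_tendsto_atTop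
    exact (((tendsto_const_nhds.add (this.const_mul B)).mul this).const_mul _).const_mul _
  simp only [mul_zero] at h2
  refine h2.congr' ?_
  filter_upwards [eventually_gt_atTop B] with R hR
  have : R - B ≠ 0 := by linarith
  field_simp
  ring

/-- If the potentials of `ν n` are asymptotically at most that of `μ`, then their difference tends
to zero when tested against compactly supported functions. -/
lemma tendsto_integral_mul_softPotential_sub {y B : ℝ} (hy : 0 < y) (hB : 0 ≤ B)
    (hμB : ∀ᵐ t ∂μ, |t| ≤ B) (hμ : HasLogMoment μ) (hν : ∀ n, HasLogMoment (ν n))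
    (h : ∀ x τ, 0 < τ → ∀ᶠ n in atTop, softPotential y (ν n) x ≤ softPotential y μ x + τ)
    {f : ℝ → ℝ} {M S : ℝ} (hM : ∀ x, |f x| ≤ M)
    (hS : ∀ x, S < |x| → f x = 0) :
    Tendsto (fun n => ∫ x, f x * (softPotential y μ x - softPotential y (ν n) x)) atTop
      (𝓝 0) := by
  have hM0 : 0 ≤ M := (abs_nonneg _).trans (hM 0)
  rw [Metric.tendsto_atTop]
  intro δ hδ
  obtain ⟨R, ⟨hR1, hRB⟩, hRS⟩ := (((tendsto_mul_div_sq B M).eventually_lt_const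
    (half_pos hδ)).and (eventually_gt_atTop B)).and (eventually_gt_atTop S) |>.exists
  have hR : 0 < R := hB.trans_lt hRB
  have ht := (tendsto_integral_negPart_softPotential_sub hy hμ hν h hR.le).const_mul (M * 2)
  rw [mul_zero] at ht
  obtain ⟨N, hN⟩ := eventually_atTop.1 (ht.eventually_lt_const (half_pos hδ))
  refine ⟨N, fun n hn => ?_⟩
  have c1 := continuous_softPotential hy hμ
  have c2 := continuous_softPotential hy (hν n)
  have e : ∫ x, f x * (softPotential y μ x - softPotential y (ν n) x) =
      ∫ x in -R..R, f x * (softPotential y μ x - softPotential y (ν n) x) := by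
    rw [intervalIntegral.integral_of_le (by linarith)]
    refine (setIntegral_eq_integral_of_forall_compl_eq_zero fun x hx => ?_).symm
    by_cases hxR : x = -R
    · rw [hS x (by rw [hxR, abs_neg, abs_of_pos hR]; exact hRS), zero_mul]
    · rw [hS x ?_, zero_mul]
      refine hRS.trans ?_
      by_contra hc
      obtain ⟨h1, h2⟩ := abs_le.1 (not_lt.1 hc)
      exact hx ⟨lt_of_le_of_ne h1 (Ne.symm hxR), h2⟩
  rw [dist_zero_right, e]
  -- `|g| = g + 2 g⁻`: the integral of `g` is small by the choice of `R`, that of `g⁻` by assumption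
  have hb : ‖∫ x in -R..R, f x * (softPotential y μ x - softPotential y (ν n) x)‖ ≤
      ∫ x in -R..R, (M * (softPotential y μ x - softPotential y (ν n) x) +
        M * 2 * max 0 (softPotential y (ν n) x - softPotential y μ x)) := by
    refine intervalIntegral.norm_integral_le_of_norm_le (by linarith) (ae_of_all _ fun x _ => ?_)
      (Continuous.intervalIntegrable (by fun_prop) _ _)
    rw [norm_mul, Real.norm_eq_abs, Real.norm_eq_abs]
    have h1 : |softPotential y μ x - softPotential y (ν n) x| =
        (softPotential y μ x - softPotential y (ν n) x) +
        2 * max 0 (softPotential y (ν n) x - softPotential y μ x) := by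
      rcases le_total (softPotential y (ν n) x) (softPotential y μ x) with h | h
      · rw [abs_of_nonneg (by linarith), max_eq_left (by linarith)]; ring
      · rw [abs_of_nonpos (by linarith), max_eq_right (by linarith)]; ring
    calc _ ≤ M * |softPotential y μ x - softPotential y (ν n) x| := by gcongr; exact hM x
      _ = _ := by rw [h1]; ring
  rw [intervalIntegral.integral_add (Continuous.intervalIntegrable (by fun_prop) _ _)
    (Continuous.intervalIntegrable (by fun_prop) _ _), intervalIntegral.integral_const_mul,
    intervalIntegral.integral_const_mul] at hb
  have h3 := mul_le_mul_of_nonneg_left (integral_softPotential_sub_le hy hB hμB hμ (hν n) hRB) hM0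
  have h4 := hN n hn
  linarith

end Convergence

/-! ### Approximate identities built from the regularized logarithm -/

/-- The difference `log |u + 2 i| - log |u + i|`, an integrable positive bump. -/
noncomputable def softBump (u : ℝ) : ℝ := softLog 2 u - softLog 1 u

lemma continuous_softBump : Continuous softBump :=
  (continuous_softLog two_pos).sub (continuous_softLog one_pos)

lemma softBump_pos (u : ℝ) : 0 < softBump u := by
  have := Real.log_lt_log (softLog_arg_pos one_pos u)
    (by norm_num : u ^ 2 + 1 ^ 2 < u ^ 2 + 2 ^ 2)
  exact sub_pos.2 (mul_lt_mul_of_pos_left this (by norm_num))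

lemma softBump_le (u : ℝ) : softBump u ≤ 3 / 2 * (1 + u ^ 2)⁻¹ := by
  have h1 := softLog_arg_pos one_pos u
  have h2 := softLog_arg_pos two_pos u
  have h3 := Real.log_le_sub_one_of_pos (div_pos h2 h1)
  rw [Real.log_div h2.ne' h1.ne', div_sub_one h1.ne'] at h3
  have h4 : (u ^ 2 + 2 ^ 2 - (u ^ 2 + 1 ^ 2)) / (u ^ 2 + 1 ^ 2) = 3 * (1 + u ^ 2)⁻¹ := by
    have : 1 + u ^ 2 ≠ 0 := by positivity
    rw [add_comm (u ^ 2) (1 ^ 2), one_pow]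
    field_simp
    ring
  unfold softBump softLog; linarith

lemma integrable_softBump : Integrable softBump := by
  refine Integrable.mono' (integrable_inv_one_add_sq.const_mul (3 / 2))
    continuous_softBump.aestronglyMeasurable (ae_of_all _ fun u => ?_)
  rw [Real.norm_eq_abs, abs_of_pos (softBump_pos u)]
  exact softBump_le u

lemma integral_softBump_pos : 0 < ∫ u, softBump u := by
  rw [integral_pos_iff_support_of_nonneg (fun u => (softBump_pos u).le) integrable_softBump]
  have : Function.support softBump = Set.univ :=
    Set.eq_univ_of_forall fun u => (softBump_pos u).ne'
  simp [this]

lemma softBump_div {ε : ℝ} (hε : 0 < ε) (u : ℝ) :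
    softBump (u / ε) = softLog (2 * ε) u - softLog ε u := by
  have e1 : (u / ε) ^ 2 + 2 ^ 2 = (u ^ 2 + (2 * ε) ^ 2) / ε ^ 2 := by field_simp
  have e2 : (u / ε) ^ 2 + 1 ^ 2 = (u ^ 2 + ε ^ 2) / ε ^ 2 := by field_simp
  rw [softBump, softLog, softLog, softLog, softLog, e1, e2, Real.log_div (by positivity)
    (by positivity), Real.log_div (by positivity) (by positivity)]
  ring

lemma tendsto_setIntegral_softBump_tail {δ : ℝ} (hδ : 0 < δ) :
    Tendsto (fun ε : ℝ => ∫ v, Set.indicator {v : ℝ | δ ≤ ε * |v|} softBump v) (𝓝[>] 0) (𝓝 0) := by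
  have key : Tendsto (fun ε : ℝ => ∫ v, Set.indicator {v : ℝ | δ ≤ ε * |v|} softBump v) (𝓝[>] 0)
      (𝓝 (∫ _ : ℝ, (0 : ℝ))) := by
    refine tendsto_integral_filter_of_dominated_convergence softBump ?_ ?_ integrable_softBump ?_
    · refine Eventually.of_forall fun ε => ?_
      exact continuous_softBump.aestronglyMeasurable.indicator
        (measurableSet_le measurable_const (by fun_prop))
    · refine Eventually.of_forall fun ε => ae_of_all _ fun v => ?_
      refine (norm_indicator_le_norm_self _ _).trans ?_
      rw [Real.norm_eq_abs, abs_of_pos (softBump_pos v)]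
    · refine ae_of_all _ fun v => ?_
      have : Tendsto (fun ε : ℝ => ε * |v|) (𝓝[>] 0) (𝓝 (0 * |v|)) :=
        (tendsto_id.mono_left nhdsWithin_le_nhds).mul_const _
      rw [zero_mul] at this
      refine tendsto_const_nhds.congr' ?_
      filter_upwards [this.eventually_lt_const hδ] with ε hε
      rw [Set.indicator_of_notMem (by simpa using hε)]
  simpa using key

/-- Rescaled bumps form an approximate identity. -/
lemma exists_abs_integral_mul_softBump_sub_le {f : ℝ → ℝ} (hf : UniformContinuous f) {M : ℝ}
    (hM : ∀ x, |f x| ≤ M) {η : ℝ} (hη : 0 < η) :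
    ∃ ε > 0, ∀ t, |(∫ x, f x * softBump ((x - t) / ε)) - ε * (∫ u, softBump u) * f t| ≤
      ε * (∫ u, softBump u) * η := by
  set c := ∫ u, softBump u with hc
  have hc0 : 0 < c := integral_softBump_pos
  have hM0 : 0 ≤ M := (abs_nonneg _).trans (hM 0)
  obtain ⟨δ, hδ, hfδ⟩ := Metric.uniformContinuous_iff.1 hf (η / 2) (by positivity)
  have ht := (tendsto_setIntegral_softBump_tail hδ).const_mul (2 * M)
  rw [mul_zero] at ht
  obtain ⟨ε, hε1, hε⟩ := ((ht.eventually_lt_const (by positivity : 0 < c * (η / 2))).and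
    self_mem_nhdsWithin).exists
  have hε0 : 0 < ε := hε
  refine ⟨ε, hε0, fun t => ?_⟩
  have hfm : AEStronglyMeasurable (fun v => f (ε * v + t)) volume :=
    (hf.continuous.comp (by fun_prop)).aestronglyMeasurable
  have i1 : Integrable fun v => f (ε * v + t) * softBump v :=
    integrable_softBump.bdd_mul hfm (ae_of_all _ fun v => hM _)
  have i2 : Integrable fun v => f t * softBump v := integrable_softBump.const_mul _
  have e1 : ∫ x, f x * softBump ((x - t) / ε) = ε * ∫ v, f (ε * v + t) * softBump v := by
    have h1 := integral_sub_right_eq_self (μ := volume) (fun x => f (x + t) * softBump (x / ε)) t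
    simp only [sub_add_cancel] at h1
    rw [h1]
    have h2 := Measure.integral_comp_div (fun v => f (ε * v + t) * softBump v) ε
    rw [abs_of_pos hε0, smul_eq_mul] at h2
    rw [← h2]
    refine integral_congr_ae (ae_of_all _ fun x => ?_)
    simp only
    rw [mul_div_cancel₀ _ hε0.ne']
  have e2 : (∫ x, f x * softBump ((x - t) / ε)) - ε * c * f t =
      ε * ∫ v, (f (ε * v + t) - f t) * softBump v := by
    have : ∫ v, (f (ε * v + t) - f t) * softBump v =
        (∫ v, f (ε * v + t) * softBump v) - f t * c := by
      rw [hc, ← integral_const_mul, ← integral_sub i1 i2]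
      simp only [sub_mul]
    rw [e1, this]; ring
  rw [e2, abs_mul, abs_of_pos hε0, mul_assoc]
  refine mul_le_mul_of_nonneg_left ?_ hε0.le
  have hI : Integrable fun v => Set.indicator {v : ℝ | δ ≤ ε * |v|} softBump v :=
    integrable_softBump.indicator (measurableSet_le measurable_const (by fun_prop))
  have hb : ‖∫ v, (f (ε * v + t) - f t) * softBump v‖ ≤
      ∫ v, (η / 2 * softBump v + 2 * M * Set.indicator {v : ℝ | δ ≤ ε * |v|} softBump v) := by
    refine norm_integral_le_of_norm_le ((integrable_softBump.const_mul _).add (hI.const_mul _))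
      (ae_of_all _ fun v => ?_)
    rw [norm_mul, Real.norm_eq_abs, Real.norm_eq_abs, abs_of_pos (softBump_pos v)]
    have hpos := (softBump_pos v).le
    by_cases hv : δ ≤ ε * |v|
    · rw [Set.indicator_of_mem (by exact hv)]
      have : |f (ε * v + t) - f t| ≤ 2 * M := by
        have := abs_sub (f (ε * v + t)) (f t)
        linarith [hM (ε * v + t), hM t]
      have := mul_le_mul_of_nonneg_right this hpos
      have : 0 ≤ η / 2 * softBump v := by positivity
      linarith
    · rw [Set.indicator_of_notMem (by exact hv), mul_zero, add_zero]
      refine mul_le_mul_of_nonneg_right ?_ hpos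
      have := hfδ (a := ε * v + t) (b := t) (by
        rw [Real.dist_eq, add_sub_cancel_right, abs_mul, abs_of_pos hε0]; exact not_le.1 hv)
      rw [Real.dist_eq] at this
      exact this.le
  rw [integral_add (integrable_softBump.const_mul _) (hI.const_mul _), integral_const_mul,
    integral_const_mul] at hb
  rw [Real.norm_eq_abs] at hb
  linarith

/-! ### Weak convergence -/

/-- Testing against a rescaled bump is a difference of potentials at two heights. -/
lemma integral_mul_softBump {ε : ℝ} (hε : 0 < ε) {α : Measure ℝ} [IsProbabilityMeasure α]
    (hα : HasLogMoment α) {f : ℝ → ℝ} {S : ℝ} {M : ℝ} (hf : Continuous f) (hM : ∀ x, |f x| ≤ M)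
    (hS0 : 0 ≤ S) (hS : ∀ x, x ∉ Set.Ioc (-S) S → f x = 0) :
    Integrable (fun t => ∫ x, f x * softBump ((x - t) / ε)) α ∧
    ∫ x, f x * (softPotential (2 * ε) α x - softPotential ε α x) =
      ∫ t, (∫ x, f x * softBump ((x - t) / ε)) ∂α := by
  have h2 : 0 < 2 * ε := by positivity
  obtain ⟨i1, e1⟩ := integral_mul_softPotential h2 hα (S := S) hf.measurable hM hS0
  obtain ⟨i2, e2⟩ := integral_mul_softPotential hε hα (S := S) hf.measurable hM hS0
  have hS' : -S ≤ S := by linarith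
  have hsupp : ∀ g : ℝ → ℝ, ∫ x, f x * g x = ∫ x in -S..S, f x * g x := fun g => by
    rw [intervalIntegral.integral_of_le hS']
    exact (setIntegral_eq_integral_of_forall_compl_eq_zero fun x hx => by
      rw [hS x hx, zero_mul]).symm
  have c1 := continuous_softPotential h2 hα
  have c2 := continuous_softPotential hε hα
  have e3 : ∀ t, ∫ x, f x * softBump ((x - t) / ε) =
      (∫ x in -S..S, f x * softLog (2 * ε) (x - t)) - ∫ x in -S..S, f x * softLog ε (x - t) := by
    intro t
    have d1 : Continuous fun x => softLog (2 * ε) (x - t) :=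
      (continuous_softLog h2).comp (continuous_id.sub continuous_const)
    have d2 : Continuous fun x => softLog ε (x - t) :=
      (continuous_softLog hε).comp (continuous_id.sub continuous_const)
    rw [hsupp]
    refine Eq.trans ?_ (intervalIntegral.integral_sub ((hf.mul d1).intervalIntegrable _ _)
      ((hf.mul d2).intervalIntegrable _ _))
    simp only [softBump_div hε, mul_sub]
  simp only [e3]
  refine ⟨i1.sub i2, ?_⟩
  rw [hsupp, integral_sub i1 i2, ← e1, ← e2]
  refine Eq.trans ?_ (intervalIntegral.integral_sub
    ((hf.mul c1).intervalIntegrable _ _) ((hf.mul c2).intervalIntegrable _ _))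
  simp only [mul_sub]

/-- **Convergence from upper bounds on potentials.** If the regularized logarithmic potentials of
the probability measures `ν n` are asymptotically at most those of a compactly supported `μ`, then
`ν n` converges to `μ` when tested against compactly supported continuous functions. -/
theorem tendsto_integral_of_softPotential_le {ν : ℕ → Measure ℝ} [∀ n, IsProbabilityMeasure (ν n)]
    {μ : Measure ℝ} [IsProbabilityMeasure μ] {B : ℝ} (hB : 0 ≤ B)
    (hμB : ∀ᵐ t ∂μ, |t| ≤ B) (hμ : HasLogMoment μ) (hν : ∀ n, HasLogMoment (ν n))
    (h : ∀ y, 0 < y → ∀ x τ, 0 < τ →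
      ∀ᶠ n in atTop, softPotential y (ν n) x ≤ softPotential y μ x + τ)
    {f : ℝ → ℝ} (hf : Continuous f) (hfc : HasCompactSupport f) :
    Tendsto (fun n => ∫ t, f t ∂(ν n)) atTop (𝓝 (∫ t, f t ∂μ)) := by
  obtain ⟨M, hM⟩ : ∃ M, ∀ x, |f x| ≤ M := by
    obtain ⟨M, hM⟩ := hfc.exists_bound_of_continuous hf
    exact ⟨M, hM⟩
  obtain ⟨S, hS0, hS⟩ : ∃ S, 0 ≤ S ∧ ∀ x, S ≤ |x| → f x = 0 := by
    obtain ⟨S, hS⟩ := hfc.isBounded.exists_norm_le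
    refine ⟨|S| + 1, by positivity, fun x hx => ?_⟩
    by_contra h0
    have := hS x (subset_tsupport _ h0)
    rw [Real.norm_eq_abs] at this
    linarith [le_abs_self S]
  have hSI : ∀ x, x ∉ Set.Ioc (-S) S → f x = 0 := fun x hx => by
    refine hS x ?_
    by_contra hc
    obtain ⟨h1, h2⟩ := abs_lt.1 (not_le.1 hc)
    exact hx ⟨h1, h2.le⟩
  have hfi : ∀ (α : Measure ℝ) [IsProbabilityMeasure α], Integrable f α := fun α _ =>
    Integrable.of_bound hf.aestronglyMeasurable M (ae_of_all _ hM)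
  rw [Metric.tendsto_atTop]
  intro η hη
  obtain ⟨ε, hε, happ⟩ := exists_abs_integral_mul_softBump_sub_le
    (hfc.uniformContinuous_of_continuous hf) hM (by positivity : 0 < η / 4)
  set c := ε * ∫ u, softBump u with hc
  have hc0 : 0 < c := mul_pos hε integral_softBump_pos
  have h2 : 0 < 2 * ε := by positivity
  have t1 := tendsto_integral_mul_softPotential_sub h2 hB hμB hμ hν (h _ h2) hM
    (fun x hx => hS x hx.le)
  have t2 := tendsto_integral_mul_softPotential_sub hε hB hμB hμ hν (h _ hε) hM
    (fun x hx => hS x hx.le)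
  have t3 := (t1.sub t2).abs
  rw [sub_zero, abs_zero] at t3
  obtain ⟨N, hN⟩ := eventually_atTop.1 (t3.eventually_lt_const (by positivity : 0 < c * (η / 4)))
  refine ⟨N, fun n hn => ?_⟩
  have happrox : ∀ (α : Measure ℝ) [IsProbabilityMeasure α], HasLogMoment α →
      |(∫ t, (∫ x, f x * softBump ((x - t) / ε)) ∂α) - c * ∫ t, f t ∂α| ≤ c * (η / 4) := by
    intro α _ hα
    obtain ⟨i, -⟩ := integral_mul_softBump hε hα hf hM hS0 hSI
    rw [← integral_const_mul, ← integral_sub i ((hfi α).const_mul c)]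
    have := norm_integral_le_of_norm_le_const (μ := α) (C := c * (η / 4))
      (f := fun t => (∫ x, f x * softBump ((x - t) / ε)) - c * f t) (ae_of_all _ fun t => happ t)
    simpa using this
  have a1 := happrox μ hμ
  have a2 := happrox (ν n) (hν n)
  obtain ⟨-, b1⟩ := integral_mul_softBump hε hμ hf hM hS0 hSI
  obtain ⟨-, b2⟩ := integral_mul_softBump hε (hν n) hf hM hS0 hSI
  have hn' := hN n hn
  have hint : ∀ g₁ g₂ : ℝ → ℝ, Continuous g₁ → Continuous g₂ →
      Integrable fun x => f x * (g₁ x - g₂ x) := fun g₁ g₂ h₁ h₂ =>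
    (hf.mul (h₁.sub h₂)).integrable_of_hasCompactSupport hfc.mul_right
  have c1 := continuous_softPotential h2 hμ
  have c2 := continuous_softPotential hε hμ
  have c3 := continuous_softPotential h2 (hν n)
  have c4 := continuous_softPotential hε (hν n)
  have e : (∫ x, f x * (softPotential (2 * ε) μ x - softPotential (2 * ε) (ν n) x)) -
      (∫ x, f x * (softPotential ε μ x - softPotential ε (ν n) x)) =
      (∫ t, (∫ x, f x * softBump ((x - t) / ε)) ∂μ) -
      ∫ t, (∫ x, f x * softBump ((x - t) / ε)) ∂(ν n) := by
    rw [← b1, ← b2, ← integral_sub (hint _ _ c1 c3) (hint _ _ c2 c4),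
      ← integral_sub (hint _ _ c1 c2) (hint _ _ c3 c4)]
    congr 1; funext x; ring
  rw [e] at hn'
  rw [Real.dist_eq]
  have hfin : c * |∫ t, f t ∂(ν n) - ∫ t, f t ∂μ| < c * η := by
    rw [← abs_of_pos hc0, ← abs_mul, abs_of_pos hc0, mul_sub]
    rw [abs_lt] at hn' ⊢
    rw [abs_le] at a1 a2
    constructor <;> nlinarith
  exact lt_of_mul_lt_mul_left hfin hc0.le

/-- Sub-probability measures that converge to a compactly supported probability measure against
compactly supported continuous functions converge weakly. -/
theorem tendsto_finiteMeasure_of_hasCompactSupport {m : ℕ → FiniteMeasure ℝ}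
    {μ : ProbabilityMeasure ℝ} {B : ℝ} (hμB : ∀ᵐ t ∂(μ : Measure ℝ), |t| ≤ B)
    (hm : ∀ n, (m n : Measure ℝ).real Set.univ ≤ 1)
    (h : ∀ f : ℝ → ℝ, Continuous f → HasCompactSupport f →
      Tendsto (fun n => ∫ t, f t ∂(m n : Measure ℝ)) atTop (𝓝 (∫ t, f t ∂(μ : Measure ℝ)))) :
    Tendsto m atTop (𝓝 μ.toFiniteMeasure) := by
  rw [FiniteMeasure.tendsto_iff_forall_integral_tendsto]
  intro F
  -- a cutoff that is `1` on the support of `μ`; no mass is lost in the limit outside its support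
  set χ : ℝ → ℝ := fun x => max 0 (1 - max 0 (|x| - B)) with hχ
  have hχc : Continuous χ := by fun_prop
  have hχ0 : ∀ x, 0 ≤ χ x := fun x => le_max_left _ _
  have hχ1 : ∀ x, χ x ≤ 1 := fun x => max_le zero_le_one (by linarith [le_max_left 0 (|x| - B)])
  have hχs : HasCompactSupport χ := by
    refine HasCompactSupport.intro (K := Set.Icc (-(B + 1)) (B + 1)) isCompact_Icc fun x hx => ?_
    have : B + 1 < |x| := by
      by_contra hc
      exact hx (abs_le.1 (not_lt.1 hc))
    exact max_eq_left (by linarith [le_max_right 0 (|x| - B)])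
  have hχμ : ∀ᵐ t ∂(μ : Measure ℝ), χ t = 1 := by
    filter_upwards [hμB] with t ht
    simp [hχ, max_eq_left (by linarith : |t| - B ≤ 0)]
  have t1 := h χ hχc hχs
  have t2 := h (fun x => F x * χ x) (F.continuous.mul hχc) hχs.mul_left
  have e1 : ∫ t, χ t ∂(μ : Measure ℝ) = 1 := by
    rw [integral_congr_ae hχμ]; simp
  have e2 : ∫ t, F t * χ t ∂(μ : Measure ℝ) = ∫ t, F t ∂(μ : Measure ℝ) :=
    integral_congr_ae (by filter_upwards [hχμ] with t ht; rw [ht, mul_one])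
  rw [e1] at t1
  rw [e2] at t2
  have t3 : Tendsto (fun n => ‖F‖ * (1 - ∫ t, χ t ∂(m n : Measure ℝ))) atTop (𝓝 0) := by
    simpa using ((tendsto_const_nhds (x := (1 : ℝ))).sub t1).const_mul ‖F‖
  have t4 : Tendsto (fun n => (∫ t, F t ∂(m n : Measure ℝ)) - ∫ t, F t * χ t ∂(m n : Measure ℝ))
      atTop (𝓝 0) := by
    refine squeeze_zero_norm (fun n => ?_) t3
    have iF : Integrable (fun t => F t) (m n : Measure ℝ) := F.integrable _
    have iχ : Integrable χ (m n : Measure ℝ) :=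
      Integrable.of_bound hχc.aestronglyMeasurable 1 (ae_of_all _ fun t => by
        rw [Real.norm_eq_abs, abs_of_nonneg (hχ0 t)]; exact hχ1 t)
    have iFχ : Integrable (fun t => F t * χ t) (m n : Measure ℝ) :=
      iχ.bdd_mul F.continuous.aestronglyMeasurable (ae_of_all _ fun t => F.norm_coe_le_norm t)
    rw [← integral_sub iF iFχ]
    refine (norm_integral_le_of_norm_le (((integrable_const (1 : ℝ)).sub iχ).const_mul ‖F‖)
      (ae_of_all _ fun t => ?_)).trans ?_
    · have : F t - F t * χ t = F t * (1 - χ t) := by ring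
      rw [this, norm_mul, Real.norm_of_nonneg (sub_nonneg.2 (hχ1 t))]
      exact mul_le_mul_of_nonneg_right (F.norm_coe_le_norm t) (sub_nonneg.2 (hχ1 t))
    · rw [integral_const_mul]
      refine mul_le_mul_of_nonneg_left ?_ (norm_nonneg F)
      refine (integral_sub (integrable_const (1 : ℝ)) iχ).le.trans ?_
      have := hm n
      simp only [integral_const, smul_eq_mul, mul_one]
      linarith
  have := t4.add t2
  simpa using this

/-! ### Bilinear expansion of the energies -/

lemma hasLogMoment_dirac (x : ℝ) : HasLogMoment (Measure.dirac x) :=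
  integrable_dirac (by simp)

lemma HasLogMoment.add_smul {α β : Measure ℝ} (hα : HasLogMoment α) (hβ : HasLogMoment β)
    (c : NNReal) : HasLogMoment (α + c • β) :=
  Integrable.add_measure hα (Integrable.smul_measure_nnreal hβ)

lemma mutualEnergy_comm (y : ℝ) (α β : Measure ℝ) [IsFiniteMeasure α] [IsFiniteMeasure β] :
    mutualEnergy y α β = mutualEnergy y β α := by
  unfold mutualEnergy
  rw [← integral_prod_swap]
  refine integral_congr_ae (ae_of_all _ fun p => ?_)
  simp only [Prod.fst_swap, Prod.snd_swap]
  rw [← softLog_neg, neg_sub]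

lemma mutualEnergy_add_smul_left {y : ℝ} (hy : 0 < y) {α α' β : Measure ℝ} [IsFiniteMeasure α]
    [IsFiniteMeasure α'] [IsFiniteMeasure β] (hα : HasLogMoment α) (hα' : HasLogMoment α')
    (hβ : HasLogMoment β) (c : NNReal) :
    mutualEnergy y (α + c • α') β = mutualEnergy y α β + c * mutualEnergy y α' β := by
  unfold mutualEnergy
  rw [Measure.add_prod, Measure.prod_smul_left, integral_add_measure
    (hα.integrable_softLog_prod hβ hy)
    (Integrable.smul_measure_nnreal (hα'.integrable_softLog_prod hβ hy)), integral_smul_nnreal_measure]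
  rfl

lemma mutualEnergy_add_smul_right {y : ℝ} (hy : 0 < y) {α α' β : Measure ℝ} [IsFiniteMeasure α]
    [IsFiniteMeasure α'] [IsFiniteMeasure β] (hα : HasLogMoment α) (hα' : HasLogMoment α')
    (hβ : HasLogMoment β) (c : NNReal) :
    mutualEnergy y β (α + c • α') = mutualEnergy y β α + c * mutualEnergy y β α' := by
  rw [mutualEnergy_comm, mutualEnergy_add_smul_left hy hα hα' hβ, mutualEnergy_comm y α,
    mutualEnergy_comm y α']

lemma mutualEnergy_eq_integral_softPotential {y : ℝ} (hy : 0 < y) {α β : Measure ℝ}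
    [IsFiniteMeasure α] [IsFiniteMeasure β] (hα : HasLogMoment α) (hβ : HasLogMoment β) :
    mutualEnergy y α β = ∫ t, softPotential y β t ∂α :=
  integral_prod _ (hα.integrable_softLog_prod hβ hy)

lemma mutualEnergy_dirac_left {y : ℝ} (hy : 0 < y) {β : Measure ℝ} [IsFiniteMeasure β]
    (hβ : HasLogMoment β) (x : ℝ) :
    mutualEnergy y (Measure.dirac x) β = softPotential y β x := by
  rw [mutualEnergy_eq_integral_softPotential hy (hasLogMoment_dirac x) hβ, integral_dirac]

/-- Positive definiteness, tested on `ν - μ + c (δ_x - δ_z)`. -/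
lemma mul_softPotential_sub_le_diffEnergy {y : ℝ} (hy : 0 < y) {ν μ : Measure ℝ}
    [IsProbabilityMeasure ν] [IsProbabilityMeasure μ] (hν : HasLogMoment ν) (hμ : HasLogMoment μ)
    (c : NNReal) (x z : ℝ) :
    c * ((softPotential y ν x - softPotential y μ x) - (softPotential y ν z - softPotential y μ z))
      - c ^ 2 * (softLog y (x - z) - Real.log y) ≤ 1 / 2 * diffEnergy y ν μ := by
  have hx := hasLogMoment_dirac x
  have hz := hasLogMoment_dirac z
  have h := diffEnergy_nonneg hy (hν.add_smul hx c) (hμ.add_smul hz c) (by simp)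
  have e1 : softPotential y (Measure.dirac x) x = Real.log y := by
    rw [softPotential, integral_dirac, sub_self, softLog_zero y]
  have e2 : softPotential y (Measure.dirac z) z = Real.log y := by
    rw [softPotential, integral_dirac, sub_self, softLog_zero y]
  have e3 : softPotential y (Measure.dirac z) x = softLog y (x - z) := by
    rw [softPotential, integral_dirac]
  unfold diffEnergy at h ⊢
  rw [mutualEnergy_add_smul_left hy hν hx (hν.add_smul hx c),
    mutualEnergy_add_smul_left hy hν hx (hμ.add_smul hz c),
    mutualEnergy_add_smul_left hy hμ hz (hμ.add_smul hz c),
    mutualEnergy_add_smul_right hy hν hx hν, mutualEnergy_add_smul_right hy hν hx hx,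
    mutualEnergy_add_smul_right hy hμ hz hν, mutualEnergy_add_smul_right hy hμ hz hx,
    mutualEnergy_add_smul_right hy hμ hz hμ, mutualEnergy_add_smul_right hy hμ hz hz,
    mutualEnergy_comm y ν (Measure.dirac x), mutualEnergy_comm y ν (Measure.dirac z),
    mutualEnergy_comm y μ (Measure.dirac z), mutualEnergy_dirac_left hy hν,
    mutualEnergy_dirac_left hy hν, mutualEnergy_dirac_left hy hμ, mutualEnergy_dirac_left hy hμ,
    mutualEnergy_dirac_left hy hx, mutualEnergy_dirac_left hy hz, mutualEnergy_dirac_left hy hz,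
    e1, e2, e3] at h
  nlinarith

/-! ### The variational inequalities -/

/-- The consequences of one-cut regularity that drive the variational argument: the regularity of
`V` and `μ`, and the Euler–Lagrange conditions on `[a, b]` and outside. -/
structure EulerLagrange (V : ℝ → ℝ) (μ : ProbabilityMeasure ℝ) (a b l : ℝ) : Prop where
  le : a ≤ b
  continuous : Continuous V
  growth : ∀ K : ℝ, ∃ C : ℝ, ∀ t, K * |t| - C ≤ V t
  nullSingleton : NullSingletonClass (μ : Measure ℝ)
  ae_mem : ∀ᵐ t ∂(μ : Measure ℝ), t ∈ Set.Icc a b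
  integrable_log : ∀ x : ℝ,
    Integrable (fun t => Real.log (|t - x|⁻¹)) (μ : Measure ℝ) ∧
    Integrable (fun t => Real.log (|Real.exp t - Real.exp x|⁻¹)) (μ : Measure ℝ)
  eq_zero : ∀ x ∈ Set.Icc a b, effectivePotential V μ x + l = 0
  nonneg : ∀ x, 0 ≤ effectivePotential V μ x + l

lemma exists_linear_le_of_growth {V : ℝ → ℝ} (hV : Continuous V) (hg : HasSuperlinearGrowth V)
    (K : ℝ) : ∃ C : ℝ, ∀ t, K * |t| - C ≤ V t := by
  obtain ⟨A, hA⟩ := eventually_atTop.1 (hg.1.eventually_ge_atTop |K|)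
  obtain ⟨B, hB⟩ := eventually_atBot.1 (hg.2.eventually_ge_atTop |K|)
  obtain ⟨m, hm⟩ := (isCompact_Icc (a := B) (b := A)).bddBelow_image
    (f := fun t => V t - K * |t|) (by fun_prop)
  refine ⟨|m|, fun t => ?_⟩
  have key : |K| ≤ V t / (|t| + 1) → K * |t| - |m| ≤ V t := fun h => by
    rw [le_div_iff₀ (by positivity)] at h
    nlinarith [le_abs_self K, abs_nonneg t, abs_nonneg K, abs_nonneg m]
  by_cases h1 : A ≤ t
  · exact key (hA t h1)
  by_cases h2 : t ≤ B
  · exact key (hB t h2)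
  have := hm ⟨t, ⟨(not_le.1 h2).le, (not_le.1 h1).le⟩, rfl⟩
  simp only at this
  linarith [neg_abs_le m]

lemma IsOneCutRegularWith.exists_eulerLagrange {V : ℝ → ℝ} {μ : ProbabilityMeasure ℝ}
    (h : IsOneCutRegularWith V μ) : ∃ a b l, EulerLagrange V μ a b l := by
  obtain ⟨a, b, l, ψ, hab, -, -, hμ, hsupp, -, -, -, heq, hpos⟩ := h.exists_density
  have hV : Continuous V := by
    rw [← continuousOn_univ]; exact h.analytic.continuousOn
  refine ⟨a, b, l, hab.le, hV, exists_linear_le_of_growth hV h.growth, ?_, ?_,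
    h.integrable_log, heq, fun x => ?_⟩
  · rw [hμ]; infer_instance
  · rw [← hsupp]; exact Measure.support_mem_ae
  · by_cases hx : x ∈ Set.Icc a b
    · exact (heq x hx).ge
    · exact (hpos x hx).le

lemma hasLogMoment_of_integrable_abs {ν : Measure ℝ} (h : Integrable (fun t : ℝ => |t|) ν) :
    HasLogMoment ν := by
  refine Integrable.mono h (Continuous.aestronglyMeasurable
    (Continuous.log (by fun_prop) fun t => by positivity)) (ae_of_all _ fun t => ?_)
  rw [Real.norm_eq_abs, abs_of_nonneg (log_one_add_abs_nonneg t), norm_abs_eq_norm,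
    Real.norm_eq_abs]
  exact log_one_add_abs_le t

lemma log_one_add_exp_le (t : ℝ) : Real.log (1 + |Real.exp t|) ≤ Real.log 2 + |t| := by
  rw [Real.abs_exp, ← Real.log_exp |t|, ← Real.log_mul (by norm_num) (by positivity)]
  apply Real.log_le_log (by positivity)
  have := Real.exp_le_exp.2 (le_abs_self t)
  have := Real.one_le_exp (abs_nonneg t)
  linarith

lemma hasLogMoment_map_exp_of_integrable_abs {ν : Measure ℝ} [IsFiniteMeasure ν]
    (h : Integrable (fun t : ℝ => |t|) ν) : HasLogMoment (ν.map Real.exp) := by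
  have hc : Continuous fun t : ℝ => Real.log (1 + |t|) :=
    Continuous.log (by fun_prop) fun t => by positivity
  rw [HasLogMoment, integrable_map_measure hc.aestronglyMeasurable Real.measurable_exp.aemeasurable]
  refine Integrable.mono' ((integrable_const (Real.log 2)).add h)
    (hc.comp Real.continuous_exp).aestronglyMeasurable (ae_of_all _ fun t => ?_)
  simp only [Function.comp_apply]
  rw [Real.norm_eq_abs, abs_of_nonneg (log_one_add_abs_nonneg _)]
  exact log_one_add_exp_le t

lemma softPotential_map {y : ℝ} (hy : 0 < y) (ν : Measure ℝ) {φ : ℝ → ℝ} (hφ : Measurable φ)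
    (x : ℝ) : softPotential y (ν.map φ) x = ∫ t, softLog y (x - φ t) ∂ν :=
  integral_map hφ.aemeasurable
    ((continuous_softLog hy).comp (by fun_prop)).aestronglyMeasurable

/-- The loss in the logarithmic potential caused by the regularization. -/
lemma softLog_add_log_inv_nonneg (ε : ℝ) {d : ℝ} (hd : d ≠ 0) :
    0 ≤ softLog ε d + Real.log (|d|⁻¹) := by
  rw [Real.log_inv]
  linarith [log_abs_le_softLog (y := ε) hd]

lemma softLog_add_log_inv_anti {ε : ℝ} {d d' : ℝ} (hd : d ≠ 0) (h : |d| ≤ |d'|) :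
    softLog ε d' + Real.log (|d'|⁻¹) ≤ softLog ε d + Real.log (|d|⁻¹) := by
  have hd' : 0 < |d'| := (abs_pos.2 hd).trans_le h
  have key : ∀ u : ℝ, u ≠ 0 → softLog ε u + Real.log (|u|⁻¹) =
      1 / 2 * Real.log (1 + ε ^ 2 / u ^ 2) := fun u hu => by
    have e : u ^ 2 + ε ^ 2 = |u| ^ 2 * (1 + ε ^ 2 / u ^ 2) := by rw [sq_abs]; field_simp
    rw [softLog, e, Real.log_mul (by positivity) (by positivity), Real.log_pow, Real.log_inv]
    push_cast; ring
  rw [key d hd, key d' (abs_pos.1 hd')]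
  have h2 : d ^ 2 ≤ d' ^ 2 := sq_le_sq.2 h
  have : ε ^ 2 / d' ^ 2 ≤ ε ^ 2 / d ^ 2 := by gcongr
  have := Real.log_le_log (by positivity : 0 < 1 + ε ^ 2 / d' ^ 2)
    (by linarith : 1 + ε ^ 2 / d' ^ 2 ≤ 1 + ε ^ 2 / d ^ 2)
  linarith

section OneScale

variable {μ : Measure ℝ} [NullSingletonClass μ] {φ : ℝ → ℝ}

lemma ae_sub_ne_zero (hφ : Function.Injective φ) (x : ℝ) : ∀ᵐ s ∂μ, φ x - φ s ≠ 0 := by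
  have : ∀ᵐ s ∂μ, s ≠ x := by simp [ae_iff]
  filter_upwards [this] with s hs h
  exact hs (hφ (sub_eq_zero.1 h)).symm

variable [IsProbabilityMeasure μ]

lemma tendsto_softPotential_map (hφ : Function.Injective φ) (hφc : Continuous φ)
    (hL : HasLogMoment (μ.map φ)) {x : ℝ}
    (hx : Integrable (fun t => Real.log (|φ t - φ x|⁻¹)) μ) :
    Tendsto (fun m : ℕ => -softPotential (1 / ((m : ℝ) + 1)) (μ.map φ) (φ x)) atTop
      (𝓝 (∫ t, Real.log (|φ t - φ x|⁻¹) ∂μ)) := by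
  have hpos : ∀ m : ℕ, 0 < 1 / ((m : ℝ) + 1) := fun m => by positivity
  have : IsProbabilityMeasure (μ.map φ) := Measure.isProbabilityMeasure_map hφc.aemeasurable
  have h1 : Integrable (fun t => softLog 1 (φ x - φ t)) μ := by
    have := hL.integrable_softLog one_pos (φ x)
    rwa [integrable_map_measure this.aestronglyMeasurable hφc.aemeasurable] at this
  simp only [softPotential_map (hpos _) μ hφc.measurable, ← integral_neg]
  refine tendsto_integral_of_dominated_convergence
    (fun t => |Real.log (|φ t - φ x|⁻¹)| + |softLog 1 (φ x - φ t)|) (fun m => ?_)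
    (hx.abs.add h1.abs) (fun m => ?_) ?_
  · exact ((continuous_softLog (hpos m)).comp (by fun_prop)).neg.aestronglyMeasurable
  · filter_upwards [ae_sub_ne_zero hφ x] with t ht
    have h2 := log_abs_le_softLog (y := 1 / ((m : ℝ) + 1)) ht
    have h3 : softLog (1 / ((m : ℝ) + 1)) (φ x - φ t) ≤ softLog 1 (φ x - φ t) := by
      refine softLog_mono_left (hpos m) ?_ _
      rw [div_le_one (by positivity)]; linarith [m.cast_nonneg (α := ℝ)]
    rw [norm_neg, Real.norm_eq_abs, Real.log_inv, abs_neg, abs_sub_comm (φ t)]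
    have h4 := neg_abs_le (Real.log |φ x - φ t|)
    have h5 := le_abs_self (softLog 1 (φ x - φ t))
    have h6 := abs_nonneg (softLog 1 (φ x - φ t))
    have h7 := abs_nonneg (Real.log |φ x - φ t|)
    exact abs_le.2 ⟨by linarith, by linarith⟩
  · filter_upwards [ae_sub_ne_zero hφ x] with t ht
    rw [Real.log_inv, abs_sub_comm (φ t)]
    refine Tendsto.neg ?_
    have h0 : Tendsto (fun m : ℕ => 1 / ((m : ℝ) + 1)) atTop (𝓝 0) :=
      tendsto_one_div_add_atTop_nhds_zero_nat
    have e : Real.log |φ x - φ t| = 1 / 2 * Real.log ((φ x - φ t) ^ 2 + 0 ^ 2) := by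
      rw [← sq_abs (φ x - φ t)]
      simp [Real.log_pow]
    rw [e]
    unfold softLog
    refine Tendsto.const_mul _ (Tendsto.log ((tendsto_const_nhds).add (h0.pow 2)) ?_)
    have : 0 < (φ x - φ t) ^ 2 := by positivity
    positivity

/-- The regularization loss at a point is at most that at its projection to `[a, b]`. -/
lemma softPotential_map_add_le (hφ : StrictMono φ) (hφc : Continuous φ)
    (hL : HasLogMoment (μ.map φ)) {a b : ℝ} (hμ : ∀ᵐ t ∂μ, t ∈ Set.Icc a b)
    (hlog : ∀ x, Integrable (fun t => Real.log (|φ t - φ x|⁻¹)) μ) {ε : ℝ} (hε : 0 < ε) (x : ℝ) :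
    softPotential ε (μ.map φ) (φ x) + ∫ t, Real.log (|φ t - φ x|⁻¹) ∂μ ≤
      softPotential ε (μ.map φ) (φ (max a (min b x))) +
        ∫ t, Real.log (|φ t - φ (max a (min b x))|⁻¹) ∂μ := by
  have : IsProbabilityMeasure (μ.map φ) := Measure.isProbabilityMeasure_map hφc.aemeasurable
  have h1 : ∀ z, Integrable (fun t => softLog ε (φ z - φ t)) μ := fun z => by
    have := hL.integrable_softLog hε (φ z)
    rwa [integrable_map_measure this.aestronglyMeasurable hφc.aemeasurable] at this
  rw [softPotential_map hε μ hφc.measurable, softPotential_map hε μ hφc.measurable,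
    ← integral_add (h1 _) (hlog _), ← integral_add (h1 _) (hlog _)]
  refine integral_mono_ae ((h1 _).add (hlog _)) ((h1 _).add (hlog _)) ?_
  filter_upwards [hμ, ae_sub_ne_zero hφ.injective (max a (min b x))] with t ht hne
  rw [abs_sub_comm (φ t) (φ x), abs_sub_comm (φ t) (φ (max a (min b x)))]
  refine softLog_add_log_inv_anti hne ?_
  rcases le_total x t with h | h
  · have h2 : max a (min b x) ≤ t := max_le ht.1 ((min_le_right _ _).trans h)
    have h3 : x ≤ max a (min b x) := by
      rw [min_eq_right (h.trans ht.2)]; exact le_max_right _ _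
    have := hφ.monotone h2
    have := hφ.monotone h3
    have := hφ.monotone h
    rw [abs_of_nonpos (by linarith), abs_of_nonpos (by linarith)]
    linarith
  · have h2 : t ≤ max a (min b x) := le_max_of_le_right (le_min ht.2 h)
    have h3 : max a (min b x) ≤ x := max_le (ht.1.trans h) (min_le_right _ _)
    have := hφ.monotone h2
    have := hφ.monotone h3
    have := hφ.monotone h
    rw [abs_of_nonneg (by linarith), abs_of_nonneg (by linarith)]
    linarith

lemma softPotential_mono_left {α : Measure ℝ} [IsFiniteMeasure α] (hα : HasLogMoment α) {ε ε' : ℝ}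
    (hε : 0 < ε) (h : ε ≤ ε') (x : ℝ) : softPotential ε α x ≤ softPotential ε' α x :=
  integral_mono (hα.integrable_softLog hε x) (hα.integrable_softLog (hε.trans_le h) x)
    fun _ => softLog_mono_left hε h _

end OneScale

instance isProbabilityMeasure_map_exp (ν : Measure ℝ) [IsProbabilityMeasure ν] :
    IsProbabilityMeasure (ν.map Real.exp) :=
  Measure.isProbabilityMeasure_map Real.measurable_exp.aemeasurable

/-- The regularization of `∫ log |t - x|⁻¹ dμ(t) + ∫ log |eᵗ - eˣ|⁻¹ dμ(t)`. -/
noncomputable def regPotential (ε : ℝ) (μ : Measure ℝ) (x : ℝ) : ℝ :=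
  -softPotential ε μ x - softPotential ε (μ.map Real.exp) (Real.exp x)

lemma softPotential_le_log_add {α : Measure ℝ} [IsProbabilityMeasure α] (hα : HasLogMoment α)
    (x : ℝ) : softPotential 1 α x ≤
      Real.log 2 + Real.log (1 + |x|) + ∫ t, Real.log (1 + |t|) ∂α := by
  have : softPotential 1 α x ≤
      ∫ t, (Real.log 2 + Real.log (1 + |x|) + Real.log (1 + |t|)) ∂α := by
    refine integral_mono (hα.integrable_softLog one_pos x) ((integrable_const _).add hα) fun t => ?_
    have := (le_abs_self _).trans (abs_softLog_sub_le one_pos x t)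
    norm_num at this ⊢
    linarith
  rwa [integral_add (integrable_const _) hα, integral_const, probReal_univ, one_smul] at this

section

variable {V : ℝ → ℝ} {μ : ProbabilityMeasure ℝ} {a b l : ℝ}

namespace EulerLagrange

lemma integrable_of_continuous (h : EulerLagrange V μ a b l) {f : ℝ → ℝ} (hf : Continuous f) :
    Integrable f (μ : Measure ℝ) := by
  obtain ⟨C, hC⟩ := (isCompact_Icc (a := a) (b := b)).exists_bound_of_continuousOn hf.continuousOn
  exact Integrable.of_bound hf.aestronglyMeasurable C (by
    filter_upwards [h.ae_mem] with t ht using hC t ht)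

lemma hasLogMoment (h : EulerLagrange V μ a b l) : HasLogMoment (μ : Measure ℝ) :=
  hasLogMoment_of_integrable_abs (h.integrable_of_continuous continuous_abs)

lemma hasLogMoment_map_exp (h : EulerLagrange V μ a b l) :
    HasLogMoment ((μ : Measure ℝ).map Real.exp) :=
  hasLogMoment_map_exp_of_integrable_abs (h.integrable_of_continuous continuous_abs)

lemma continuous_regPotential (h : EulerLagrange V μ a b l) {ε : ℝ} (hε : 0 < ε) :
    Continuous (regPotential ε (μ : Measure ℝ)) := by
  have h1 := continuous_softPotential hε h.hasLogMoment
  have h2 := continuous_softPotential hε h.hasLogMoment_map_exp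
  unfold regPotential
  fun_prop

lemma regPotential_anti (h : EulerLagrange V μ a b l) {ε ε' : ℝ} (hε : 0 < ε) (hε' : ε ≤ ε')
    (x : ℝ) : regPotential ε' (μ : Measure ℝ) x ≤ regPotential ε (μ : Measure ℝ) x := by
  have h1 := softPotential_mono_left h.hasLogMoment hε hε' x
  have h2 := softPotential_mono_left h.hasLogMoment_map_exp hε hε' (Real.exp x)
  unfold regPotential
  linarith

lemma tendsto_regPotential (h : EulerLagrange V μ a b l) (x : ℝ) :
    Tendsto (fun m : ℕ => regPotential (1 / ((m : ℝ) + 1)) (μ : Measure ℝ) x) atTop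
      (𝓝 (effectivePotential V μ x - V x)) := by
  have := h.nullSingleton
  have h1 := tendsto_softPotential_map (μ := (μ : Measure ℝ)) (φ := id) Function.injective_id
    continuous_id (by rw [Measure.map_id]; exact h.hasLogMoment) (x := x) (h.integrable_log x).1
  have h2 := tendsto_softPotential_map (μ := (μ : Measure ℝ)) Real.exp_injective
    Real.continuous_exp h.hasLogMoment_map_exp (x := x) (h.integrable_log x).2
  simp only [Measure.map_id, id] at h1
  have e : effectivePotential V μ x - V x = (∫ t, Real.log (|t - x|⁻¹) ∂(μ : Measure ℝ)) +
      ∫ t, Real.log (|Real.exp t - Real.exp x|⁻¹) ∂(μ : Measure ℝ) := by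
    unfold effectivePotential; ring
  rw [e]
  refine (h1.add h2).congr fun m => ?_
  rw [regPotential, sub_eq_add_neg]

lemma regPotential_le (h : EulerLagrange V μ a b l) {x : ℝ} (hx : x ∈ Set.Icc a b) {ε : ℝ}
    (hε : 0 < ε) : regPotential ε (μ : Measure ℝ) x ≤ -V x - l := by
  have h1 := h.tendsto_regPotential x
  have h2 := h.eq_zero x hx
  have h3 : effectivePotential V μ x - V x = -V x - l := by linarith
  rw [h3] at h1
  refine ge_of_tendsto h1 ?_
  have : Tendsto (fun m : ℕ => 1 / ((m : ℝ) + 1)) atTop (𝓝 0) :=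
    tendsto_one_div_add_atTop_nhds_zero_nat
  filter_upwards [this.eventually_lt_const hε] with m hm
  exact h.regPotential_anti (by positivity) hm.le x

/-- The regularized effective potential is almost nonnegative, uniformly on the line: on `[a, b]`
this is Dini's theorem, and outside the loss is smaller than at the nearer endpoint. -/
lemma exists_neg_le_regPotential (h : EulerLagrange V μ a b l) {η : ℝ} (hη : 0 < η) {y : ℝ}
    (hy : 0 < y) : ∃ ε, 0 < ε ∧ ε ≤ y ∧
      ∀ x, -η ≤ regPotential ε (μ : Measure ℝ) x + V x + l := by
  have := h.nullSingleton
  have hpos : ∀ m : ℕ, 0 < 1 / ((m : ℝ) + 1) := fun m => by positivity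
  have dini : TendstoUniformlyOn (fun (m : ℕ) x => regPotential (1 / ((m : ℝ) + 1)) (μ : Measure ℝ) x)
      (fun x => -V x - l) atTop (Set.Icc a b) := by
    refine Monotone.tendstoUniformlyOn_of_forall_tendsto isCompact_Icc
      (fun m => (h.continuous_regPotential (hpos m)).continuousOn)
      (fun x _ m m' hm => h.regPotential_anti (hpos m') ?_ x)
      (by have := h.continuous; fun_prop) (fun x hx => ?_)
    · exact one_div_le_one_div_of_le (by positivity) (by gcongr)
    · have h1 := h.tendsto_regPotential x
      have h3 : effectivePotential V μ x - V x = -V x - l := by linarith [h.eq_zero x hx]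
      rwa [h3] at h1
  have h0 : Tendsto (fun m : ℕ => 1 / ((m : ℝ) + 1)) atTop (𝓝 0) :=
    tendsto_one_div_add_atTop_nhds_zero_nat
  obtain ⟨m, hm, hmy⟩ := ((Metric.tendstoUniformlyOn_iff.1 dini η hη).and
    (h0.eventually_lt_const hy)).exists
  refine ⟨1 / ((m : ℝ) + 1), hpos m, hmy.le, fun x => ?_⟩
  have hz : max a (min b x) ∈ Set.Icc a b := ⟨le_max_left _ _, max_le h.le (min_le_left _ _)⟩
  have h1 := hm _ hz
  have h2 := softPotential_map_add_le (μ := (μ : Measure ℝ)) (φ := id) strictMono_id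
    continuous_id (by rw [Measure.map_id]; exact h.hasLogMoment) h.ae_mem
    (fun x => (h.integrable_log x).1) (hpos m) x
  have h3 := softPotential_map_add_le (μ := (μ : Measure ℝ)) Real.exp_strictMono
    Real.continuous_exp h.hasLogMoment_map_exp h.ae_mem
    (fun x => (h.integrable_log x).2) (hpos m) x
  simp only [Measure.map_id, id] at h2
  have h4 := h.nonneg x
  have h5 := h.eq_zero _ hz
  rw [Real.dist_eq] at h1
  have h6 := (abs_lt.1 h1).2
  unfold effectivePotential at h4 h5
  unfold regPotential at h6 ⊢
  linarith

/-- Far from the origin the field dominates the potentials, uniformly in the regularization. -/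
lemma exists_le_regPotential (h : EulerLagrange V μ a b l) (K C : ℝ) :
    ∃ A, ∀ ε, 0 < ε → ε ≤ 1 → ∀ x, A ≤ |x| →
      K * |x| + C ≤ regPotential ε (μ : Measure ℝ) x + V x + l := by
  obtain ⟨D, hD⟩ := h.growth (K + 3)
  set m₁ := ∫ t, Real.log (1 + |t|) ∂(μ : Measure ℝ)
  set m₂ := ∫ t, Real.log (1 + |t|) ∂((μ : Measure ℝ).map Real.exp)
  refine ⟨C + D - l + 3 * Real.log 2 + m₁ + m₂, fun ε hε hε1 x hx => ?_⟩
  have h1 := h.regPotential_anti hε hε1 x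
  have h2 := softPotential_le_log_add h.hasLogMoment x
  have h3 := softPotential_le_log_add h.hasLogMoment_map_exp (Real.exp x)
  have h4 := log_one_add_abs_le x
  have h5 := log_one_add_exp_le x
  have h6 := hD x
  unfold regPotential at h1 ⊢
  linarith

end EulerLagrange

/-! ### The lower bound for the energy -/

/-- The energy of `ν` in the field `V`, with both logarithmic kernels regularized. -/
noncomputable def regEnergy (V : ℝ → ℝ) (ε : ℝ) (ν : Measure ℝ) : ℝ :=
  -(1 / 2 * mutualEnergy ε ν ν) - 1 / 2 * mutualEnergy ε (ν.map Real.exp) (ν.map Real.exp) +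
    ∫ t, V t ∂ν

lemma EulerLagrange.integrable_abs (h : EulerLagrange V μ a b l) {ν : Measure ℝ}
    [IsProbabilityMeasure ν] (hν : Integrable V ν) : Integrable (fun t : ℝ => |t|) ν := by
  obtain ⟨C, hC⟩ := h.growth 1
  refine Integrable.mono' (hν.add (integrable_const C)) continuous_abs.aestronglyMeasurable
    (ae_of_all _ fun t => ?_)
  have := hC t
  simp only [Real.norm_eq_abs, abs_abs, Pi.add_apply]
  linarith

/-- Expansion of the regularized energy about `μ`. -/
lemma EulerLagrange.regEnergy_ge (h : EulerLagrange V μ a b l) {ν : Measure ℝ}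
    [IsProbabilityMeasure ν] (hν : Integrable V ν) {ε : ℝ} (hε : 0 < ε) :
    Integrable (fun t => regPotential ε (μ : Measure ℝ) t + V t + l) ν ∧
    1 / 2 * ((∫ t, V t ∂(μ : Measure ℝ)) - l) + 1 / 2 * diffEnergy ε ν (μ : Measure ℝ) +
      1 / 2 * diffEnergy ε (ν.map Real.exp) ((μ : Measure ℝ).map Real.exp) +
      ∫ t, (regPotential ε (μ : Measure ℝ) t + V t + l) ∂ν ≤ regEnergy V ε ν := by
  have ha := h.integrable_abs hν
  have hm := h.hasLogMoment
  have hm' := h.hasLogMoment_map_exp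
  have hn := hasLogMoment_of_integrable_abs ha
  have hn' := hasLogMoment_map_exp_of_integrable_abs ha
  -- the potentials of `μ` are integrable against any measure with logarithmic moments
  have key : ∀ α : Measure ℝ, IsProbabilityMeasure α → HasLogMoment α →
      HasLogMoment (α.map Real.exp) →
      Integrable (regPotential ε (μ : Measure ℝ)) α ∧
      ∫ t, regPotential ε (μ : Measure ℝ) t ∂α = -mutualEnergy ε α (μ : Measure ℝ) -
        mutualEnergy ε (α.map Real.exp) ((μ : Measure ℝ).map Real.exp) := by
    intro α _ hα hα'
    have i1 : Integrable (softPotential ε (μ : Measure ℝ)) α :=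
      (hα.integrable_softLog_prod hm hε).integral_prod_left
    have i2 : Integrable (softPotential ε ((μ : Measure ℝ).map Real.exp)) (α.map Real.exp) :=
      (hα'.integrable_softLog_prod hm' hε).integral_prod_left
    rw [mutualEnergy_eq_integral_softPotential hε hα hm,
      mutualEnergy_eq_integral_softPotential hε hα' hm',
      integral_map Real.measurable_exp.aemeasurable i2.aestronglyMeasurable]
    rw [integrable_map_measure i2.aestronglyMeasurable Real.measurable_exp.aemeasurable] at i2
    refine ⟨i1.neg.sub i2, ?_⟩
    rw [← integral_neg]
    exact integral_sub i1.neg i2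
  obtain ⟨k1, k2⟩ := key ν inferInstance hn hn'
  obtain ⟨k3, k4⟩ := key μ inferInstance hm hm'
  refine ⟨(k1.add hν).add (integrable_const l), ?_⟩
  have e1 : ∫ t, (regPotential ε (μ : Measure ℝ) t + V t + l) ∂ν =
      (∫ t, regPotential ε (μ : Measure ℝ) t ∂ν) + (∫ t, V t ∂ν) + l := by
    have i : Integrable (fun t => regPotential ε (μ : Measure ℝ) t + V t) ν := k1.add hν
    rw [integral_add i (integrable_const l), integral_add k1 hν]
    simp
  have hVμ : Integrable V (μ : Measure ℝ) := h.integrable_of_continuous h.continuous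
  have e2 : ∫ t, regPotential ε (μ : Measure ℝ) t ∂(μ : Measure ℝ) ≤
      ∫ t, (-V t - l) ∂(μ : Measure ℝ) := by
    refine integral_mono_ae k3 (hVμ.neg.sub (integrable_const l)) ?_
    filter_upwards [h.ae_mem] with t ht using h.regPotential_le ht hε
  have i : Integrable (fun t => -V t) (μ : Measure ℝ) := hVμ.neg
  rw [integral_sub i (integrable_const l), integral_neg] at e2
  simp only [integral_const, probReal_univ, one_smul] at e2
  rw [e1, k2]
  rw [k4] at e2
  unfold regEnergy diffEnergy
  linarith

lemma tendsto_softLog_sub_sub_log {y : ℝ} (hy : 0 < y) (A : ℝ) {η : ℝ} (hη : 0 < η) :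
    ∀ᶠ R : ℝ in atTop, ∀ w : ℝ, |w| ≤ A → |softLog y (R - w) - Real.log R| ≤ η := by
  have h1 : Tendsto (fun R : ℝ => (|A| + y) / (R - (|A| + y))) atTop (𝓝 0) :=
    tendsto_const_nhds.div_atTop (tendsto_atTop_add_const_right _ _ tendsto_id)
  filter_upwards [h1.eventually_le_const hη, eventually_gt_atTop (2 * (|A| + y))] with R hR hRA w hw
  have hw' : |w| ≤ |A| := hw.trans (le_abs_self A)
  have hA := abs_nonneg A
  have hR0 : 0 < R := by linarith
  have h2 : 0 < R - (|A| + y) := by linarith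
  obtain ⟨hw1, hw2⟩ := abs_le.1 hw'
  have up : softLog y (R - w) ≤ Real.log (R + (|A| + y)) := by
    refine (softLog_le_log_add hy _).trans (Real.log_le_log (by positivity) ?_)
    rw [abs_of_pos (by linarith : 0 < R - w)]; linarith
  have lo : Real.log (R - (|A| + y)) ≤ softLog y (R - w) := by
    have h3 : R - w ≠ 0 := by linarith
    refine le_trans (Real.log_le_log h2 ?_) (log_abs_le_softLog h3)
    rw [abs_of_pos (by linarith : 0 < R - w)]; linarith
  have u1 : Real.log (R + (|A| + y)) - Real.log R ≤ (|A| + y) / R := by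
    rw [← Real.log_div (by positivity) hR0.ne']
    refine (Real.log_le_sub_one_of_pos (by positivity)).trans (le_of_eq ?_)
    field_simp; ring
  have u2 : Real.log R - Real.log (R - (|A| + y)) ≤ (|A| + y) / (R - (|A| + y)) := by
    rw [← Real.log_div hR0.ne' h2.ne']
    refine (Real.log_le_sub_one_of_pos (by positivity)).trans (le_of_eq ?_)
    field_simp; ring
  have u3 : (|A| + y) / R ≤ (|A| + y) / (R - (|A| + y)) := by
    gcongr; linarith
  rw [abs_le]
  constructor <;> linarith

lemma softLog_sub_sub_log_le {y : ℝ} (hy : 0 < y) {R : ℝ} (hR : 1 ≤ R) (w : ℝ) :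
    softLog y (R - w) - Real.log R ≤ Real.log (1 + y) + Real.log (1 + |w|) := by
  have h := softLog_le_log_add hy (R - w)
  have h2 : Real.log (|R - w| + y) ≤ Real.log ((1 + y) * (1 + |w|) * R) := by
    apply Real.log_le_log (by positivity)
    have := abs_sub R w
    rw [abs_of_pos (by linarith : 0 < R)] at this
    nlinarith [abs_nonneg w, mul_nonneg hy.le (abs_nonneg w),
      mul_nonneg (mul_nonneg hy.le (abs_nonneg w)) (by linarith : 0 ≤ R),
      mul_nonneg (abs_nonneg w) (by linarith : 0 ≤ R - 1),
      mul_nonneg hy.le (by linarith : 0 ≤ R - 1)]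
  rw [Real.log_mul (by positivity) (by positivity), Real.log_mul (by positivity) (by positivity)]
    at h2
  linarith

/-- A quantitative variational inequality. With a small coupling `T`, the excess of the potential of
`φ_* ν` over that of `φ_* μ` at `x + i y` bounds the excess of the energy of `ν` over that of `μ`
from below, uniformly in `ν`. The first moment on the left makes the bound integrable when `ν` is the
empirical measure of points that range over the line. The quadratic form of `softLog y` is tested on
`φ_* ν - φ_* μ + T (δ_x - δ_R)`, where `R` is so far away that the potentials there are almost
`log R`. -/
theorem EulerLagrange.exists_regEnergy_ge (h : EulerLagrange V μ a b l) {φ : ℝ → ℝ}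
    (hφ : φ = id ∨ φ = Real.exp) {y : ℝ} (hy : 0 < y) (x : ℝ) {τ : ℝ} (hτ : 0 < τ) :
    ∃ T κ ε : ℝ, 0 < T ∧ 0 < κ ∧ 0 < ε ∧ ∀ ν : Measure ℝ, IsProbabilityMeasure ν →
      Integrable V ν →
      1 / 2 * ((∫ t, V t ∂(μ : Measure ℝ)) - l) + T * (softPotential y (ν.map φ) x -
        softPotential y ((μ : Measure ℝ).map φ) x - τ) + κ * ∫ t, |t| ∂ν ≤ regEnergy V ε ν := by
  have hφc : Continuous φ := by
    rcases hφ with rfl | rfl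
    exacts [continuous_id, Real.continuous_exp]
  have hφlog : ∀ t, Real.log (1 + |φ t|) ≤ Real.log 2 + |t| := fun t => by
    rcases hφ with rfl | rfl
    · have := log_one_add_abs_le t
      have := Real.log_nonneg (by norm_num : (1 : ℝ) ≤ 2)
      simp only [id]; linarith
    · exact log_one_add_exp_le t
  have hφm : ∀ ν : Measure ℝ, IsProbabilityMeasure ν → Integrable (fun t : ℝ => |t|) ν →
      HasLogMoment (ν.map φ) := fun ν _ hν => by
    rcases hφ with rfl | rfl
    · rw [Measure.map_id]; exact hasLogMoment_of_integrable_abs hν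
    · exact hasLogMoment_map_exp_of_integrable_abs hν
  have hφp : ∀ ν : Measure ℝ, IsProbabilityMeasure ν → IsProbabilityMeasure (ν.map φ) :=
    fun ν _ => Measure.isProbabilityMeasure_map hφc.aemeasurable
  have hμm := hφm μ inferInstance (h.integrable_of_continuous continuous_abs)
  set C₀ := Real.log (1 + y) + Real.log 2 with hC₀
  have hC₀0 : 0 ≤ C₀ := add_nonneg (Real.log_nonneg (by linarith)) (Real.log_nonneg (by norm_num))
  -- the slope `2` pays for both `T` and `κ`, which are at most `1`
  obtain ⟨A₁, hA₁⟩ := h.exists_le_regPotential 2 C₀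
  -- on `[-A, A]` the far point sees `φ` as constant; `A` also covers the support of `μ`
  set A := max (max |a| |b|) A₁ with hA
  have hA0 : 0 ≤ A := (abs_nonneg a).trans ((le_max_left _ _).trans (le_max_left _ _))
  obtain ⟨M, hM⟩ := (isCompact_Icc (a := -A) (b := A)).exists_bound_of_continuousOn
    hφc.continuousOn
  obtain ⟨R, hR, hR1⟩ := ((tendsto_softLog_sub_sub_log hy M (by positivity : 0 < τ / 8)).and
    (eventually_ge_atTop 1)).exists
  set D := softLog y (x - R) - Real.log y with hD
  have hD0 : 0 ≤ D := sub_nonneg.2 (log_le_softLog hy _)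
  obtain ⟨T, hT0, hT1, hTD⟩ : ∃ T : ℝ, 0 < T ∧ T ≤ 1 ∧ T * D ≤ τ / 8 := by
    refine ⟨min 1 (τ / 8 / (D + 1)), by positivity, min_le_left _ _, ?_⟩
    calc min 1 (τ / 8 / (D + 1)) * D ≤ τ / 8 / (D + 1) * (D + 1) := by
          gcongr
          · exact min_le_right _ _
          · linarith
      _ = τ / 8 := by field_simp
  have hκ : 0 < min 1 (T * τ / 8 / (A + 1)) := by positivity
  set κ := min 1 (T * τ / 8 / (A + 1)) with hκd
  have hκ1 : κ ≤ 1 := min_le_left _ _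
  have hκA : κ * A ≤ T * τ / 8 := by
    calc κ * A ≤ T * τ / 8 / (A + 1) * (A + 1) := by
          gcongr
          · exact min_le_right _ _
          · linarith
      _ = T * τ / 8 := by field_simp
  obtain ⟨ε, hε, hεy, hεη⟩ := h.exists_neg_le_regPotential (by positivity : 0 < T * τ / 8)
    (lt_min hy one_pos)
  have hε1 : ε ≤ 1 := hεy.trans (min_le_right _ _)
  have hεy' : ε ≤ y := hεy.trans (min_le_left _ _)
  refine ⟨T, κ, ε, hT0, hκ, hε, fun ν _ hν => ?_⟩
  have hνa := h.integrable_abs hν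
  have hνm := hφm ν inferInstance hνa
  have := hφp ν inferInstance
  have := hφp μ inferInstance
  obtain ⟨hi, hge⟩ := h.regEnergy_ge hν hε
  -- one of the two quadratic terms is used, the other is dropped
  have hdiff : 1 / 2 * diffEnergy y (ν.map φ) ((μ : Measure ℝ).map φ) ≤
      1 / 2 * diffEnergy ε ν (μ : Measure ℝ) +
      1 / 2 * diffEnergy ε (ν.map Real.exp) ((μ : Measure ℝ).map Real.exp) := by
    have q1 := diffEnergy_nonneg hε (hasLogMoment_of_integrable_abs hνa) h.hasLogMoment (by simp)
    have q2 := diffEnergy_nonneg hε (hasLogMoment_map_exp_of_integrable_abs hνa)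
      h.hasLogMoment_map_exp (by simp)
    have q3 := diffEnergy_antitone hε hεy' hνm hμm
    rcases hφ with rfl | rfl
    · simp only [Measure.map_id] at q3 ⊢; linarith
    · linarith
  have hquad := mul_softPotential_sub_le_diffEnergy hy hνm hμm T.toNNReal x R
  rw [← hD, Real.coe_toNNReal T hT0.le] at hquad
  -- the far point contributes little
  have iR : ∀ α : Measure ℝ, IsProbabilityMeasure α → HasLogMoment (α.map φ) →
      Integrable (fun t => softLog y (R - φ t)) α := fun α _ hα => by
    have := hφp α inferInstance
    have := hα.integrable_softLog hy R
    rwa [integrable_map_measure this.aestronglyMeasurable hφc.aemeasurable] at this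
  have hμR : Real.log R - τ / 8 ≤ softPotential y ((μ : Measure ℝ).map φ) R := by
    rw [softPotential_map hy _ hφc.measurable]
    have : ∫ _, (Real.log R - τ / 8) ∂(μ : Measure ℝ) ≤
        ∫ t, softLog y (R - φ t) ∂(μ : Measure ℝ) := by
      refine integral_mono_ae (integrable_const _) (iR μ inferInstance hμm) ?_
      filter_upwards [h.ae_mem] with t ht
      have ht' : t ∈ Set.Icc (-A) A := by
        have h1 : |a| ≤ A := (le_max_left _ _).trans (le_max_left _ _)
        have h2 : |b| ≤ A := (le_max_right _ _).trans (le_max_left _ _)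
        exact ⟨by linarith [ht.1, neg_abs_le a], by linarith [ht.2, le_abs_self b]⟩
      have := (abs_le.1 (hR _ (hM t ht'))).1
      linarith
    simpa using this
  have hνR : T * (softPotential y (ν.map φ) R - Real.log R) + κ * (∫ t, |t| ∂ν) - T * τ / 2 ≤
      ∫ t, (regPotential ε (μ : Measure ℝ) t + V t + l) ∂ν := by
    have i1 : Integrable (fun t => T * (softLog y (R - φ t) - Real.log R)) ν :=
      ((iR ν inferInstance hνm).sub (integrable_const _)).const_mul T
    have i2 : Integrable (fun t => κ * |t|) ν := hνa.const_mul κ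
    have e : ∫ t, (T * (softLog y (R - φ t) - Real.log R) + κ * |t| - T * τ / 2) ∂ν =
        T * (softPotential y (ν.map φ) R - Real.log R) + κ * (∫ t, |t| ∂ν) - T * τ / 2 := by
      have i3 : Integrable (fun t => T * (softLog y (R - φ t) - Real.log R) + κ * |t|) ν := i1.add i2
      rw [integral_sub i3 (integrable_const _), integral_add i1 i2, integral_const_mul,
        integral_const_mul, integral_sub (iR ν inferInstance hνm) (integrable_const _),
        softPotential_map hy _ hφc.measurable]
      simp
    rw [← e]
    refine integral_mono ((i1.add i2).sub (integrable_const _)) hi fun t => ?_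
    have h6 : 0 < T * τ := by positivity
    by_cases ht : |t| ≤ A
    · have h1 := (abs_le.1 (hR _ (hM t (abs_le.1 ht)))).2
      have h2 := hεη t
      have h3 : T * (softLog y (R - φ t) - Real.log R) ≤ T * (τ / 8) := by gcongr
      have h4 : κ * |t| ≤ κ * A := by gcongr
      linarith
    · have h1 := hA₁ ε hε hε1 t ((le_max_right _ _).trans (not_le.1 ht).le)
      have h2 := softLog_sub_sub_log_le hy hR1 (φ t)
      have h3 := hφlog t
      have h4 : T * (softLog y (R - φ t) - Real.log R) ≤ 1 * (C₀ + |t|) := by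
        calc T * (softLog y (R - φ t) - Real.log R) ≤ T * (C₀ + |t|) := by gcongr; linarith
          _ ≤ 1 * (C₀ + |t|) := by gcongr
      have h5 : κ * |t| ≤ 1 * |t| := by gcongr
      linarith
  have h1 : T * (Real.log R - τ / 8) ≤ T * softPotential y ((μ : Measure ℝ).map φ) R := by gcongr
  have h2 : T ^ 2 * D ≤ T * (τ / 8) := by
    rw [sq, mul_assoc]; gcongr
  have h3 : 0 < T * τ := by positivity
  linarith

end

/-! ### Biorthogonal ensembles -/

/-- The unnormalized density `det (φ(x_i)^j) det (χ(x_i)^j) ∏ w(x_j)` of the biorthogonal ensemble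
with weight `w`. -/
noncomputable def ensembleDensity (φ χ w : ℝ → ℝ) {n : ℕ} (x : Fin n → ℝ) : ℝ :=
  (Matrix.vandermonde (φ ∘ x)).det * (Matrix.vandermonde (χ ∘ x)).det * ∏ j, w (x j)

lemma vandermonde_mul_vandermonde_nonneg {φ χ : ℝ → ℝ} (hφ : Monotone φ) (hχ : Monotone χ) {n : ℕ}
    (x : Fin n → ℝ) :
    0 ≤ (Matrix.vandermonde (φ ∘ x)).det * (Matrix.vandermonde (χ ∘ x)).det := by
  rw [Matrix.det_vandermonde, Matrix.det_vandermonde, ← Finset.prod_mul_distrib]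
  refine Finset.prod_nonneg fun i _ => ?_
  rw [← Finset.prod_mul_distrib]
  refine Finset.prod_nonneg fun j _ => ?_
  simp only [Function.comp_apply]
  rcases le_total (x i) (x j) with h | h
  · exact mul_nonneg (sub_nonneg.2 (hφ h)) (sub_nonneg.2 (hχ h))
  · exact mul_nonneg_of_nonpos_of_nonpos (sub_nonpos.2 (hφ h)) (sub_nonpos.2 (hχ h))

lemma ensembleDensity_nonneg {φ χ w : ℝ → ℝ} (hφ : Monotone φ) (hχ : Monotone χ)
    (hw : ∀ t, 0 ≤ w t) {n : ℕ} (x : Fin n → ℝ) : 0 ≤ ensembleDensity φ χ w x :=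
  mul_nonneg (vandermonde_mul_vandermonde_nonneg hφ hχ x) (Finset.prod_nonneg fun _ _ => hw _)

lemma det_vandermonde_eq_sum {n : ℕ} (v : Fin n → ℝ) :
    (Matrix.vandermonde v).det =
      ∑ σ : Equiv.Perm (Fin n), (σ.sign : ℤ) * ∏ i, v i ^ (σ i : ℕ) := by
  rw [← Matrix.det_transpose, Matrix.det_apply']
  rfl

lemma integrable_prod_mul_ensembleDensity {φ χ w m : ℝ → ℝ}
    (h : ∀ i j : ℕ, Integrable fun t => m t * (φ t ^ i * χ t ^ j * w t)) {n : ℕ} :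
    Integrable fun x : Fin n → ℝ => (∏ j, m (x j)) * ensembleDensity φ χ w x := by
  have e : (fun x : Fin n → ℝ => (∏ j, m (x j)) * ensembleDensity φ χ w x) = fun x =>
      ∑ σ : Equiv.Perm (Fin n), ∑ τ : Equiv.Perm (Fin n), (((σ.sign : ℤ) : ℝ) * ((τ.sign : ℤ) : ℝ)) *
        ∏ i, (m (x i) * (φ (x i) ^ (σ i : ℕ) * χ (x i) ^ (τ i : ℕ) * w (x i))) := by
    funext x
    rw [ensembleDensity, det_vandermonde_eq_sum, det_vandermonde_eq_sum, Finset.sum_mul_sum,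
      Finset.sum_mul, Finset.mul_sum]
    refine Finset.sum_congr rfl fun σ _ => ?_
    rw [Finset.sum_mul, Finset.mul_sum]
    refine Finset.sum_congr rfl fun τ _ => ?_
    simp only [Finset.prod_mul_distrib, Function.comp_apply]
    ring
  rw [e]
  refine integrable_finsetSum _ fun σ _ => integrable_finsetSum _ fun τ _ => ?_
  exact (Integrable.fintype_prod fun i => h (σ i) (τ i)).const_mul _

lemma det_vandermonde_cons {n : ℕ} (u : ℝ) (v : Fin n → ℝ) :
    (Matrix.vandermonde (Fin.cons u v : Fin (n + 1) → ℝ)).det =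
      (∏ j, (v j - u)) * (Matrix.vandermonde v).det := by
  simp only [Matrix.det_vandermonde, Fin.prod_univ_succ, Fin.prod_Ioi_zero, Fin.prod_Ioi_succ,
    Fin.cons_zero, Fin.cons_succ]

lemma det_vandermonde_insertNth {n : ℕ} (i : Fin (n + 1)) (u : ℝ) (v : Fin n → ℝ) :
    (Matrix.vandermonde (i.insertNth u v : Fin (n + 1) → ℝ)).det =
      (-1) ^ (i : ℕ) * (Matrix.vandermonde (Fin.cons u v : Fin (n + 1) → ℝ)).det := by
  have h := Matrix.det_permute i.cycleRange (Matrix.vandermonde (Fin.cons u v : Fin (n + 1) → ℝ))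
  rw [Fin.sign_cycleRange] at h
  have e : (Matrix.vandermonde (Fin.cons u v : Fin (n + 1) → ℝ)).submatrix i.cycleRange id =
      Matrix.vandermonde (i.insertNth u v : Fin (n + 1) → ℝ) := by
    rw [← Fin.cons_comp_cycleRange]
    rfl
  rw [e] at h
  simpa using h

/-- Laplace expansion of a Vandermonde determinant in which one power is repeated. -/
lemma sum_pow_mul_det_vandermonde_eq_zero {n k : ℕ} (hk : k < n) (v : Fin (n + 1) → ℝ) :
    ∑ i : Fin (n + 1), (-1) ^ (i : ℕ) * v i ^ k * (Matrix.vandermonde (v ∘ i.succAbove)).det = 0 := by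
  set M : Matrix (Fin (n + 1)) (Fin (n + 1)) ℝ :=
    Matrix.of fun p => Fin.cons (v p ^ k) fun q : Fin n => v p ^ (q : ℕ) with hM
  have h0 : M.det = 0 :=
    Matrix.det_zero_of_column_eq (i := 0) (j := Fin.succ ⟨k, hk⟩) (Fin.succ_ne_zero _).symm
      fun p => by simp only [hM, Matrix.of_apply, Fin.cons_zero, Fin.cons_succ]
  rw [← h0, Matrix.det_succ_column_zero]
  refine Finset.sum_congr rfl fun i _ => ?_
  have e1 : M i 0 = v i ^ k := by simp [hM]
  have e2 : M.submatrix i.succAbove Fin.succ = Matrix.vandermonde (v ∘ i.succAbove) := by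
    ext p q; simp [hM, Matrix.vandermonde_apply]
  rw [e1, e2]

section Orthogonality

variable {φ χ w : ℝ → ℝ}

/-- The integrand of the orthogonality relation, with the extra variable `p.1` singled out. -/
noncomputable def orthogonalityIntegrand (φ χ w : ℝ → ℝ) (n k : ℕ) (p : ℝ × (Fin n → ℝ)) : ℝ :=
  (Matrix.vandermonde (Fin.cons (φ p.1) (φ ∘ p.2) : Fin (n + 1) → ℝ)).det * χ p.1 ^ k *
    (Matrix.vandermonde (χ ∘ p.2)).det * (w p.1 * ∏ j, w (p.2 j))

lemma integrable_orthogonalityIntegrand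
    (h : ∀ i j : ℕ, Integrable fun t => φ t ^ i * χ t ^ j * w t) (n k : ℕ) :
    Integrable (orthogonalityIntegrand φ χ w n k) := by
  have mp := volume_preserving_piFinSuccAbove (fun _ : Fin (n + 1) => ℝ) 0
  rw [← mp.integrable_comp_emb (MeasurableEquiv.measurableEmbedding _)]
  have e : orthogonalityIntegrand φ χ w n k ∘ MeasurableEquiv.piFinSuccAbove (fun _ => ℝ) 0 =
      fun x => ∑ σ : Equiv.Perm (Fin (n + 1)), ∑ τ : Equiv.Perm (Fin n),
        (((σ.sign : ℤ) : ℝ) * ((τ.sign : ℤ) : ℝ)) *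
        ∏ i, (φ (x i) ^ (σ i : ℕ) *
          χ (x i) ^ ((Fin.cons k fun q => (τ q : ℕ) : Fin (n + 1) → ℕ) i) * w (x i)) := by
    funext x
    have e1 : (Fin.cons (φ (x 0)) (φ ∘ fun j => x (Fin.succ j)) : Fin (n + 1) → ℝ) = φ ∘ x := by
      funext i
      refine Fin.cases ?_ (fun j => ?_) i <;> simp
    have e2 : orthogonalityIntegrand φ χ w n k (MeasurableEquiv.piFinSuccAbove (fun _ => ℝ) 0 x) =
        (Matrix.vandermonde (φ ∘ x)).det * χ (x 0) ^ k *
        (Matrix.vandermonde (χ ∘ fun j => x (Fin.succ j))).det *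
        (w (x 0) * ∏ j, w (x (Fin.succ j))) := by
      rw [← e1]; rfl
    rw [Function.comp_apply, e2, det_vandermonde_eq_sum, det_vandermonde_eq_sum]
    have e3 : ∀ A B C D : ℝ, A * B * C * D = A * C * (B * D) := fun A B C D => by ring
    rw [e3, Finset.sum_mul_sum, Finset.sum_mul]
    refine Finset.sum_congr rfl fun σ _ => ?_
    rw [Finset.sum_mul]
    refine Finset.sum_congr rfl fun τ _ => ?_
    simp only [Finset.prod_mul_distrib, Function.comp_apply]
    rw [Fin.prod_univ_succ (fun i => w (x i)), Fin.prod_univ_succ (fun i => χ (x i) ^ _)]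
    simp only [Fin.cons_zero, Fin.cons_succ]
    ring
  rw [e]
  refine integrable_finsetSum _ fun σ _ => integrable_finsetSum _ fun τ _ => ?_
  exact (Integrable.fintype_prod fun i => h (σ i) _).const_mul _

lemma integral_orthogonalityIntegrand
    (h : ∀ i j : ℕ, Integrable fun t => φ t ^ i * χ t ^ j * w t) {n k : ℕ} (hk : k < n) :
    ∫ p, orthogonalityIntegrand φ χ w n k p = 0 := by
  -- the `i`-th term of the Laplace expansion, in which the variable `x i` is singled out
  set F : Fin (n + 1) → (Fin (n + 1) → ℝ) → ℝ := fun i x =>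
    (Matrix.vandermonde (φ ∘ x)).det * ((-1) ^ (i : ℕ) * χ (x i) ^ k *
      (Matrix.vandermonde ((χ ∘ x) ∘ i.succAbove)).det) * ∏ j, w (x j) with hF
  have hFG : ∀ i x, F i x =
      orthogonalityIntegrand φ χ w n k (MeasurableEquiv.piFinSuccAbove (fun _ => ℝ) i x) := by
    intro i x
    have e1 : φ ∘ x = i.insertNth (φ (x i)) (φ ∘ fun j => x (i.succAbove j)) := by
      rw [Fin.eq_insertNth_iff]
      exact ⟨rfl, rfl⟩
    have e2 : orthogonalityIntegrand φ χ w n k (MeasurableEquiv.piFinSuccAbove (fun _ => ℝ) i x) =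
        (Matrix.vandermonde (Fin.cons (φ (x i)) (φ ∘ fun j => x (i.succAbove j)) :
          Fin (n + 1) → ℝ)).det * χ (x i) ^ k *
        (Matrix.vandermonde (χ ∘ fun j => x (i.succAbove j))).det *
        (w (x i) * ∏ j, w (x (i.succAbove j))) := rfl
    have hs : ((-1 : ℝ) ^ (i : ℕ)) * (-1) ^ (i : ℕ) = 1 := by
      rw [← mul_pow]; norm_num
    rw [hF, e2]
    simp only
    rw [e1, det_vandermonde_insertNth, Fin.prod_univ_succAbove (fun j => w (x j)) i]
    rw [show (χ ∘ x) ∘ i.succAbove = χ ∘ fun j => x (i.succAbove j) from rfl]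
    linear_combination ((Matrix.vandermonde (Fin.cons (φ (x i)) (φ ∘ fun j => x (i.succAbove j)) :
          Fin (n + 1) → ℝ)).det * χ (x i) ^ k *
        (Matrix.vandermonde (χ ∘ fun j => x (i.succAbove j))).det *
        (w (x i) * ∏ j, w (x (i.succAbove j)))) * hs
  have mp := fun i => volume_preserving_piFinSuccAbove (fun _ : Fin (n + 1) => ℝ) i
  have hI : ∀ i, ∫ x, F i x = ∫ p, orthogonalityIntegrand φ χ w n k p := fun i => by
    simp only [hFG]
    exact (mp i).integral_comp (MeasurableEquiv.measurableEmbedding _) _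
  have hInt : ∀ i, Integrable (F i) := fun i => by
    have : F i = orthogonalityIntegrand φ χ w n k ∘
        MeasurableEquiv.piFinSuccAbove (fun _ => ℝ) i := funext (hFG i)
    rw [this, (mp i).integrable_comp_emb (MeasurableEquiv.measurableEmbedding _)]
    exact integrable_orthogonalityIntegrand h n k
  have hsum : ∑ i, ∫ x, F i x = 0 := by
    rw [← integral_finsetSum _ fun i _ => hInt i]
    refine integral_eq_zero_of_ae (ae_of_all _ fun x => ?_)
    simp only [hF, Pi.zero_apply]
    rw [← Finset.sum_mul, ← Finset.mul_sum]
    have := sum_pow_mul_det_vandermonde_eq_zero hk (χ ∘ x)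
    simp only [Function.comp_apply] at this
    rw [this, mul_zero, zero_mul]
  simp only [hI, Finset.sum_const, Finset.card_univ, Fintype.card_fin, nsmul_eq_mul] at hsum
  exact (mul_eq_zero.1 hsum).resolve_left (by positivity)

lemma integral_prod_sub_mul_ensembleDensity
    (h : ∀ i j : ℕ, Integrable fun t => φ t ^ i * χ t ^ j * w t) {n k : ℕ} (hk : k < n) :
    ∫ t, (∫ x : Fin n → ℝ, (∏ j, (φ t - φ (x j))) * ensembleDensity φ χ w x) *
      χ t ^ k * w t = 0 := by
  have h1 := integral_orthogonalityIntegrand h hk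
  have h2 : ∫ p, orthogonalityIntegrand φ χ w n k p = ∫ t, ∫ x, orthogonalityIntegrand φ χ w n k (t, x) :=
    integral_prod _ (integrable_orthogonalityIntegrand h n k)
  rw [h2] at h1
  have e : ∀ t, (∫ x : Fin n → ℝ, (∏ j, (φ t - φ (x j))) * ensembleDensity φ χ w x) *
      χ t ^ k * w t = (-1) ^ n * ∫ x, orthogonalityIntegrand φ χ w n k (t, x) := by
    intro t
    rw [mul_assoc, ← integral_mul_const, ← integral_const_mul]
    refine integral_congr_ae (ae_of_all _ fun x => ?_)
    have hs : (∏ j, (φ t - φ (x j))) = (-1) ^ n * ∏ j, (φ (x j) - φ t) := by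
      have := Finset.prod_neg (s := Finset.univ) (f := fun j => φ (x j) - φ t)
      simp only [neg_sub, Finset.card_univ, Fintype.card_fin] at this
      exact this
    simp only [orthogonalityIntegrand, ensembleDensity, det_vandermonde_cons, hs,
      Function.comp_apply]
    ring
  simp only [e]
  rw [integral_const_mul, h1, mul_zero]

end Orthogonality

/-! ### Average characteristic polynomials -/

/-- The polynomial `∏ (X - φ(x_j))`, whose roots are the images of the points under `φ`. -/
noncomputable def nodalPoly (φ : ℝ → ℝ) {n : ℕ} (x : Fin n → ℝ) : ℝ[X] := ∏ j, (X - C (φ (x j)))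

lemma nodalPoly_monic (φ : ℝ → ℝ) {n : ℕ} (x : Fin n → ℝ) : (nodalPoly φ x).Monic :=
  monic_prod_of_monic _ _ fun _ _ => monic_X_sub_C _

lemma nodalPoly_natDegree (φ : ℝ → ℝ) {n : ℕ} (x : Fin n → ℝ) : (nodalPoly φ x).natDegree = n := by
  rw [nodalPoly, natDegree_prod_of_monic _ _ fun _ _ => monic_X_sub_C _]
  simp

section AverageCharPoly

variable {φ χ w : ℝ → ℝ}

lemma integrable_eval_nodalPoly_mul
    (h : ∀ i j : ℕ, Integrable fun t => φ t ^ i * χ t ^ j * w t) {n : ℕ} (u : ℝ) :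
    Integrable fun x : Fin n → ℝ => (nodalPoly φ x).eval u * ensembleDensity φ χ w x := by
  have e : (fun x : Fin n → ℝ => (nodalPoly φ x).eval u * ensembleDensity φ χ w x) =
      fun x => (∏ j, (u - φ (x j))) * ensembleDensity φ χ w x := by
    funext x; simp [nodalPoly, eval_prod]
  rw [e]
  refine integrable_prod_mul_ensembleDensity (m := fun t => u - φ t) fun i j => ?_
  have := ((h i j).const_mul u).sub (h (i + 1) j)
  refine this.congr (ae_of_all _ fun t => ?_)
  simp only [Pi.sub_apply]; ring

/-- The average characteristic polynomial of a biorthogonal ensemble: a polynomial that represents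
the mean of `∏ (X - φ(x_j))` under every linear functional. -/
lemma exists_averageCharPoly
    (h : ∀ i j : ℕ, Integrable fun t => φ t ^ i * χ t ^ j * w t) (n : ℕ) :
    ∃ P : ℝ[X], ∀ (E : Type) [NormedAddCommGroup E] [NormedSpace ℝ E] [CompleteSpace E] 
      (L : ℝ[X] →ₗ[ℝ] E),
      L P = ∫ x : Fin n → ℝ, ensembleDensity φ χ w x • L (nodalPoly φ x) := by
  classical
  set v : ℕ → ℝ := fun i => i with hv
  have hinj : Set.InjOn v (Finset.range (n + 1) : Finset ℕ) := Nat.cast_injective.injOn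
  refine ⟨Lagrange.interpolate (Finset.range (n + 1)) v fun i =>
    ∫ x : Fin n → ℝ, (nodalPoly φ x).eval (v i) * ensembleDensity φ χ w x, fun E _ _ _ L => ?_⟩
  have key : ∀ x : Fin n → ℝ, nodalPoly φ x = Lagrange.interpolate (Finset.range (n + 1)) v
      fun i => (nodalPoly φ x).eval (v i) := fun x => by
    refine Lagrange.eq_interpolate hinj ?_
    rw [degree_eq_natDegree (nodalPoly_monic φ x).ne_zero, nodalPoly_natDegree, Finset.card_range]
    exact_mod_cast Nat.lt_succ_self n
  have hL : ∀ r : ℕ → ℝ, L (Lagrange.interpolate (Finset.range (n + 1)) v r) =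
      ∑ i ∈ Finset.range (n + 1), r i • L (Lagrange.basis (Finset.range (n + 1)) v i) := fun r => by
    rw [Lagrange.interpolate_apply, map_sum]
    refine Finset.sum_congr rfl fun i _ => ?_
    rw [← smul_eq_C_mul, map_smul]
  have e : ∀ x : Fin n → ℝ, ensembleDensity φ χ w x • L (nodalPoly φ x) =
      ∑ i ∈ Finset.range (n + 1), ((nodalPoly φ x).eval (v i) * ensembleDensity φ χ w x) •
        L (Lagrange.basis (Finset.range (n + 1)) v i) := fun x => by
    conv_lhs => rw [key x, hL, Finset.smul_sum]
    refine Finset.sum_congr rfl fun i _ => ?_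
    rw [smul_smul, mul_comm]
  simp only [e]
  rw [integral_finsetSum _ fun i _ => (integrable_eval_nodalPoly_mul h (v i)).smul_const _, hL]
  refine Finset.sum_congr rfl fun i _ => ?_
  rw [integral_smul_const]

/-- The normalized average characteristic polynomial is monic, is orthogonal to the lower powers of
`χ`, and is bounded by the average of the absolute values. -/
lemma exists_monic_orthogonal
    (h : ∀ i j : ℕ, Integrable fun t => φ t ^ i * χ t ^ j * w t) (n : ℕ)
    (hnn : ∀ x : Fin n → ℝ, 0 ≤ ensembleDensity φ χ w x)
    (hZ : 0 < ∫ x : Fin n → ℝ, ensembleDensity φ χ w x) :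
    ∃ P : ℝ[X], P.Monic ∧ P.natDegree = n ∧
      (∀ k < n, ∫ t, P.eval (φ t) * χ t ^ k * w t = 0) ∧
      ∀ z : ℂ, ‖aeval z P‖ * (∫ x : Fin n → ℝ, ensembleDensity φ χ w x) ≤
        ∫ x : Fin n → ℝ, (∏ j, ‖z - φ (x j)‖) * ensembleDensity φ χ w x := by
  obtain ⟨P₀, hP₀⟩ := exists_averageCharPoly h n
  set Z := ∫ x : Fin n → ℝ, ensembleDensity φ χ w x with hZd
  have hcoeff : ∀ m, P₀.coeff m = ∫ x : Fin n → ℝ, ensembleDensity φ χ w x •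
      (nodalPoly φ x).coeff m := fun m => hP₀ ℝ (lcoeff ℝ m)
  have h1 : P₀.coeff n = Z := by
    rw [hcoeff, hZd]
    refine integral_congr_ae (ae_of_all _ fun x => ?_)
    have := (nodalPoly_monic φ x).coeff_natDegree
    rw [nodalPoly_natDegree] at this
    simp [this]
  have h2 : ∀ m, n < m → P₀.coeff m = 0 := fun m hm => by
    rw [hcoeff]
    refine integral_eq_zero_of_ae (ae_of_all _ fun x => ?_)
    have : (nodalPoly φ x).coeff m = 0 :=
      coeff_eq_zero_of_natDegree_lt (by rwa [nodalPoly_natDegree])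
    simp [this]
  have hdeg : P₀.natDegree = n := by
    refine le_antisymm (natDegree_le_iff_coeff_eq_zero.2 fun m hm => h2 m hm) ?_
    exact le_natDegree_of_ne_zero (by rw [h1]; exact hZ.ne')
  have hlead : P₀.leadingCoeff = Z := by rw [leadingCoeff, hdeg, h1]
  refine ⟨C Z⁻¹ * P₀, ?_, ?_, ?_, ?_⟩
  · rw [Monic, leadingCoeff_mul, leadingCoeff_C, hlead, inv_mul_cancel₀ hZ.ne']
  · rw [natDegree_C_mul (inv_ne_zero hZ.ne'), hdeg]
  · intro k hk
    have e : ∀ t, (C Z⁻¹ * P₀).eval (φ t) * χ t ^ k * w t =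
        Z⁻¹ * ((∫ x : Fin n → ℝ, (∏ j, (φ t - φ (x j))) * ensembleDensity φ χ w x) *
          χ t ^ k * w t) := fun t => by
      have := hP₀ ℝ (leval (φ t))
      simp only [leval_apply, nodalPoly, eval_prod, eval_sub, eval_X, eval_C, smul_eq_mul] at this
      rw [eval_mul, eval_C, this]
      simp only [mul_comm (ensembleDensity φ χ w _)]
      ring
    simp only [e]
    rw [integral_const_mul, integral_prod_sub_mul_ensembleDensity h hk, mul_zero]
  · intro z
    have := hP₀ ℂ (aeval z).toLinearMap
    simp only [AlgHom.toLinearMap_apply, nodalPoly, map_prod, map_sub, aeval_X, aeval_C] at this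
    rw [map_mul, aeval_C, this, norm_mul]
    have hn : ‖(algebraMap ℝ ℂ) Z⁻¹‖ = Z⁻¹ := by
      rw [norm_algebraMap', Real.norm_of_nonneg (inv_nonneg.2 hZ.le)]
    rw [hn, mul_comm, ← mul_assoc, mul_inv_cancel₀ hZ.ne', one_mul]
    refine (norm_integral_le_integral_norm _).trans (le_of_eq ?_)
    refine integral_congr_ae (ae_of_all _ fun x => ?_)
    simp only [norm_smul, norm_prod, Real.norm_of_nonneg (hnn x)]
    rw [mul_comm]
    rfl

end AverageCharPoly

/-! ### Zeros of biorthogonal polynomials -/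

/-- The function `f` does not change sign. -/
def ConstSign (f : ℝ → ℝ) : Prop := (∀ x, 0 ≤ f x) ∨ ∀ x, f x ≤ 0

lemma ConstSign.mul {f g : ℝ → ℝ} (hf : ConstSign f) (hg : ConstSign g) :
    ConstSign fun x => f x * g x := by
  rcases hf with hf | hf <;> rcases hg with hg | hg
  · exact .inl fun x => mul_nonneg (hf x) (hg x)
  · exact .inr fun x => mul_nonpos_of_nonneg_of_nonpos (hf x) (hg x)
  · exact .inr fun x => mul_nonpos_of_nonpos_of_nonneg (hf x) (hg x)
  · exact .inl fun x => mul_nonneg_of_nonpos_of_nonpos (hf x) (hg x)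

lemma ConstSign.pow {f : ℝ → ℝ} (hf : ConstSign f) (k : ℕ) : ConstSign fun x => f x ^ k := by
  induction k with
  | zero => exact .inl fun x => by simp
  | succ k ih => simpa only [pow_succ] using ih.mul hf

lemma ConstSign.prod {ι : Type*} {f : ι → ℝ → ℝ} (s : Finset ι) (hf : ∀ i ∈ s, ConstSign (f i)) :
    ConstSign fun x => ∏ i ∈ s, f i x := by
  classical
  induction s using Finset.induction_on with
  | empty => exact .inl fun x => by simp
  | insert i s hi ih =>
    simp only [Finset.prod_insert hi]
    exact (hf i (by simp)).mul (ih fun j hj => hf j (by simp [hj]))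

lemma constSign_of_ne_zero {f : ℝ → ℝ} (hf : Continuous f) (h0 : ∀ x, f x ≠ 0) : ConstSign f := by
  by_contra hc
  unfold ConstSign at hc
  push Not at hc
  obtain ⟨⟨x, hx⟩, y, hy⟩ := hc
  obtain ⟨z, hz⟩ := mem_range_of_exists_le_of_exists_ge hf ⟨x, hx.le⟩ ⟨y, hy.le⟩
  exact h0 z hz

lemma StrictMono.sub_mul_sub_nonneg {φ χ : ℝ → ℝ} (hφ : StrictMono φ) (hχ : StrictMono χ)
    (x y : ℝ) : 0 ≤ (φ x - φ y) * (χ x - χ y) := by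
  rcases le_total x y with h | h
  · exact mul_nonneg_of_nonpos_of_nonpos (sub_nonpos.2 (hφ.monotone h))
      (sub_nonpos.2 (hχ.monotone h))
  · exact mul_nonneg (sub_nonneg.2 (hφ.monotone h)) (sub_nonneg.2 (hχ.monotone h))

section Zeros

variable {φ χ w : ℝ → ℝ}

lemma integrable_eval_mul_pow_mul (h : ∀ i j : ℕ, Integrable fun t => φ t ^ i * χ t ^ j * w t)
    (P : ℝ[X]) (k : ℕ) : Integrable fun t => P.eval (φ t) * χ t ^ k * w t := by
  have e : (fun t => P.eval (φ t) * χ t ^ k * w t) =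
      fun t => ∑ i ∈ Finset.range (P.natDegree + 1), P.coeff i * (φ t ^ i * χ t ^ k * w t) := by
    funext t
    rw [eval_eq_sum_range, Finset.sum_mul, Finset.sum_mul]
    exact Finset.sum_congr rfl fun i _ => by ring
  rw [e]
  exact integrable_finsetSum _ fun i _ => (h i k).const_mul _

/-- A polynomial `P(φ)` that is orthogonal to `1, χ, …, χ^(n-1)` has at least `n` zeros: otherwise
a product of factors `χ - χ(z)` over its sign changes `z` would not be orthogonal to it. -/
lemma le_card_zeros_of_orthogonal (hφ : StrictMono φ) (hχ : StrictMono χ) (hφc : Continuous φ)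
    (hχc : Continuous χ) (hwc : Continuous w) (hw : ∀ t, 0 < w t)
    (h : ∀ i j : ℕ, Integrable fun t => φ t ^ i * χ t ^ j * w t) {n : ℕ} {P : ℝ[X]} (hP : P ≠ 0)
    (horth : ∀ k < n, ∫ t, P.eval (φ t) * χ t ^ k * w t = 0) :
    ∃ S : Finset ℝ, n ≤ S.card ∧ ∀ r ∈ S, r ∈ Set.range φ ∧ P.eval r = 0 := by
  classical
  set g : ℝ → ℝ := Function.invFun φ
  set S := P.roots.toFinset.filter fun r => r ∈ Set.range φ ∧ Odd (P.rootMultiplicity r) with hS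
  have hg : ∀ r ∈ Set.range φ, φ (g r) = r := fun r hr => Function.invFun_eq hr
  refine ⟨S, ?_, fun r hr => ?_⟩
  swap
  · rw [hS, Finset.mem_filter, Multiset.mem_toFinset, mem_roots hP] at hr
    exact ⟨hr.2.1, hr.1⟩
  by_contra hlt
  rw [not_le] at hlt
  -- the zeros of odd multiplicity are the sign changes of `P(φ)`; `T(χ)` changes sign with it
  set T : ℝ[X] := ∏ r ∈ S, (X - C (χ (g r))) with hT
  have hTdeg : T.natDegree = S.card := by
    rw [hT, natDegree_prod_of_monic _ _ fun _ _ => monic_X_sub_C _]; simp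
  have hTm : T.Monic := monic_prod_of_monic _ _ fun _ _ => monic_X_sub_C _
  have hmono := integrable_eval_mul_pow_mul h P
  have hexp : (fun t => P.eval (φ t) * T.eval (χ t) * w t) =
      fun t => ∑ k ∈ Finset.range n, T.coeff k * (P.eval (φ t) * χ t ^ k * w t) := by
    funext t
    rw [eval_eq_sum_range' (by rwa [hTdeg] : T.natDegree < n), Finset.mul_sum, Finset.sum_mul]
    exact Finset.sum_congr rfl fun i _ => by ring
  have hint : Integrable fun t => P.eval (φ t) * T.eval (χ t) * w t := by
    rw [hexp]
    exact integrable_finsetSum _ fun k _ => (hmono k).const_mul _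
  have hzero : ∫ t, P.eval (φ t) * T.eval (χ t) * w t = 0 := by
    rw [hexp, integral_finsetSum _ fun k _ => (hmono k).const_mul _]
    refine Finset.sum_eq_zero fun k hk => ?_
    rw [integral_const_mul, horth k (Finset.mem_range.1 hk), mul_zero]
  -- the integrand does not change sign
  have hsign : ConstSign fun t => P.eval (φ t) * T.eval (χ t) * w t := by
    obtain ⟨Q, hQ, -, hQr⟩ := exists_prod_multiset_X_sub_C_mul P
    have hQ0 : Q ≠ 0 := fun h0 => hP (by rw [← hQ, h0, mul_zero])
    have hSsub : S ⊆ P.roots.toFinset := Finset.filter_subset _ _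
    have hfac : ∀ t, P.eval (φ t) * T.eval (χ t) * w t =
        (∏ r ∈ P.roots.toFinset, ((φ t - r) ^ P.rootMultiplicity r *
          if r ∈ S then χ t - χ (g r) else 1)) * Q.eval (φ t) * w t := by
      intro t
      have e1 : P.eval (φ t) =
          (∏ r ∈ P.roots.toFinset, (φ t - r) ^ P.rootMultiplicity r) * Q.eval (φ t) := by
        conv_lhs => rw [← hQ, eval_mul, Finset.prod_multiset_map_count, eval_prod]
        simp only [eval_pow, eval_sub, eval_X, eval_C, count_roots]
      have e2 : T.eval (χ t) = ∏ r ∈ P.roots.toFinset,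
          if r ∈ S then χ t - χ (g r) else 1 := by
        rw [Finset.prod_ite_mem, Finset.inter_eq_right.2 hSsub, hT, eval_prod]
        simp only [eval_sub, eval_X, eval_C]
      rw [e1, e2, Finset.prod_mul_distrib]
      ring
    simp only [hfac]
    refine ((ConstSign.prod _ fun r hr => ?_).mul ?_).mul (.inl fun t => (hw t).le)
    · by_cases hrφ : r ∈ Set.range φ
      · rcases Nat.even_or_odd (P.rootMultiplicity r) with he | ho
        · have : r ∉ S := by
            rw [hS, Finset.mem_filter]
            exact fun hc => (Nat.not_odd_iff_even.2 he) hc.2.2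
          simp only [this, if_false, mul_one]
          exact .inl fun t => he.pow_nonneg _
        · have : r ∈ S := by
            rw [hS, Finset.mem_filter]
            exact ⟨hr, hrφ, ho⟩
          simp only [this, if_true]
          refine .inl fun t => ?_
          obtain ⟨m, hm⟩ := ho
          change 0 ≤ (φ t - r) ^ P.rootMultiplicity r * (χ t - χ (g r))
          rw [hm, pow_succ, mul_assoc]
          refine mul_nonneg (Even.pow_nonneg (even_two_mul m) _) ?_
          have := hφ.sub_mul_sub_nonneg hχ t (g r)
          rwa [hg r hrφ] at this
      · have : r ∉ S := by
          rw [hS, Finset.mem_filter]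
          exact fun hc => hrφ hc.2.1
        simp only [this, if_false, mul_one]
        exact (constSign_of_ne_zero (by fun_prop)
          fun t ht => hrφ ⟨t, sub_eq_zero.1 ht⟩).pow _
    · refine constSign_of_ne_zero (Q.continuous.comp hφc) fun t ht => ?_
      have : φ t ∈ Q.roots := (mem_roots hQ0).2 ht
      rw [hQr] at this
      exact Multiset.notMem_zero _ this
  -- hence it vanishes identically
  have hcont : Continuous fun t => P.eval (φ t) * T.eval (χ t) * w t :=
    ((P.continuous.comp hφc).mul (T.continuous.comp hχc)).mul hwc
  have hvan : (fun t => P.eval (φ t) * T.eval (χ t) * w t) = 0 := by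
    rw [← Continuous.ae_eq_iff_eq volume hcont continuous_zero]
    rcases hsign with hs | hs
    · exact (integral_eq_zero_iff_of_nonneg hs hint).1 hzero
    · have h1 : ∫ t, -(P.eval (φ t) * T.eval (χ t) * w t) = 0 := by
        rw [integral_neg, hzero, neg_zero]
      have := (integral_eq_zero_iff_of_nonneg (fun t => neg_nonneg.2 (hs t)) hint.neg).1 h1
      filter_upwards [this] with t ht
      simpa using ht
  have hroots : ∀ t, φ t ∈ P.roots.toFinset ∨ χ t ∈ T.roots.toFinset := fun t => by
    have h0 := congrFun hvan t
    simp only [Pi.zero_apply, mul_eq_zero, (hw t).ne', or_false] at h0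
    simp only [Multiset.mem_toFinset, mem_roots hP, mem_roots hTm.ne_zero]
    exact h0
  have hfin : (Set.univ : Set ℝ).Finite := by
    refine Set.Finite.subset (((P.roots.toFinset.finite_toSet).preimage
      hφ.injective.injOn).union ((T.roots.toFinset.finite_toSet).preimage hχ.injective.injOn))
      fun t _ => ?_
    exact hroots t
  exact Set.infinite_univ hfin

/-- The orthogonality relations determine a unique monic polynomial: the difference of two would have
too low a degree for its number of zeros. -/
lemma existsUnique_orthogonal (hφ : StrictMono φ) (hχ : StrictMono χ) (hφc : Continuous φ)
    (hχc : Continuous χ) (hwc : Continuous w) (hw : ∀ t, 0 < w t)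
    (h : ∀ i j : ℕ, Integrable fun t => φ t ^ i * χ t ^ j * w t) {n : ℕ}
    (hZ : 0 < ∫ x : Fin n → ℝ, ensembleDensity φ χ w x) :
    ∃! P : ℝ[X], P.Monic ∧ P.natDegree = n ∧ ∀ k < n, ∫ t, P.eval (φ t) * χ t ^ k * w t = 0 := by
  obtain ⟨P, hPm, hPd, hPo, -⟩ := exists_monic_orthogonal h n
    (ensembleDensity_nonneg hφ.monotone hχ.monotone fun t => (hw t).le) hZ
  refine ⟨P, ⟨hPm, hPd, hPo⟩, ?_⟩
  rintro Q ⟨hQm, hQd, hQo⟩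
  by_contra hne
  have h0 : Q - P ≠ 0 := sub_ne_zero.2 hne
  have hint := integrable_eval_mul_pow_mul h
  obtain ⟨S, hS, hSr⟩ := le_card_zeros_of_orthogonal hφ hχ hφc hχc hwc hw h h0 (n := n)
    fun k hk => by
      simp only [eval_sub, sub_mul]
      rw [integral_sub (hint Q k) (hint P k), hQo k hk, hPo k hk, sub_zero]
  have hsub : S ⊆ (Q - P).roots.toFinset := fun r hr =>
    Multiset.mem_toFinset.2 ((mem_roots h0).2 (hSr r hr).2)
  have h1 : S.card ≤ (Q - P).natDegree :=
    (Finset.card_le_card hsub).trans ((Multiset.toFinset_card_le _).trans (card_roots' _))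
  have h2 : (Q - P).degree < Q.degree :=
    degree_sub_lt_left (by rw [degree_eq_natDegree hQm.ne_zero, degree_eq_natDegree hPm.ne_zero,
      hQd, hPd])
      hQm.ne_zero (by rw [hQm.leadingCoeff, hPm.leadingCoeff])
  have h3 := (natDegree_lt_natDegree_iff h0).2 h2
  omega

lemma exists_enumeratesZeros (hφ : StrictMono φ) (hχ : StrictMono χ) (hφc : Continuous φ)
    (hχc : Continuous χ) (hwc : Continuous w) (hw : ∀ t, 0 < w t)
    (h : ∀ i j : ℕ, Integrable fun t => φ t ^ i * χ t ^ j * w t) {n : ℕ} {P : ℝ[X]}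
    (hPm : P.Monic) (hPd : P.natDegree = n)
    (hPo : ∀ k < n, ∫ t, P.eval (φ t) * χ t ^ k * w t = 0) :
    ∃ z : Fin n → ℝ, EnumeratesZeros (fun x => P.eval (φ x)) z := by
  classical
  obtain ⟨S, hS, hSr⟩ := le_card_zeros_of_orthogonal hφ hχ hφc hχc hwc hw h hPm.ne_zero hPo
  have hsub : S ⊆ P.roots.toFinset := fun r hr =>
    Multiset.mem_toFinset.2 ((mem_roots hPm.ne_zero).2 (hSr r hr).2)
  have hcard : P.roots.toFinset.card ≤ n :=
    (Multiset.toFinset_card_le _).trans ((card_roots' _).trans hPd.le)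
  have hSe : S = P.roots.toFinset := Finset.eq_of_subset_of_card_le hsub (hcard.trans hS)
  have hSn : S.card = n := le_antisymm (hSe ▸ hcard) hS
  set e := S.orderEmbOfFin hSn
  have hmem : ∀ j, e j ∈ S := fun j => Finset.orderEmbOfFin_mem S hSn j
  choose z hz using fun j => (hSr (e j) (hmem j)).1
  refine ⟨z, fun i j hij => ?_, ?_⟩
  · have : e i = e j := by rw [← hz i, ← hz j, hij]
    exact e.injective this
  · ext x
    constructor
    · rintro ⟨j, rfl⟩
      change P.eval (φ (z j)) = 0
      rw [hz j]
      exact (hSr _ (hmem j)).2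
    · intro hx
      have : φ x ∈ S := by
        rw [hSe, Multiset.mem_toFinset]
        exact (mem_roots hPm.ne_zero).2 hx
      have hr : φ x ∈ Set.range e := by
        rw [Finset.range_orderEmbOfFin]; exact this
      obtain ⟨j, hj⟩ := hr
      exact ⟨j, hφ.injective (by rw [hz j, hj])⟩

/-- A monic polynomial of degree `n` with `n` distinct zeros is their nodal polynomial. -/
lemma eq_nodalPoly_of_enumeratesZeros (hφ : StrictMono φ) {n : ℕ} {P : ℝ[X]} (hPm : P.Monic)
    (hPd : P.natDegree = n) {z : Fin n → ℝ} (hz : EnumeratesZeros (fun x => P.eval (φ x)) z) :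
    P = nodalPoly φ z := by
  refine (eq_of_monic_of_dvd_of_natDegree_le (nodalPoly_monic φ z) hPm ?_ ?_)
  · refine Fintype.prod_dvd_of_coprime (pairwise_coprime_X_sub_C (hφ.injective.comp hz.1))
      fun j => dvd_iff_isRoot.2 ?_
    have : z j ∈ {x | P.eval (φ x) = 0} := hz.2 ▸ Set.mem_range_self j
    exact this
  · rw [nodalPoly_natDegree, hPd]

end Zeros

/-! ### The logarithmic kernel and the energy of the equilibrium measure -/

/-- The interaction `log |t - s|⁻¹ + log |eᵗ - eˢ|⁻¹`, with the value `0` on the diagonal. -/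
noncomputable def logKernel (p : ℝ × ℝ) : ℝ :=
  Real.log (|p.1 - p.2|⁻¹) + Real.log (|Real.exp p.1 - Real.exp p.2|⁻¹)

lemma measurable_logKernel : Measurable logKernel := by
  unfold logKernel
  fun_prop

lemma log_abs_sub_le (t s : ℝ) : Real.log |t - s| ≤ |t| + |s| :=
  (Real.log_le_self (abs_nonneg _)).trans (abs_sub t s)

lemma log_abs_exp_sub_exp_le (t s : ℝ) : Real.log |Real.exp t - Real.exp s| ≤ |t| + |s| := by
  rcases eq_or_ne (Real.exp t - Real.exp s) 0 with h | h
  · rw [h, abs_zero, Real.log_zero]; positivity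
  · rw [Real.log_le_iff_le_exp (abs_pos.2 h), abs_sub_le_iff]
    have h1 : Real.exp t ≤ Real.exp (|t| + |s|) :=
      Real.exp_le_exp.2 (by linarith [le_abs_self t, abs_nonneg s])
    have h2 : Real.exp s ≤ Real.exp (|t| + |s|) :=
      Real.exp_le_exp.2 (by linarith [le_abs_self s, abs_nonneg t])
    constructor <;> linarith [Real.exp_pos t, Real.exp_pos s]

lemma neg_le_logKernel (p : ℝ × ℝ) : -(2 * (|p.1| + |p.2|)) ≤ logKernel p := by
  rw [logKernel, Real.log_inv, Real.log_inv]
  linarith [log_abs_sub_le p.1 p.2, log_abs_exp_sub_exp_le p.1 p.2]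

lemma logKernel_symm (t s : ℝ) : logKernel (t, s) = logKernel (s, t) := by
  simp only [logKernel, abs_sub_comm]

namespace EulerLagrange

variable {V : ℝ → ℝ} {μ : ProbabilityMeasure ℝ} {a b l : ℝ}

/-- On `[a, b]` the potential of `μ` is known, by the Euler–Lagrange equation. -/
lemma integral_logKernel_left (h : EulerLagrange V μ a b l) {s : ℝ} (hs : s ∈ Set.Icc a b) :
    ∫ t, logKernel (s, t) ∂(μ : Measure ℝ) = -V s - l := by
  have h0 := h.eq_zero s hs
  rw [effectivePotential] at h0
  have h1 := integral_add (h.integrable_log s).1 (h.integrable_log s).2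
  have h2 : ∀ t, logKernel (s, t) =
      Real.log (|t - s|⁻¹) + Real.log (|Real.exp t - Real.exp s|⁻¹) := fun t => by
    rw [logKernel_symm, logKernel]
  simp only [h2]
  linarith

lemma integrable_logKernel (h : EulerLagrange V μ a b l) :
    Integrable logKernel ((μ : Measure ℝ).prod (μ : Measure ℝ)) := by
  have ha : Integrable (fun t : ℝ => |t|) (μ : Measure ℝ) := h.integrable_of_continuous continuous_abs
  have hg : Integrable (fun p : ℝ × ℝ => 2 * (|p.1| + |p.2|))
      ((μ : Measure ℝ).prod (μ : Measure ℝ)) :=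
    ((ha.comp_fst _).add (ha.comp_snd _)).const_mul 2
  -- a nonnegative kernel, whose partial integrals are known
  have key : Integrable (fun p : ℝ × ℝ => logKernel p + 2 * (|p.1| + |p.2|))
      ((μ : Measure ℝ).prod (μ : Measure ℝ)) := by
    have hm : Measurable (fun p : ℝ × ℝ => logKernel p + 2 * (|p.1| + |p.2|)) :=
      measurable_logKernel.add (by fun_prop)
    have hk : ∀ s, Integrable (fun t => logKernel (s, t)) (μ : Measure ℝ) := fun s => by
      refine ((h.integrable_log s).1.add (h.integrable_log s).2).congr (ae_of_all _ fun t => ?_)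
      exact (logKernel_symm s t).symm
    have hg' : ∀ s : ℝ, Integrable (fun t => 2 * (|s| + |t|)) (μ : Measure ℝ) := fun s =>
      ((integrable_const _).add ha).const_mul 2
    rw [integrable_prod_iff hm.aestronglyMeasurable]
    refine ⟨ae_of_all _ fun s => (hk s).add (hg' s), ?_⟩
    have hi : Integrable (fun s => -V s - l + ∫ t, 2 * (|s| + |t|) ∂(μ : Measure ℝ))
        (μ : Measure ℝ) :=
      ((h.integrable_of_continuous h.continuous).neg.sub (integrable_const _)).add
        hg.integral_prod_left
    refine hi.congr ?_
    filter_upwards [h.ae_mem] with s hs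
    rw [← h.integral_logKernel_left hs, ← integral_add (hk s) (hg' s)]
    refine integral_congr_ae (ae_of_all _ fun t => ?_)
    have := neg_le_logKernel (s, t)
    exact (Real.norm_of_nonneg (show 0 ≤ logKernel (s, t) + 2 * (|s| + |t|) by linarith)).symm
  refine (key.sub hg).congr (ae_of_all _ fun p => ?_)
  simp

lemma integral_logKernel (h : EulerLagrange V μ a b l) :
    ∫ p, logKernel p ∂((μ : Measure ℝ).prod (μ : Measure ℝ)) = -(∫ t, V t ∂(μ : Measure ℝ)) - l := by
  rw [integral_prod _ h.integrable_logKernel]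
  have e : ∀ᵐ s ∂(μ : Measure ℝ), ∫ t, logKernel (s, t) ∂(μ : Measure ℝ) = -V s - l := by
    filter_upwards [h.ae_mem] with s hs using h.integral_logKernel_left hs
  have hi : Integrable (fun s => -V s) (μ : Measure ℝ) :=
    (h.integrable_of_continuous h.continuous).neg
  rw [integral_congr_ae e, integral_sub hi (integrable_const _), integral_neg]
  simp

end EulerLagrange

/-- Restricting `μ` to the set where its density is bounded changes the energy by an arbitrarily
small amount. -/
lemma EulerLagrange.exists_bounded_density {V : ℝ → ℝ} {μ : ProbabilityMeasure ℝ} {a b l : ℝ}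
    (h : EulerLagrange V μ a b l) {ψ : ℝ → ℝ} (hψ : Measurable ψ)
    (hμψ : (μ : Measure ℝ) = volume.withDensity (fun x => ENNReal.ofReal (ψ x)))
    {δ : ℝ} (hδ : 0 < δ) :
    ∃ (ν : Measure ℝ) (K : NNReal), IsProbabilityMeasure ν ∧ 0 < K ∧ ν ≤ K • volume ∧
      Integrable V ν ∧ Integrable logKernel (ν.prod ν) ∧
      1 / 2 * (∫ p, logKernel p ∂(ν.prod ν)) + ∫ t, V t ∂ν ≤
        1 / 2 * ((∫ t, V t ∂(μ : Measure ℝ)) - l) + δ := by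
  set m : Measure ℝ := (μ : Measure ℝ) with hm
  set A : ℕ → Set ℝ := fun N => {x | ψ x ≤ N} with hA
  have hAm : ∀ N, MeasurableSet (A N) := fun N => measurableSet_le hψ measurable_const
  have hAmono : Monotone A := fun N N' hN x hx =>
    le_trans (show ψ x ≤ N from hx) (by exact_mod_cast hN : (N : ℝ) ≤ N')
  have hAU : ⋃ N, A N = Set.univ := Set.eq_univ_of_forall fun x => by
    obtain ⟨N, hN⟩ := exists_nat_ge (ψ x)
    exact Set.mem_iUnion.2 ⟨N, hN⟩
  have hAAU : ⋃ N, A N ×ˢ A N = Set.univ := Set.eq_univ_of_forall fun x => by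
    obtain ⟨N, hN⟩ := exists_nat_ge (max (ψ x.1) (ψ x.2))
    exact Set.mem_iUnion.2 ⟨N, (le_max_left _ _).trans hN, (le_max_right _ _).trans hN⟩
  have hV := h.integrable_of_continuous h.continuous
  have hk := h.integrable_logKernel
  have t1 : Tendsto (fun N => ∫ t in A N, V t ∂m) atTop (𝓝 (∫ t, V t ∂m)) := by
    have := tendsto_setIntegral_of_monotone hAm hAmono (f := V) (μ := m) hV.integrableOn
    rwa [hAU, setIntegral_univ] at this
  have t2 : Tendsto (fun N => ∫ p in A N ×ˢ A N, logKernel p ∂(m.prod m)) atTop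
      (𝓝 (∫ p, logKernel p ∂(m.prod m))) := by
    have := tendsto_setIntegral_of_monotone (fun N => (hAm N).prod (hAm N))
      (fun N N' hN => Set.prod_mono (hAmono hN) (hAmono hN)) (f := logKernel) (μ := m.prod m)
      hk.integrableOn
    rwa [hAAU, setIntegral_univ] at this
  have t3 : Tendsto (fun N => m.real (A N)) atTop (𝓝 1) := by
    have := tendsto_setIntegral_of_monotone hAm hAmono (f := fun _ => (1 : ℝ)) (μ := m)
      (integrable_const _).integrableOn
    rw [hAU, setIntegral_univ] at this
    simpa using this
  have t4 : Tendsto (fun N => 1 / 2 * ((m.real (A N))⁻¹ * ((m.real (A N))⁻¹ *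
      ∫ p in A N ×ˢ A N, logKernel p ∂(m.prod m))) + (m.real (A N))⁻¹ * ∫ t in A N, V t ∂m) atTop
      (𝓝 (1 / 2 * ((∫ t, V t ∂m) - l))) := by
    have := (((t3.inv₀ one_ne_zero).mul ((t3.inv₀ one_ne_zero).mul t2)).const_mul (1 / 2)).add
      ((t3.inv₀ one_ne_zero).mul t1)
    rw [h.integral_logKernel] at this
    convert this using 2
    rw [inv_one]; ring
  -- `ψ ≤ N` on the set `A N`, so that the conditioned measure has density at most `N / μ (A N)`;
  -- `N + 1` in place of `N` makes `K` positive
  obtain ⟨N, hN1, hN2⟩ := ((t3.eventually_const_lt (show (0 : ℝ) < 1 by norm_num)).and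
    (t4.eventually_le_const (show _ < 1 / 2 * ((∫ t, V t ∂m) - l) + δ by linarith))).exists
  have hc0 : m (A N) ≠ 0 := fun h0 => by
    rw [measureReal_def, h0] at hN1
    simp at hN1
  have hp : IsProbabilityMeasure (ProbabilityTheory.cond m (A N)) :=
    ProbabilityTheory.cond_isProbabilityMeasure hc0
  have hci : (m (A N))⁻¹ ≠ ⊤ := ENNReal.inv_ne_top.2 hc0
  have hcd : ProbabilityTheory.cond m (A N) = (m (A N))⁻¹ • m.restrict (A N) := rfl
  have hpp : (ProbabilityTheory.cond m (A N)).prod (ProbabilityTheory.cond m (A N)) =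
      (m (A N))⁻¹ • (m (A N))⁻¹ • (m.prod m).restrict (A N ×ˢ A N) := by
    rw [hcd, Measure.prod_smul_left, Measure.prod_smul_right, Measure.prod_restrict]
  have hr : ((m (A N))⁻¹).toReal = (m.real (A N))⁻¹ := by
    rw [ENNReal.toReal_inv, measureReal_def]
  refine ⟨ProbabilityTheory.cond m (A N), ((m (A N))⁻¹ * (N + 1 : ℕ)).toNNReal, hp, ?_, ?_, ?_, ?_, ?_⟩
  · refine ENNReal.toNNReal_pos (mul_ne_zero (ENNReal.inv_ne_zero.2 (measure_ne_top _ _)) ?_)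
      (ENNReal.mul_ne_top hci (ENNReal.natCast_ne_top _))
    exact_mod_cast N.succ_ne_zero
  · refine Measure.le_intro fun s hs _ => ?_
    rw [Measure.smul_apply, ENNReal.smul_def, ENNReal.coe_toNNReal
      (ENNReal.mul_ne_top hci (ENNReal.natCast_ne_top _)), hcd, Measure.smul_apply, smul_eq_mul,
      smul_eq_mul, mul_assoc]
    gcongr
    rw [Measure.restrict_apply hs, hμψ, withDensity_apply _ (hs.inter (hAm N))]
    calc ∫⁻ x in s ∩ A N, ENNReal.ofReal (ψ x) ≤ ∫⁻ x in s ∩ A N, ((N + 1 : ℕ) : ENNReal) := by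
          refine setLIntegral_mono measurable_const fun x hx => ?_
          rw [← ENNReal.ofReal_natCast]
          refine ENNReal.ofReal_le_ofReal (le_trans hx.2 ?_)
          push_cast; linarith
      _ = ((N + 1 : ℕ) : ENNReal) * volume (s ∩ A N) := setLIntegral_const _ _
      _ ≤ _ := by gcongr; exact Set.inter_subset_left
  · rw [hcd]; exact hV.restrict.smul_measure hci
  · rw [hpp]; exact (hk.restrict.smul_measure hci).smul_measure hci
  · rw [hpp, hcd, integral_smul_measure, integral_smul_measure, integral_smul_measure, hr]
    simpa only [smul_eq_mul] using hN2

/-! ### The density of a point configuration -/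

lemma integrable_exp_neg_mul_abs {c : ℝ} (hc : 0 < c) :
    Integrable fun t : ℝ => Real.exp (-(c * |t|)) := by
  have h1 : Integrable ((Set.Ioi (-1 : ℝ)).indicator fun t => Real.exp (-c * t)) :=
    (exp_neg_integrableOn_Ioi (-1) hc).integrable_indicator measurableSet_Ioi
  refine (h1.add h1.comp_neg).mono' (by fun_prop) (ae_of_all _ fun t => ?_)
  have h0 : ∀ s : ℝ, 0 ≤ (Set.Ioi (-1 : ℝ)).indicator (fun t => Real.exp (-c * t)) s := fun s =>
    Set.indicator_nonneg (fun _ _ => (Real.exp_pos _).le) s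
  rw [Real.norm_eq_abs, Real.abs_exp, Pi.add_apply]
  rcases le_total 0 t with ht | ht
  · have := h0 (-t)
    rw [Set.indicator_of_mem (show t ∈ Set.Ioi (-1 : ℝ) from by simp; linarith), abs_of_nonneg ht,
      ← neg_mul]
    linarith
  · have := h0 t
    rw [Set.indicator_of_mem (show -t ∈ Set.Ioi (-1 : ℝ) from by simp; linarith), abs_of_nonpos ht,
      ← neg_mul]
    linarith

/-- All mixed moments of the weight `e^{-nV}` are finite. -/
lemma integrable_moment {V : ℝ → ℝ} (hVc : Continuous V)
    (hg : ∀ K : ℝ, ∃ C : ℝ, ∀ t, K * |t| - C ≤ V t) {n : ℕ} (hn : 1 ≤ n) (i j : ℕ) :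
    Integrable fun t : ℝ => t ^ i * Real.exp t ^ j * Real.exp (-(n * V t)) := by
  -- the slope pays for `|t| ^ i ≤ e ^ (i |t|)`, for `e ^ (j t)` and for the convergence
  obtain ⟨C, hC⟩ := hg (i + j + 1)
  refine ((integrable_exp_neg_mul_abs one_pos).const_mul (Real.exp (n * C))).mono' (by fun_prop)
    (ae_of_all _ fun t => ?_)
  have h1 : |t| ^ i ≤ Real.exp (i * |t|) := by
    rw [Real.exp_nat_mul]
    exact pow_le_pow_left₀ (abs_nonneg t) (by linarith [Real.add_one_le_exp |t|]) i
  have h2 : Real.exp t ^ j ≤ Real.exp (j * |t|) := by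
    rw [← Real.exp_nat_mul]
    exact Real.exp_le_exp.2 (mul_le_mul_of_nonneg_left (le_abs_self t) (Nat.cast_nonneg j))
  have hn' : (1 : ℝ) ≤ n := by exact_mod_cast hn
  rw [norm_mul, norm_mul, Real.norm_eq_abs, Real.norm_eq_abs, Real.norm_eq_abs, abs_pow,
    abs_of_pos (pow_pos (Real.exp_pos t) j), Real.abs_exp]
  calc |t| ^ i * Real.exp t ^ j * Real.exp (-(n * V t))
      ≤ Real.exp (i * |t|) * Real.exp (j * |t|) *
        Real.exp (n * C - n * ((i + j + 1) * |t|)) := by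
        gcongr
        have := mul_le_mul_of_nonneg_left (hC t) (zero_le_one.trans hn')
        linarith
    _ = Real.exp (i * |t| + j * |t| + (n * C - n * ((i + j + 1) * |t|))) := by
        rw [Real.exp_add, Real.exp_add]
    _ ≤ Real.exp (n * C + -(1 * |t|)) := by
        refine Real.exp_le_exp.2 ?_
        have h0 : 0 ≤ (i + j + 1) * |t| := by positivity
        nlinarith [mul_le_mul_of_nonneg_right hn' h0]
    _ = _ := Real.exp_add _ _

/-- Sum over all pairs in terms of the sum over ordered pairs `i < j`. -/
lemma sum_sum_eq_of_symm {n : ℕ} {f : Fin n → Fin n → ℝ} {c : ℝ} (hf : ∀ i j, f i j = f j i)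
    (hc : ∀ i, f i i = c) :
    ∑ i, ∑ j, f i j = 2 * (∑ i, ∑ j ∈ Finset.Ioi i, f i j) + n * c := by
  have h1 := Finset.sum_sum_Ioi_add_eq_sum_sum_off_diag f
  have h2 : ∀ i, ∑ j, f i j = (∑ j ∈ {i}ᶜ, f j i) + c := fun i => by
    rw [← Finset.sum_compl_add_sum ({i} : Finset (Fin n)) (fun j => f i j), Finset.sum_singleton, hc]
    exact congrArg (· + c) (Finset.sum_congr rfl fun j _ => hf i j)
  simp only [h2, Finset.sum_add_distrib, ← h1, Finset.sum_const, Finset.card_univ,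
    Fintype.card_fin, nsmul_eq_mul]
  simp only [hf, Finset.mul_sum, two_mul]
  simp only [Finset.sum_add_distrib]

/-- Off the diagonals the density is the exponential of minus the energy of the point
configuration. -/
lemma ensembleDensity_eq_exp (V : ℝ → ℝ) {n : ℕ} {x : Fin n → ℝ} (hx : Function.Injective x)
    (c : ℝ) :
    ensembleDensity id Real.exp (fun t => Real.exp (-(c * V t))) x =
      Real.exp (-((∑ i, ∑ j ∈ Finset.Ioi i, logKernel (x i, x j)) + c * ∑ i, V (x i))) := by
  have h1 := vandermonde_mul_vandermonde_nonneg monotone_id Real.exp_monotone x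
  rw [ensembleDensity, ← abs_of_nonneg h1, abs_mul, Matrix.det_vandermonde,
    Matrix.det_vandermonde, neg_add, Real.exp_add, Finset.mul_sum, ← Finset.sum_neg_distrib,
    Real.exp_sum, ← Finset.sum_neg_distrib, Real.exp_sum]
  congr 1
  rw [Finset.abs_prod, Finset.abs_prod, ← Finset.prod_mul_distrib]
  refine Finset.prod_congr rfl fun i _ => ?_
  rw [Finset.abs_prod, Finset.abs_prod, ← Finset.prod_mul_distrib, ← Finset.sum_neg_distrib,
    Real.exp_sum]
  refine Finset.prod_congr rfl fun j hj => ?_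
  have hij : x j - x i ≠ 0 := sub_ne_zero.2 fun h => (Finset.mem_Ioi.1 hj).ne' (hx h)
  have hij' : Real.exp (x j) - Real.exp (x i) ≠ 0 :=
    sub_ne_zero.2 fun h => (Finset.mem_Ioi.1 hj).ne' (hx (Real.exp_injective h))
  rw [logKernel_symm, logKernel, Real.log_inv, Real.log_inv, neg_add, neg_neg, neg_neg,
    Real.exp_add, Real.exp_log (abs_pos.2 hij), Real.exp_log (abs_pos.2 hij')]
  rfl

lemma abs_le_exp_softLog (ε d : ℝ) : |d| ≤ Real.exp (softLog ε d) := by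
  rcases eq_or_ne d 0 with rfl | hd
  · simpa using (Real.exp_pos _).le
  · exact (Real.log_le_iff_le_exp (abs_pos.2 hd)).1 (log_abs_le_softLog hd)

lemma ensembleDensity_le_exp (V : ℝ → ℝ) (ε : ℝ) {n : ℕ} (x : Fin n → ℝ) (c : ℝ) :
    ensembleDensity id Real.exp (fun t => Real.exp (-(c * V t))) x ≤
      Real.exp ((∑ i, ∑ j ∈ Finset.Ioi i, softLog ε (x i - x j)) +
        (∑ i, ∑ j ∈ Finset.Ioi i, softLog ε (Real.exp (x i) - Real.exp (x j))) -
          c * ∑ i, V (x i)) := by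
  have hv : ∀ v : Fin n → ℝ, |(Matrix.vandermonde v).det| ≤
      Real.exp (∑ i, ∑ j ∈ Finset.Ioi i, softLog ε (v i - v j)) := fun v => by
    rw [Matrix.det_vandermonde, Finset.abs_prod, Real.exp_sum]
    refine Finset.prod_le_prod (fun _ _ => abs_nonneg _) fun i _ => ?_
    rw [Finset.abs_prod, Real.exp_sum]
    refine Finset.prod_le_prod (fun _ _ => abs_nonneg _) fun j _ => ?_
    rw [abs_sub_comm]
    exact abs_le_exp_softLog ε _
  have h1 := vandermonde_mul_vandermonde_nonneg monotone_id Real.exp_monotone x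
  rw [ensembleDensity, ← abs_of_nonneg h1, abs_mul, sub_eq_add_neg, Real.exp_add, Real.exp_add,
    Finset.mul_sum, ← Finset.sum_neg_distrib, Real.exp_sum Finset.univ fun i => -(c * V (x i))]
  exact mul_le_mul_of_nonneg_right (mul_le_mul (hv _) (hv _) (abs_nonneg _) (Real.exp_pos _).le)
    (Finset.prod_nonneg fun _ _ => (Real.exp_pos _).le)

/-! ### Empirical measures -/

lemma coe_countingMeasure {n : ℕ} (x : Fin n → ℝ) :
    (countingMeasure x : Measure ℝ) = (n : NNReal)⁻¹ • ∑ j, Measure.dirac (x j) := by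
  rw [countingMeasure, FiniteMeasure.toMeasure_smul]
  congr 1
  have : ∀ s : Finset (Fin n), ((∑ j ∈ s, (diracProba (x j)).toFiniteMeasure : FiniteMeasure ℝ) :
      Measure ℝ) = ∑ j ∈ s, Measure.dirac (x j) := fun s => by
    induction s using Finset.induction_on with
    | empty => simp
    | insert j s hj ih => 
      rw [Finset.sum_insert hj, Finset.sum_insert hj, FiniteMeasure.toMeasure_add, ih]; rfl
  exact this _

lemma isProbabilityMeasure_countingMeasure {n : ℕ} (hn : 1 ≤ n) (x : Fin n → ℝ) :
    IsProbabilityMeasure (countingMeasure x : Measure ℝ) := by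
  refine ⟨?_⟩
  rw [coe_countingMeasure, Measure.smul_apply, Measure.finsetSum_apply]
  simp only [measure_univ, Finset.sum_const, Finset.card_univ, Fintype.card_fin, nsmul_eq_mul,
    mul_one, ENNReal.smul_def, smul_eq_mul]
  have : (n : NNReal) ≠ 0 := by exact_mod_cast (by omega : n ≠ 0)
  rw [ENNReal.coe_inv this]
  exact ENNReal.inv_mul_cancel (by exact_mod_cast this) (ENNReal.natCast_ne_top n)

lemma integrable_countingMeasure {n : ℕ} (x : Fin n → ℝ) (f : ℝ → ℝ) :
    Integrable f (countingMeasure x : Measure ℝ) := by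
  rw [coe_countingMeasure]
  refine Integrable.smul_measure_nnreal ?_
  exact integrable_finsetSum_measure.2 fun j _ => integrable_dirac (by simp)

lemma integral_countingMeasure {n : ℕ} (x : Fin n → ℝ) (f : ℝ → ℝ) :
    ∫ t, f t ∂(countingMeasure x : Measure ℝ) = (n : ℝ)⁻¹ * ∑ j, f (x j) := by
  rw [coe_countingMeasure, integral_smul_nnreal_measure, integral_finsetSum_measure fun j _ =>
    integrable_dirac (by simp)]
  simp [NNReal.smul_def]

lemma softPotential_map_countingMeasure {y : ℝ} (hy : 0 < y) {φ : ℝ → ℝ} (hφ : Measurable φ)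
    {n : ℕ} (x : Fin n → ℝ) (u : ℝ) :
    softPotential y ((countingMeasure x : Measure ℝ).map φ) u =
      (n : ℝ)⁻¹ * ∑ j, softLog y (u - φ (x j)) := by
  rw [softPotential_map hy _ hφ, integral_countingMeasure]

lemma mutualEnergy_map_countingMeasure {y : ℝ} (hy : 0 < y) {φ : ℝ → ℝ} (hφ : Measurable φ)
    {n : ℕ} (hn : 1 ≤ n) (x : Fin n → ℝ) :
    mutualEnergy y ((countingMeasure x : Measure ℝ).map φ) ((countingMeasure x : Measure ℝ).map φ) =
      (n : ℝ)⁻¹ * ∑ i, ((n : ℝ)⁻¹ * ∑ j, softLog y (φ (x i) - φ (x j))) := by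
  have := isProbabilityMeasure_countingMeasure hn x
  have : IsProbabilityMeasure ((countingMeasure x : Measure ℝ).map φ) :=
    Measure.isProbabilityMeasure_map hφ.aemeasurable
  have hl : HasLogMoment ((countingMeasure x : Measure ℝ).map φ) := by
    rw [HasLogMoment, integrable_map_measure
      (by fun_prop : Measurable fun t : ℝ => Real.log (1 + |t|)).aestronglyMeasurable hφ.aemeasurable]
    exact integrable_countingMeasure _ _
  rw [mutualEnergy_eq_integral_softPotential hy hl hl, integral_map hφ.aemeasurable
    (continuous_softPotential hy hl).aestronglyMeasurable, integral_countingMeasure]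
  simp only [softPotential_map_countingMeasure hy hφ]

/-- The density is controlled by the regularized energy of the empirical measure; the regularized
self-interactions cost a factor `ε⁻ⁿ`. -/
lemma ensembleDensity_le_exp_regEnergy (V : ℝ → ℝ) {ε : ℝ} (hε : 0 < ε) {n : ℕ} (hn : 1 ≤ n)
    (x : Fin n → ℝ) :
    ensembleDensity id Real.exp (fun t => Real.exp (-(n * V t))) x ≤
      Real.exp (-((n : ℝ) ^ 2 * regEnergy V ε (countingMeasure x : Measure ℝ)) -
        n * Real.log ε) := by
  refine (ensembleDensity_le_exp V ε x n).trans (Real.exp_le_exp.2 (le_of_eq ?_))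
  have hn' : (n : ℝ) ≠ 0 := by exact_mod_cast (by omega : n ≠ 0)
  have e1 := mutualEnergy_map_countingMeasure hε measurable_id hn x
  have e2 := mutualEnergy_map_countingMeasure hε Real.measurable_exp hn x
  rw [Measure.map_id] at e1
  simp only [id, ← Finset.mul_sum] at e1 e2
  have s1 := sum_sum_eq_of_symm (f := fun i j => softLog ε (x i - x j)) (c := Real.log ε)
    (fun i j => by rw [← softLog_neg, neg_sub]) (fun i => by rw [sub_self, softLog_zero ε])
  have s2 := sum_sum_eq_of_symm (f := fun i j => softLog ε (Real.exp (x i) - Real.exp (x j)))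
    (c := Real.log ε) (fun i j => by rw [← softLog_neg, neg_sub])
    (fun i => by rw [sub_self, softLog_zero ε])
  rw [regEnergy, e1, e2, integral_countingMeasure, s1, s2]
  field_simp
  ring

/-! ### Lower bound for the partition function -/

lemma measurePreserving_pair {ν : Measure ℝ} [IsProbabilityMeasure ν] {n : ℕ} {i j : Fin n}
    (hij : i ≠ j) :
    MeasurePreserving (fun x : Fin n → ℝ => (x i, x j)) (Measure.pi fun _ => ν) (ν.prod ν) := by
  refine ⟨by fun_prop, ?_⟩
  have h := (ProbabilityTheory.iIndepFun_pi (μ := fun _ : Fin n => ν) (X := fun _ => id)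
    fun _ => aemeasurable_id).indepFun hij
  simp only [id] at h
  rw [ProbabilityTheory.indepFun_iff_map_prod_eq_prod_map_map (measurable_pi_apply i).aemeasurable
    (measurable_pi_apply j).aemeasurable] at h
  rw [h, (measurePreserving_eval (fun _ : Fin n => ν) i).map_eq,
    (measurePreserving_eval (fun _ : Fin n => ν) j).map_eq]

lemma ae_fst_ne_snd (ν : Measure ℝ) [SFinite ν] [NullSingletonClass ν] :
    ∀ᵐ p ∂(ν.prod ν), p.1 ≠ p.2 := by
  rw [Measure.ae_prod_iff_ae_ae]
  · exact ae_of_all _ fun s => by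
      filter_upwards [Measure.ae_ne ν s] with t ht using ht.symm
  · exact (measurableSet_eq_fun measurable_fst measurable_snd).compl

lemma ae_injective_pi {ν : Measure ℝ} [IsProbabilityMeasure ν] [NullSingletonClass ν] (n : ℕ) :
    ∀ᵐ x ∂(Measure.pi fun _ : Fin n => ν), Function.Injective x := by
  have h1 : ∀ i j : Fin n, i ≠ j → ∀ᵐ x ∂(Measure.pi fun _ : Fin n => ν), x i ≠ x j :=
    fun i j hij => (measurePreserving_pair hij).quasiMeasurePreserving.ae (ae_fst_ne_snd ν)
  have h2 : ∀ᵐ x ∂(Measure.pi fun _ : Fin n => ν), ∀ i j : Fin n, i ≠ j → x i ≠ x j := by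
    rw [ae_all_iff]; intro i
    rw [ae_all_iff]; intro j
    by_cases hij : i = j
    · exact ae_of_all _ fun x h => absurd hij h
    · filter_upwards [h1 i j hij] with x hx _ using hx
  filter_upwards [h2] with x hx i j h
  by_contra hij
  exact hx i j hij h

lemma pi_le_smul_volume {ν : Measure ℝ} [IsProbabilityMeasure ν] {K : NNReal} (hK : 0 < K)
    (hν : ν ≤ K • volume) (n : ℕ) :
    (Measure.pi fun _ : Fin n => ν) ≤ K ^ n • (volume : Measure (Fin n → ℝ)) := by
  have h : ((K ^ n)⁻¹ • (Measure.pi fun _ : Fin n => ν)).toOuterMeasure ≤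
      OuterMeasure.pi fun _ : Fin n => (volume : Measure ℝ).toOuterMeasure := by
    rw [OuterMeasure.le_pi]
    intro s _
    change ((K ^ n)⁻¹ • (Measure.pi fun _ : Fin n => ν)) (Set.univ.pi s) ≤ ∏ i, volume (s i)
    rw [Measure.smul_apply, Measure.pi_pi]
    calc (K ^ n)⁻¹ • ∏ i, ν (s i) ≤ (K ^ n)⁻¹ • ∏ i, (K • volume (s i)) := by
          gcongr with i _
          exact hν (s i)
      _ = ((K ^ n)⁻¹ * K ^ n) • ∏ i, volume (s i) := by
          rw [Finset.prod_smul, mul_smul, Finset.prod_const, Finset.card_univ, Fintype.card_fin]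
      _ = ∏ i, volume (s i) := by rw [inv_mul_cancel₀ (pow_pos hK n).ne', one_smul]
  refine Measure.le_intro fun s hs _ => ?_
  have h1 : ((K ^ n)⁻¹ • (Measure.pi fun _ : Fin n => ν)) s ≤ volume s := by
    refine (h s).trans (le_of_eq ?_)
    rw [volume_pi, Measure.pi, toMeasure_apply _ _ hs]
  rw [Measure.smul_apply] at h1 ⊢
  calc Measure.pi (fun _ : Fin n => ν) s
      = K ^ n • (K ^ n)⁻¹ • Measure.pi (fun _ : Fin n => ν) s := by
        rw [smul_smul, mul_inv_cancel₀ (pow_pos hK n).ne', one_smul]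
    _ ≤ _ := by gcongr

/-- Jensen's inequality for the partition function, with a trial product measure. -/
lemma exp_le_integral_ensembleDensity {V : ℝ → ℝ} {ν : Measure ℝ} [IsProbabilityMeasure ν]
    {K : NNReal} (hK : 0 < K) (hν : ν ≤ K • volume) (hV : Integrable V ν)
    (hk : Integrable logKernel (ν.prod ν)) {n : ℕ}
    (hD : Integrable fun x : Fin n → ℝ =>
      ensembleDensity id Real.exp (fun t => Real.exp (-(n * V t))) x) :
    Real.exp (-((n : ℝ) ^ 2 * (1 / 2 * (∫ p, logKernel p ∂(ν.prod ν)) + ∫ t, V t ∂ν)) +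
      n / 2 * ∫ p, logKernel p ∂(ν.prod ν)) ≤ K ^ n *
      ∫ x : Fin n → ℝ, ensembleDensity id Real.exp (fun t => Real.exp (-(n * V t))) x := by
  set P : Measure (Fin n → ℝ) := Measure.pi fun _ => ν with hP
  set D : (Fin n → ℝ) → ℝ := fun x =>
    ensembleDensity id Real.exp (fun t => Real.exp (-(n * V t))) x with hDdef
  set E := ∫ p, logKernel p ∂(ν.prod ν) with hE
  set v := ∫ t, V t ∂ν with hv
  have hna : NullSingletonClass ν := ⟨fun x => by
    refine le_antisymm ((hν _).trans ?_) bot_le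
    simp⟩
  have hPK := pi_le_smul_volume hK hν n
  have hD0 : ∀ x, 0 ≤ D x := ensembleDensity_nonneg monotone_id Real.exp_monotone
    fun t => (Real.exp_pos _).le
  set G : (Fin n → ℝ) → ℝ := fun x =>
    -((∑ i, ∑ j ∈ Finset.Ioi i, logKernel (x i, x j)) + n * ∑ i, V (x i)) with hG
  have i1 : ∀ i, ∀ j ∈ Finset.Ioi i, Integrable (fun x : Fin n → ℝ => logKernel (x i, x j)) P :=
    fun i j hj => (measurePreserving_pair (Finset.mem_Ioi.1 hj).ne).integrable_comp_of_integrable hk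
  have i2 : ∀ i, Integrable (fun x : Fin n → ℝ => V (x i)) P := fun i =>
    (measurePreserving_eval (fun _ : Fin n => ν) i).integrable_comp_of_integrable hV
  have i1' : Integrable (fun x : Fin n → ℝ => ∑ i, ∑ j ∈ Finset.Ioi i, logKernel (x i, x j)) P :=
    integrable_finsetSum _ fun i _ => integrable_finsetSum _ (i1 i)
  have i2' : Integrable (fun x : Fin n → ℝ => n * ∑ i, V (x i)) P :=
    (integrable_finsetSum _ fun i _ => i2 i).const_mul _
  have iG : Integrable G P := (i1'.add i2').neg
  have e1 : ∀ i, ∀ j ∈ Finset.Ioi i, ∫ x : Fin n → ℝ, logKernel (x i, x j) ∂P = E := fun i j hj => by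
    have mp := measurePreserving_pair (ν := ν) (Finset.mem_Ioi.1 hj).ne
    rw [hE, ← mp.map_eq, integral_map mp.measurable.aemeasurable
      measurable_logKernel.aestronglyMeasurable]
  have e2 : ∀ i, ∫ x : Fin n → ℝ, V (x i) ∂P = v := fun i => by
    have mp := measurePreserving_eval (fun _ : Fin n => ν) i
    rw [hv]
    conv_rhs => rw [← mp.map_eq]
    rw [integral_map mp.measurable.aemeasurable (by rw [mp.map_eq]; exact hV.1)]
  have hcard : 2 * (∑ i : Fin n, ∑ j ∈ Finset.Ioi i, E) = n * (n * E) - n * E := by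
    have := sum_sum_eq_of_symm (n := n) (f := fun _ _ => E) (c := E) (fun _ _ => rfl) fun _ => rfl
    simp only [Finset.sum_const, Finset.card_univ, Fintype.card_fin, nsmul_eq_mul] at this ⊢
    linarith
  have eG : ∫ x, G x ∂P = -((n : ℝ) ^ 2 * (1 / 2 * E + v)) + n / 2 * E := by
    have := integral_add i1' i2'
    rw [hG, integral_neg, this, integral_finsetSum _ fun i _ => integrable_finsetSum _ (i1 i),
      integral_const_mul, integral_finsetSum _ fun i _ => i2 i]
    simp only [e2]
    rw [Finset.sum_congr rfl fun i _ => (integral_finsetSum _ (i1 i)).trans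
      (Finset.sum_congr rfl (e1 i))]
    simp only [Finset.sum_const, Finset.card_univ, Fintype.card_fin, nsmul_eq_mul] at hcard ⊢
    linarith
  have hDP : Integrable D P := (hD.smul_measure_nnreal (c := K ^ n)).mono_measure hPK
  have key : Real.exp (∫ x, G x ∂P) ≤ ∫ x, D x ∂P := by
    -- `e ^ G ≥ e ^ m (1 + G - m)`, integrated, with `m` the mean of `G`
    set m := ∫ x, G x ∂P with hm
    have h1 : ∫ x, Real.exp m * (1 + (G x - m)) ∂P ≤ ∫ x, D x ∂P := by
      refine integral_mono_ae (((integrable_const _).add (iG.sub (integrable_const _))).const_mul _)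
        hDP ?_
      filter_upwards [ae_injective_pi (ν := ν) n] with x hx
      have : D x = Real.exp (G x) := ensembleDensity_eq_exp V hx n
      rw [this]
      calc Real.exp m * (1 + (G x - m)) ≤ Real.exp m * Real.exp (G x - m) := by
            gcongr
            linarith [Real.add_one_le_exp (G x - m)]
        _ = Real.exp (G x) := by rw [← Real.exp_add]; congr 1; ring
    have i3 : Integrable (fun x => G x - m) P := iG.sub (integrable_const _)
    rw [integral_const_mul, integral_add (integrable_const _) i3, integral_sub iG
      (integrable_const _)] at h1
    simpa [← hm] using h1
  rw [← eG]
  refine key.trans ?_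
  have := integral_mono_measure hPK (ae_of_all _ hD0) (hD.smul_measure_nnreal (c := K ^ n))
  rw [integral_smul_nnreal_measure] at this
  simpa [NNReal.smul_def] using this

namespace EulerLagrange

variable {V : ℝ → ℝ} {μ : ProbabilityMeasure ℝ} {a b l : ℝ}

lemma integrable_ensembleDensity (h : EulerLagrange V μ a b l) {n : ℕ} (hn : 1 ≤ n) :
    Integrable fun x : Fin n → ℝ =>
      ensembleDensity id Real.exp (fun t => Real.exp (-(n * V t))) x := by
  have := integrable_prod_mul_ensembleDensity (φ := id) (χ := Real.exp)
    (w := fun t => Real.exp (-(n * V t))) (m := fun _ => 1) (n := n) fun i j => by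
      simpa using integrable_moment h.continuous h.growth hn i j
  simpa using this

/-- The logarithm of the partition function is at least `-n² (I + o(1))`. -/
lemma exists_exp_le_integral_ensembleDensity (h : EulerLagrange V μ a b l) {ψ : ℝ → ℝ}
    (hψ : Measurable ψ)
    (hμψ : (μ : Measure ℝ) = volume.withDensity (fun x => ENNReal.ofReal (ψ x)))
    {δ : ℝ} (hδ : 0 < δ) :
    ∃ C : ℝ, ∀ n : ℕ, 1 ≤ n →
      Real.exp (-((n : ℝ) ^ 2 * (1 / 2 * ((∫ t, V t ∂(μ : Measure ℝ)) - l) + δ)) - n * C) ≤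
        ∫ x : Fin n → ℝ, ensembleDensity id Real.exp (fun t => Real.exp (-(n * V t))) x := by
  obtain ⟨ν, K, hν, hK, hνK, hV, hk, hle⟩ := h.exists_bounded_density hψ hμψ hδ
  set E := ∫ p, logKernel p ∂(ν.prod ν) with hE
  refine ⟨Real.log K - E / 2, fun n hn => ?_⟩
  have hK' : (0 : ℝ) < K := hK
  have key := exp_le_integral_ensembleDensity hK hνK hV hk (h.integrable_ensembleDensity hn)
  rw [← hE] at key
  have e : Real.exp (-((n : ℝ) ^ 2 * (1 / 2 * ((∫ t, V t ∂(μ : Measure ℝ)) - l) + δ)) -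
      n * (Real.log K - E / 2)) * K ^ n ≤
      Real.exp (-((n : ℝ) ^ 2 * (1 / 2 * E + ∫ t, V t ∂ν)) + n / 2 * E) := by
    have : (K : ℝ) ^ n = Real.exp (n * Real.log K) := by
      rw [Real.exp_nat_mul, Real.exp_log hK']
    rw [this, ← Real.exp_add]
    refine Real.exp_le_exp.2 ?_
    have := mul_le_mul_of_nonneg_left hle (sq_nonneg (n : ℝ))
    linarith
  have := e.trans key
  rw [mul_comm] at this
  exact le_of_mul_le_mul_left this (pow_pos hK' n)

end EulerLagrange

/-! ### Upper bound for the average characteristic polynomial -/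

namespace EulerLagrange

variable {V : ℝ → ℝ} {μ : ProbabilityMeasure ℝ} {a b l : ℝ}

/-- The weight `exp (T n² (X - U - τ))`, with `X` the potential of the empirical measure and `U` that
of `μ`, leaves the partition function exponentially small in comparison with `exp (-n² I)`. The
majorant `g` makes the measurability of `X` irrelevant. -/
lemma exists_integral_exp_mul_ensembleDensity_le (h : EulerLagrange V μ a b l) {φ : ℝ → ℝ}
    (hφ : φ = id ∨ φ = Real.exp) {y : ℝ} (hy : 0 < y) (u : ℝ) {τ : ℝ} (hτ : 0 < τ) :
    ∃ T C : ℝ, 0 < T ∧ ∀ n : ℕ, 1 ≤ n → ∃ g : (Fin n → ℝ) → ℝ, Integrable g ∧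
      (∀ x, Real.exp (T * (n : ℝ) ^ 2 * (softPotential y ((countingMeasure x : Measure ℝ).map φ) u -
        softPotential y ((μ : Measure ℝ).map φ) u - τ)) *
        ensembleDensity id Real.exp (fun t => Real.exp (-(n * V t))) x ≤ g x) ∧
      ∫ x, g x ≤ Real.exp (-((n : ℝ) ^ 2 *
        (1 / 2 * ((∫ t, V t ∂(μ : Measure ℝ)) - l) + T * (τ / 2))) + n * C) := by
  -- half of `τ` is kept as the exponential gain
  obtain ⟨T, κ, ε, hT, hκ, hε, key⟩ := h.exists_regEnergy_ge hφ hy u (half_pos hτ)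
  set I := 1 / 2 * ((∫ t, V t ∂(μ : Measure ℝ)) - l) with hI
  set U := softPotential y ((μ : Measure ℝ).map φ) u with hU
  set J := ∫ t : ℝ, Real.exp (-(κ * |t|)) with hJ
  have hJ0 : 0 < J := integral_exp_pos (integrable_exp_neg_mul_abs hκ)
  refine ⟨T, Real.log J - Real.log ε, hT, fun n hn => ?_⟩
  have hn' : (1 : ℝ) ≤ n := by exact_mod_cast hn
  set c := Real.exp (-((n : ℝ) ^ 2 * (I + T * (τ / 2))) - n * Real.log ε) with hc
  refine ⟨fun x => c * ∏ j, Real.exp (-(κ * |x j|)), ?_, fun x => ?_, ?_⟩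
  · exact (Integrable.fintype_prod fun _ => integrable_exp_neg_mul_abs hκ).const_mul _
  · have := isProbabilityMeasure_countingMeasure hn x
    have h1 := key _ this (integrable_countingMeasure x V)
    rw [integral_countingMeasure] at h1
    calc _ ≤ Real.exp (T * (n : ℝ) ^ 2 *
          (softPotential y ((countingMeasure x : Measure ℝ).map φ) u - U - τ)) *
          Real.exp (-((n : ℝ) ^ 2 * regEnergy V ε (countingMeasure x : Measure ℝ)) -
            n * Real.log ε) := by
          gcongr
          exact ensembleDensity_le_exp_regEnergy V hε hn x
      _ ≤ c * Real.exp (-(κ * ∑ j, |x j|)) := by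
          rw [hc, ← Real.exp_add, ← Real.exp_add]
          refine Real.exp_le_exp.2 ?_
          have h2 := mul_le_mul_of_nonneg_left h1 (sq_nonneg (n : ℝ))
          have h3 : (n : ℝ) ^ 2 * (κ * ((n : ℝ)⁻¹ * ∑ j, |x j|)) = n * (κ * ∑ j, |x j|) := by
            field_simp
          have h4 : κ * ∑ j, |x j| ≤ n * (κ * ∑ j, |x j|) :=
            le_mul_of_one_le_left (mul_nonneg hκ.le (Finset.sum_nonneg fun _ _ => abs_nonneg _)) hn'
          rw [mul_add, h3] at h2
          linarith
      _ = _ := by rw [Finset.mul_sum, ← Finset.sum_neg_distrib, Real.exp_sum]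
  · rw [integral_const_mul, integral_fintype_prod_volume_eq_pow fun t => Real.exp (-(κ * |t|)), ← hJ,
      Fintype.card_fin, hc]
    have : J ^ n = Real.exp (n * Real.log J) := by rw [Real.exp_nat_mul, Real.exp_log hJ0]
    rw [this, ← Real.exp_add]
    exact Real.exp_le_exp.2 (le_of_eq (by ring))

lemma norm_ofReal_add_mul_I_sub {y : ℝ} (hy : 0 < y) (u t : ℝ) :
    ‖((u : ℂ) + y * Complex.I) - t‖ = Real.exp (softLog y (u - t)) := by
  have e : ((u : ℂ) + y * Complex.I) - t = ((u - t : ℝ) : ℂ) + y * Complex.I := by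
    push_cast; ring
  have hp : 0 < (u - t) ^ 2 + y ^ 2 := by positivity
  rw [e, Complex.norm_add_mul_I, softLog, Real.sqrt_eq_rpow, Real.rpow_def_of_pos hp]
  congr 1; ring

lemma prod_norm_sub {y : ℝ} (hy : 0 < y) {φ : ℝ → ℝ} (hφ : Measurable φ) (u : ℝ) {n : ℕ}
    (hn : 1 ≤ n) (x : Fin n → ℝ) :
    ∏ j, ‖((u : ℂ) + y * Complex.I) - φ (x j)‖ =
      Real.exp (n * softPotential y ((countingMeasure x : Measure ℝ).map φ) u) := by
  have hn' : (n : ℝ) ≠ 0 := by exact_mod_cast (by omega : n ≠ 0)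
  simp only [norm_ofReal_add_mul_I_sub hy, ← Real.exp_sum]
  rw [softPotential_map_countingMeasure hy hφ, mul_inv_cancel_left₀ hn']

/-- The average of `∏ |u + i y - φ (x_j)|` is at most `e^{n (U + o(1))}`, with `U` the potential
of the equilibrium measure at `u + i y`. -/
lemma eventually_integral_prod_norm_le (h : EulerLagrange V μ a b l) {ψ : ℝ → ℝ}
    (hψ : Measurable ψ)
    (hμψ : (μ : Measure ℝ) = volume.withDensity (fun x => ENNReal.ofReal (ψ x))) {φ : ℝ → ℝ}
    (hφ : φ = id ∨ φ = Real.exp) {y : ℝ} (hy : 0 < y) (u : ℝ) {τ : ℝ} (hτ : 0 < τ) :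
    ∀ᶠ n : ℕ in atTop, ∫ x : Fin n → ℝ, (∏ j, ‖((u : ℂ) + y * Complex.I) - φ (x j)‖) *
        ensembleDensity id Real.exp (fun t => Real.exp (-(n * V t))) x ≤
      2 * Real.exp (n * (softPotential y ((μ : Measure ℝ).map φ) u + τ)) *
        ∫ x : Fin n → ℝ, ensembleDensity id Real.exp (fun t => Real.exp (-(n * V t))) x := by
  obtain ⟨T, C, hT, hup⟩ := h.exists_integral_exp_mul_ensembleDensity_le hφ hy u hτ
  obtain ⟨C', hlo⟩ := h.exists_exp_le_integral_ensembleDensity hψ hμψ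
    (show 0 < T * (τ / 4) by positivity)
  have hφm : Measurable φ := by
    rcases hφ with rfl | rfl
    exacts [measurable_id, Real.measurable_exp]
  set I := 1 / 2 * ((∫ t, V t ∂(μ : Measure ℝ)) - l) with hI
  set U := softPotential y ((μ : Measure ℝ).map φ) u with hU
  have ev1 : ∀ᶠ n : ℕ in atTop, 1 ≤ T * n := by
    filter_upwards [(tendsto_natCast_atTop_atTop (R := ℝ)).eventually_ge_atTop (1 / T)] with n hn
    rw [div_le_iff₀ hT] at hn; linarith
  have ev2 : ∀ᶠ n : ℕ in atTop, C + C' ≤ T * (τ / 4) * n := by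
    filter_upwards [(tendsto_natCast_atTop_atTop (R := ℝ)).eventually_ge_atTop
      ((C + C') / (T * (τ / 4)))] with n hn
    rw [div_le_iff₀ (by positivity)] at hn; linarith
  filter_upwards [ev1, ev2, eventually_ge_atTop 1] with n h1 h2 hn
  have hn0 : (0 : ℝ) ≤ n := Nat.cast_nonneg n
  obtain ⟨g, hg, hgx, hgI⟩ := hup n hn
  set D : (Fin n → ℝ) → ℝ := fun x =>
    ensembleDensity id Real.exp (fun t => Real.exp (-(n * V t))) x with hDdef
  have hD0 : ∀ x, 0 ≤ D x := ensembleDensity_nonneg monotone_id Real.exp_monotone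
    fun t => (Real.exp_pos _).le
  have hD : Integrable D := h.integrable_ensembleDensity hn
  have hpt : ∀ x : Fin n → ℝ, (∏ j, ‖((u : ℂ) + y * Complex.I) - φ (x j)‖) * D x ≤
      Real.exp (n * (U + τ)) * (D x + g x) := fun x => by
    rw [prod_norm_sub hy hφm u hn]
    set X := softPotential y ((countingMeasure x : Measure ℝ).map φ) u with hX
    -- `n s ≤ T n² s` for `s ≥ 0`, since `T n ≥ 1`
    have h3 : Real.exp (n * X) ≤
        Real.exp (n * (U + τ)) * (1 + Real.exp (T * (n : ℝ) ^ 2 * (X - U - τ))) := by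
      rcases le_total X (U + τ) with hle | hle
      · calc Real.exp (n * X) ≤ Real.exp (n * (U + τ)) * 1 := by
              rw [mul_one]
              exact Real.exp_le_exp.2 (mul_le_mul_of_nonneg_left hle hn0)
          _ ≤ _ := by
              gcongr
              linarith [Real.exp_pos (T * (n : ℝ) ^ 2 * (X - U - τ))]
      · calc Real.exp (n * X) = Real.exp (n * (U + τ)) * Real.exp (n * (X - U - τ)) := by
              rw [← Real.exp_add]; congr 1; ring
          _ ≤ Real.exp (n * (U + τ)) * Real.exp (T * (n : ℝ) ^ 2 * (X - U - τ)) := by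
              gcongr
              · linarith
              · nlinarith
          _ ≤ _ := by
              gcongr
              linarith
    calc Real.exp (n * X) * D x ≤
          Real.exp (n * (U + τ)) * (1 + Real.exp (T * (n : ℝ) ^ 2 * (X - U - τ))) * D x :=
          mul_le_mul_of_nonneg_right h3 (hD0 x)
      _ = Real.exp (n * (U + τ)) * (D x + Real.exp (T * (n : ℝ) ^ 2 * (X - U - τ)) * D x) := by ring
      _ ≤ _ := by
          gcongr
          exact hgx x
  have hgZ : ∫ x, g x ≤ ∫ x, D x := by
    refine hgI.trans (le_trans (Real.exp_le_exp.2 ?_) (hlo n hn))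
    nlinarith [mul_le_mul_of_nonneg_left h2 hn0]
  calc _ ≤ ∫ x, Real.exp (n * (U + τ)) * (D x + g x) :=
        integral_mono_of_nonneg (ae_of_all _ fun x =>
          mul_nonneg (Finset.prod_nonneg fun _ _ => norm_nonneg _) (hD0 x))
          ((hD.add hg).const_mul _) (ae_of_all _ hpt)
    _ = Real.exp (n * (U + τ)) * ((∫ x, D x) + ∫ x, g x) := by
        rw [integral_const_mul, integral_add hD hg]
    _ ≤ Real.exp (n * (U + τ)) * ((∫ x, D x) + ∫ x, D x) := by gcongr
    _ = _ := by ring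

end EulerLagrange

/-! ### Asymptotics of the zeros -/

lemma ensembleDensity_comm (φ χ w : ℝ → ℝ) {n : ℕ} (x : Fin n → ℝ) :
    ensembleDensity φ χ w x = ensembleDensity χ φ w x := by
  rw [ensembleDensity, ensembleDensity, mul_comm (Matrix.det _) (Matrix.det _)]

/-- Continuous functions of compact support on `ℝ` factor through `id` and through `exp`. -/
lemma exists_hasCompactSupport_comp_eq {φ : ℝ → ℝ} (hφ : φ = id ∨ φ = Real.exp) {F : ℝ → ℝ}
    (hF : Continuous F) (hFc : HasCompactSupport F) :
    ∃ f : ℝ → ℝ, Continuous f ∧ HasCompactSupport f ∧ ∀ t, f (φ t) = F t := by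
  rcases hφ with rfl | rfl
  · exact ⟨F, hF, hFc, fun t => rfl⟩
  obtain ⟨R, hR⟩ := hFc.isCompact.isBounded.subset_closedBall (0 : ℝ)
  have hF0 : ∀ t, R < |t| → F t = 0 := fun t ht => by
    by_contra h
    have := hR (subset_tsupport F h)
    rw [mem_closedBall_zero_iff, Real.norm_eq_abs] at this
    linarith
  set r := -(|R| + 1) with hr
  have hr0 : ∀ t, t ≤ r → F t = 0 := fun t ht => hF0 t (by
    rw [abs_of_nonpos (by linarith [abs_nonneg R])]
    linarith [le_abs_self R])
  -- the maximum keeps the argument of the logarithm away from `0`, and `F r = 0`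
  refine ⟨fun s => F (Real.log (max s (Real.exp r))), hF.comp (Continuous.log (by fun_prop)
    fun s => ((Real.exp_pos r).trans_le (le_max_right _ _)).ne'), ?_, fun t => ?_⟩
  · refine HasCompactSupport.intro (isCompact_Icc (a := Real.exp r) (b := Real.exp |R|)) fun s hs => ?_
    rw [Set.mem_Icc, not_and_or, not_le, not_le] at hs
    rcases hs with hs | hs
    · simp only [max_eq_right hs.le, Real.log_exp]
      exact hr0 r le_rfl
    · have h1 : Real.exp r ≤ s :=
        (Real.exp_le_exp.2 (by linarith [abs_nonneg R])).trans hs.le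
      simp only [max_eq_left h1]
      have h2 : |R| < Real.log s := (Real.lt_log_iff_exp_lt ((Real.exp_pos _).trans hs)).2 hs
      exact hF0 _ ((le_abs_self R).trans_lt (h2.trans_le (le_abs_self _)))
  · rcases le_total t r with ht | ht
    · simp only [max_eq_right (Real.exp_le_exp.2 ht), Real.log_exp]
      rw [hr0 r le_rfl, hr0 t ht]
    · simp only [max_eq_left (Real.exp_le_exp.2 ht), Real.log_exp]

namespace EulerLagrange

variable {V : ℝ → ℝ} {μ : ProbabilityMeasure ℝ} {a b l : ℝ} {φ χ : ℝ → ℝ}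

lemma integrable_moment (h : EulerLagrange V μ a b l)
    (hφχ : φ = id ∧ χ = Real.exp ∨ φ = Real.exp ∧ χ = id) {n : ℕ} (hn : 1 ≤ n) (i j : ℕ) :
    Integrable fun t => φ t ^ i * χ t ^ j * Real.exp (-(n * V t)) := by
  rcases hφχ with ⟨rfl, rfl⟩ | ⟨rfl, rfl⟩
  · exact _root_.integrable_moment h.continuous h.growth hn i j
  · refine (_root_.integrable_moment h.continuous h.growth hn j i).congr (ae_of_all _ fun t => ?_)
    simp only [id]; ring

lemma integral_ensembleDensity_pos (h : EulerLagrange V μ a b l) {ψ : ℝ → ℝ} (hψ : Measurable ψ)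
    (hμψ : (μ : Measure ℝ) = volume.withDensity (fun x => ENNReal.ofReal (ψ x)))
    (hφχ : φ = id ∧ χ = Real.exp ∨ φ = Real.exp ∧ χ = id) {n : ℕ} (hn : 1 ≤ n) :
    0 < ∫ x : Fin n → ℝ, ensembleDensity φ χ (fun t => Real.exp (-(n * V t))) x := by
  obtain ⟨C, hC⟩ := h.exists_exp_le_integral_ensembleDensity hψ hμψ one_pos
  have := (Real.exp_pos _).trans_le (hC n hn)
  rcases hφχ with ⟨rfl, rfl⟩ | ⟨rfl, rfl⟩
  · exact this
  · simpa only [ensembleDensity_comm Real.exp id] using this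

/-- Upper bound for the logarithmic potential of the zeros, off the real axis. -/
lemma eventually_softPotential_zeros_le (h : EulerLagrange V μ a b l) {ψ : ℝ → ℝ}
    (hψ : Measurable ψ)
    (hμψ : (μ : Measure ℝ) = volume.withDensity (fun x => ENNReal.ofReal (ψ x)))
    (hφχ : φ = id ∧ χ = Real.exp ∨ φ = Real.exp ∧ χ = id) {P : ℕ → ℝ[X]}
    (hP : ∀ n, 1 ≤ n → (P n).Monic ∧ (P n).natDegree = n ∧
      ∀ k < n, ∫ t, (P n).eval (φ t) * χ t ^ k * Real.exp (-(n * V t)) = 0)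
    {z : (n : ℕ) → Fin n → ℝ}
    (hz : ∀ n, 1 ≤ n → EnumeratesZeros (fun x => (P n).eval (φ x)) (z n))
    {y : ℝ} (hy : 0 < y) (u : ℝ) {τ : ℝ} (hτ : 0 < τ) :
    ∀ᶠ n : ℕ in atTop, softPotential y ((countingMeasure (z n) : Measure ℝ).map φ) u ≤
      softPotential y ((μ : Measure ℝ).map φ) u + τ := by
  have hφ : φ = id ∨ φ = Real.exp := hφχ.imp And.left And.left
  have hmono : ∀ θ : ℝ → ℝ, θ = id ∨ θ = Real.exp → StrictMono θ ∧ Continuous θ := by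
    rintro θ (rfl | rfl)
    exacts [⟨strictMono_id, continuous_id⟩, ⟨Real.exp_strictMono, Real.continuous_exp⟩]
  obtain ⟨hφs, hφc⟩ := hmono φ hφ
  obtain ⟨hχs, hχc⟩ := hmono χ (hφχ.symm.imp And.right And.right)
  filter_upwards [h.eventually_integral_prod_norm_le hψ hμψ hφ hy u (half_pos hτ),
    eventually_ge_atTop 1,
    (tendsto_natCast_atTop_atTop (R := ℝ)).eventually_ge_atTop (Real.log 2 / (τ / 2))]
    with n h1 hn h2
  have hn0 : (0 : ℝ) < n := by exact_mod_cast hn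
  have hZ := h.integral_ensembleDensity_pos hψ hμψ hφχ hn
  have hm := h.integrable_moment hφχ hn
  obtain ⟨Q, hQm, hQd, hQo, hQb⟩ := exists_monic_orthogonal hm n
    (ensembleDensity_nonneg hφs.monotone hχs.monotone fun t => (Real.exp_pos _).le) hZ
  have hPQ : P n = Q := (existsUnique_orthogonal hφs hχs hφc hχc
    (by have := h.continuous; fun_prop) (fun t => Real.exp_pos _) hm hZ).unique (hP n hn)
    ⟨hQm, hQd, hQo⟩
  have h3 := hQb ((u : ℂ) + y * Complex.I)
  have h4 : ∀ x : Fin n → ℝ, ensembleDensity φ χ (fun t => Real.exp (-(n * V t))) x =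
      ensembleDensity id Real.exp (fun t => Real.exp (-(n * V t))) x := fun x => by
    rcases hφχ with ⟨rfl, rfl⟩ | ⟨rfl, rfl⟩
    · rfl
    · exact ensembleDensity_comm _ _ _ _
  simp only [h4] at h3 hZ
  have h5 := le_of_mul_le_mul_right (h3.trans h1) hZ
  rw [← hPQ, eq_nodalPoly_of_enumeratesZeros hφs (hP n hn).1 (hP n hn).2.1 (hz n hn), nodalPoly,
    map_prod, norm_prod] at h5
  simp only [map_sub, aeval_X, aeval_C, Complex.coe_algebraMap] at h5
  rw [prod_norm_sub hy hφc.measurable u hn, ← Real.exp_log (show (0 : ℝ) < 2 by norm_num),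
    ← Real.exp_add, Real.exp_le_exp, Real.exp_log (show (0 : ℝ) < 2 by norm_num)] at h5
  rw [div_le_iff₀ (half_pos hτ)] at h2
  refine le_of_mul_le_mul_left ?_ hn0
  linarith

/-- Weak convergence of the normalized zero counting measures. -/
theorem tendsto_countingMeasure_zeros (h : EulerLagrange V μ a b l) {ψ : ℝ → ℝ}
    (hψ : Measurable ψ)
    (hμψ : (μ : Measure ℝ) = volume.withDensity (fun x => ENNReal.ofReal (ψ x)))
    (hφχ : φ = id ∧ χ = Real.exp ∨ φ = Real.exp ∧ χ = id) {P : ℕ → ℝ[X]}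
    (hP : ∀ n, 1 ≤ n → (P n).Monic ∧ (P n).natDegree = n ∧
      ∀ k < n, ∫ t, (P n).eval (φ t) * χ t ^ k * Real.exp (-(n * V t)) = 0)
    {z : (n : ℕ) → Fin n → ℝ}
    (hz : ∀ n, 1 ≤ n → EnumeratesZeros (fun x => (P n).eval (φ x)) (z n)) :
    Tendsto (fun n => countingMeasure (z n)) atTop (𝓝 μ.toFiniteMeasure) := by
  have hφ : φ = id ∨ φ = Real.exp := hφχ.imp And.left And.left
  have hφc : Continuous φ := by
    rcases hφ with rfl | rfl
    exacts [continuous_id, Real.continuous_exp]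
  have hφm := hφc.measurable
  have hlog : ∀ α : Measure ℝ, Integrable (fun t => Real.log (1 + |φ t|)) α →
      HasLogMoment (α.map φ) := fun α hα => by
    rw [HasLogMoment, integrable_map_measure
      (by fun_prop : Measurable fun t : ℝ => Real.log (1 + |t|)).aestronglyMeasurable hφm.aemeasurable]
    exact hα
  have hpr : ∀ α : Measure ℝ, IsProbabilityMeasure α → IsProbabilityMeasure (α.map φ) :=
    fun α _ => Measure.isProbabilityMeasure_map hφm.aemeasurable
  have := hpr μ inferInstance
  have hν : ∀ n, IsProbabilityMeasure ((countingMeasure (z (n + 1)) : Measure ℝ).map φ) :=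
    fun n => hpr _ (isProbabilityMeasure_countingMeasure (by omega) _)
  obtain ⟨B, hB⟩ := (isCompact_Icc (a := a) (b := b)).exists_bound_of_continuousOn hφc.continuousOn
  refine tendsto_finiteMeasure_of_hasCompactSupport (B := max |a| |b|) ?_ (fun n => ?_)
    fun F hF hFc => ?_
  · filter_upwards [h.ae_mem] with t ht using abs_le_max_abs_abs ht.1 ht.2
  · rcases Nat.eq_zero_or_pos n with rfl | hn
    · rw [measureReal_def, coe_countingMeasure]; simp
    · have := isProbabilityMeasure_countingMeasure hn (z n)
      exact measureReal_le_one
  · obtain ⟨f, hf, hfc, hfF⟩ := exists_hasCompactSupport_comp_eq hφ hF hFc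
    have key := tendsto_integral_of_softPotential_le
      (ν := fun n => (countingMeasure (z (n + 1)) : Measure ℝ).map φ) (μ := (μ : Measure ℝ).map φ)
      (B := max B 0) (le_max_right _ _) ?_ (hlog _ (h.integrable_of_continuous
        (Continuous.log (by fun_prop) fun t => by positivity)))
      (fun n => hlog _ (integrable_countingMeasure _ _))
      (fun y hy u τ hτ => (tendsto_add_atTop_nat 1).eventually
        (h.eventually_softPotential_zeros_le hψ hμψ hφχ hP hz hy u hτ)) hf hfc
    · have e : ∀ α : Measure ℝ, ∫ t, f t ∂(α.map φ) = ∫ t, F t ∂α := fun α => by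
        rw [integral_map hφm.aemeasurable hf.aestronglyMeasurable]
        simp only [hfF]
      simp only [e] at key
      exact (tendsto_add_atTop_iff_nat 1).1 key
    · rw [ae_map_iff hφm.aemeasurable (measurableSet_le (by fun_prop) measurable_const)]
      filter_upwards [h.ae_mem] with t ht using (hB t ht).trans (le_max_left _ _)

end EulerLagrange

/-! ### Minimality of the energy -/

/-- The kernel `k^V` with a finite value on the diagonal. -/
noncomputable def realKernel (V : ℝ → ℝ) (p : ℝ × ℝ) : ℝ :=
  1 / 2 * logKernel p + (1 / 2 * V p.1 + 1 / 2 * V p.2)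

lemma energyKernel_of_ne (V : ℝ → ℝ) {p : ℝ × ℝ} (hp : p.1 ≠ p.2) :
    energyKernel V p.1 p.2 = (realKernel V p : EReal) := by
  rw [energyKernel, if_neg hp, realKernel, logKernel]
  congr 1; ring

lemma energy_eq_coe_integral {V : ℝ → ℝ} {ν : ProbabilityMeasure ℝ}
    (hd : ∀ᵐ p ∂((ν : Measure ℝ).prod (ν : Measure ℝ)), p.1 ≠ p.2)
    (hi : Integrable (realKernel V) ((ν : Measure ℝ).prod (ν : Measure ℝ))) :
    energy V ν = ((∫ p, realKernel V p ∂((ν : Measure ℝ).prod (ν : Measure ℝ)) : ℝ) : EReal) := by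
  have e1 : ∫⁻ p : ℝ × ℝ, (energyKernel V p.1 p.2).toENNReal
      ∂((ν : Measure ℝ).prod (ν : Measure ℝ)) =
      ∫⁻ p, ENNReal.ofReal (realKernel V p) ∂((ν : Measure ℝ).prod (ν : Measure ℝ)) := by
    refine lintegral_congr_ae ?_
    filter_upwards [hd] with p hp
    rw [energyKernel_of_ne V hp, EReal.toENNReal_of_ne_top (EReal.coe_ne_top _), EReal.toReal_coe]
  have e2 : ∫⁻ p : ℝ × ℝ, (-energyKernel V p.1 p.2).toENNReal
      ∂((ν : Measure ℝ).prod (ν : Measure ℝ)) =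
      ∫⁻ p, ENNReal.ofReal (-realKernel V p) ∂((ν : Measure ℝ).prod (ν : Measure ℝ)) := by
    refine lintegral_congr_ae ?_
    filter_upwards [hd] with p hp
    rw [energyKernel_of_ne V hp, ← EReal.coe_neg, EReal.toENNReal_of_ne_top (EReal.coe_ne_top _),
      EReal.toReal_coe]
  have f1 : ∫⁻ p, ENNReal.ofReal (realKernel V p) ∂((ν : Measure ℝ).prod (ν : Measure ℝ)) ≠ ⊤ :=
    ((lintegral_mono fun p => Real.ofReal_le_enorm _).trans_lt hi.2).ne
  have f2 : ∫⁻ p, ENNReal.ofReal (-realKernel V p) ∂((ν : Measure ℝ).prod (ν : Measure ℝ)) ≠ ⊤ :=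
    ((lintegral_mono fun p => Real.ofReal_le_enorm _).trans_lt hi.neg.2).ne
  have hc : ∀ r : ENNReal, r ≠ ⊤ → (r : EReal) = ((r.toReal : ℝ) : EReal) := fun r hr => by
    lift r to NNReal using hr
    rfl
  rw [energy, e1, e2, integral_eq_lintegral_pos_part_sub_lintegral_neg_part hi, EReal.coe_sub,
    hc _ f1, hc _ f2]

namespace EulerLagrange

variable {V : ℝ → ℝ} {μ : ProbabilityMeasure ℝ} {a b l : ℝ}

/-- The kernel is bounded below, with room to control `V`. -/
lemma exists_le_realKernel (h : EulerLagrange V μ a b l) :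
    ∃ C : ℝ, 0 ≤ C ∧ ∀ p : ℝ × ℝ, |V p.1| ≤ 4 * realKernel V p + C := by
  obtain ⟨C, hC⟩ := h.growth 4
  refine ⟨5 * |C|, by positivity, fun p => ?_⟩
  have h1 := neg_le_logKernel p
  have h2 := hC p.1
  have h3 := hC p.2
  have h4 := le_abs_self C
  have h7 := abs_nonneg C
  have h5 := abs_nonneg p.1
  have h6 := abs_nonneg p.2
  rw [realKernel, abs_le]
  constructor <;> linarith

lemma measurable_realKernel (h : EulerLagrange V μ a b l) : Measurable (realKernel V) := by
  have := h.continuous.measurable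
  exact (measurable_logKernel.const_mul _).add (by fun_prop)

/-- A measure of finite energy does not charge the diagonal, and its kernel is integrable. -/
lemma integrable_realKernel (h : EulerLagrange V μ a b l) {ν : ProbabilityMeasure ℝ}
    (hν : energy V ν ≠ ⊤) :
    (∀ᵐ p ∂((ν : Measure ℝ).prod (ν : Measure ℝ)), p.1 ≠ p.2) ∧
      Integrable (realKernel V) ((ν : Measure ℝ).prod (ν : Measure ℝ)) := by
  obtain ⟨C, hC0, hC⟩ := h.exists_le_realKernel
  set π := (ν : Measure ℝ).prod (ν : Measure ℝ) with hπ
  have hlow : ∀ p, -C ≤ realKernel V p := fun p => by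
    have := (abs_nonneg _).trans (hC p)
    linarith
  have hneg : ∫⁻ p : ℝ × ℝ, (-energyKernel V p.1 p.2).toENNReal ∂π ≠ ⊤ := by
    refine ((lintegral_mono (g := fun _ => ENNReal.ofReal C) fun p => ?_).trans_lt ?_).ne
    · by_cases hp : p.1 = p.2
      · rw [energyKernel, if_pos hp]; simp
      · rw [energyKernel_of_ne V hp, ← EReal.coe_neg, EReal.toENNReal_of_ne_top (EReal.coe_ne_top _),
          EReal.toReal_coe]
        exact ENNReal.ofReal_le_ofReal (by linarith [hlow p])
    · simp
  have hpos : ∫⁻ p : ℝ × ℝ, (energyKernel V p.1 p.2).toENNReal ∂π ≠ ⊤ := fun htop => hν (by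
    rw [energy, ← hπ, htop, ← ENNReal.coe_toNNReal hneg]
    exact EReal.top_sub_coe _)
  have hmeas : Measurable fun p : ℝ × ℝ => (energyKernel V p.1 p.2).toENNReal := by
    have e : (fun p : ℝ × ℝ => (energyKernel V p.1 p.2).toENNReal) = fun p =>
        if p.1 = p.2 then ⊤ else ENNReal.ofReal (realKernel V p) := by
      funext p
      split_ifs with hp
      · rw [energyKernel, if_pos hp]; simp
      · rw [energyKernel_of_ne V hp, EReal.toENNReal_of_ne_top (EReal.coe_ne_top _),
          EReal.toReal_coe]
    rw [e]
    exact Measurable.ite (measurableSet_eq_fun measurable_fst measurable_snd) measurable_const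
      h.measurable_realKernel.ennreal_ofReal
  have hd : ∀ᵐ p ∂π, p.1 ≠ p.2 := by
    filter_upwards [ae_lt_top hmeas hpos] with p hp hpe
    rw [energyKernel, if_pos hpe] at hp
    simp at hp
  refine ⟨hd, h.measurable_realKernel.aestronglyMeasurable, ?_⟩
  rw [hasFiniteIntegral_iff_norm]
  have hle : ∀ᵐ p ∂π, ENNReal.ofReal ‖realKernel V p‖ ≤
      (energyKernel V p.1 p.2).toENNReal + ENNReal.ofReal (2 * C) := by
    filter_upwards [hd] with p hp
    rw [energyKernel_of_ne V hp, EReal.toENNReal_of_ne_top (EReal.coe_ne_top _),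
      EReal.toReal_coe]
    rcases le_total 0 (realKernel V p) with h0 | h0
    · rw [Real.norm_of_nonneg h0]; exact le_self_add
    · refine le_trans (ENNReal.ofReal_le_ofReal ?_) le_add_self
      rw [Real.norm_of_nonpos h0]; linarith [hlow p]
  refine (lintegral_mono_ae hle).trans_lt ?_
  rw [lintegral_add_right _ measurable_const]
  exact ENNReal.add_lt_top.2 ⟨hpos.lt_top, by
    rw [lintegral_const, measure_univ, mul_one]; exact ENNReal.ofReal_lt_top⟩

/-- Regularization lowers the energy. -/
lemma regEnergy_le_energy (h : EulerLagrange V μ a b l) {ν : ProbabilityMeasure ℝ}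
    (hν : energy V ν ≠ ⊤) :
    Integrable V (ν : Measure ℝ) ∧ ∀ ε : ℝ, 0 < ε →
      (regEnergy V ε (ν : Measure ℝ) : EReal) ≤ energy V ν := by
  obtain ⟨hd, hi⟩ := h.integrable_realKernel hν
  obtain ⟨C, -, hC⟩ := h.exists_le_realKernel
  have hV : Integrable V (ν : Measure ℝ) := by
    rw [← (measurePreserving_fst (μ := (ν : Measure ℝ)) (ν := (ν : Measure ℝ))).integrable_comp
      h.continuous.aestronglyMeasurable]
    refine ((hi.const_mul 4).add (integrable_const C)).mono'
      (h.continuous.comp continuous_fst).aestronglyMeasurable (ae_of_all _ fun p => hC p)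
  refine ⟨hV, fun ε hε => ?_⟩
  rw [energy_eq_coe_integral hd hi, EReal.coe_le_coe_iff]
  have ha := h.integrable_abs hV
  have hn := hasLogMoment_of_integrable_abs ha
  have hn' := hasLogMoment_map_exp_of_integrable_abs ha
  have i1 : Integrable (fun p : ℝ × ℝ => softLog ε (p.1 - p.2))
      ((ν : Measure ℝ).prod (ν : Measure ℝ)) := hn.integrable_softLog_prod hn hε
  have em : Measurable (Prod.map Real.exp Real.exp) :=
    Real.measurable_exp.prodMap Real.measurable_exp
  have ec : Continuous fun p : ℝ × ℝ => softLog ε (p.1 - p.2) :=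
    (continuous_softLog hε).comp (continuous_fst.sub continuous_snd)
  have ep : ((ν : Measure ℝ).map Real.exp).prod ((ν : Measure ℝ).map Real.exp) =
      ((ν : Measure ℝ).prod (ν : Measure ℝ)).map (Prod.map Real.exp Real.exp) :=
    Measure.map_prod_map _ _ Real.measurable_exp Real.measurable_exp
  have i2 : Integrable (fun p : ℝ × ℝ => softLog ε (Real.exp p.1 - Real.exp p.2))
      ((ν : Measure ℝ).prod (ν : Measure ℝ)) := by
    have := hn'.integrable_softLog_prod hn' hε
    rwa [ep, integrable_map_measure ec.aestronglyMeasurable em.aemeasurable] at this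
  have e2 : mutualEnergy ε ((ν : Measure ℝ).map Real.exp) ((ν : Measure ℝ).map Real.exp) =
      ∫ p : ℝ × ℝ, softLog ε (Real.exp p.1 - Real.exp p.2)
        ∂((ν : Measure ℝ).prod (ν : Measure ℝ)) := by
    rw [mutualEnergy, ep, integral_map em.aemeasurable ec.aestronglyMeasurable]
    rfl
  have i3 : Integrable (fun p : ℝ × ℝ => 1 / 2 * V p.1) ((ν : Measure ℝ).prod (ν : Measure ℝ)) :=
    (hV.comp_fst _).const_mul _
  have i4 : Integrable (fun p : ℝ × ℝ => 1 / 2 * V p.2) ((ν : Measure ℝ).prod (ν : Measure ℝ)) :=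
    (hV.comp_snd _).const_mul _
  have e3 : ∫ p : ℝ × ℝ, 1 / 2 * V p.1 ∂((ν : Measure ℝ).prod (ν : Measure ℝ)) =
      1 / 2 * ∫ t, V t ∂(ν : Measure ℝ) := by
    rw [integral_const_mul, integral_fun_fst]; simp
  have e4 : ∫ p : ℝ × ℝ, 1 / 2 * V p.2 ∂((ν : Measure ℝ).prod (ν : Measure ℝ)) =
      1 / 2 * ∫ t, V t ∂(ν : Measure ℝ) := by
    rw [integral_const_mul, integral_fun_snd]; simp
  have i1' : Integrable (fun p : ℝ × ℝ => -(1 / 2 * softLog ε (p.1 - p.2)))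
      ((ν : Measure ℝ).prod (ν : Measure ℝ)) := (i1.const_mul _).neg
  have i2' := i2.const_mul (1 / 2)
  have i12 : Integrable (fun p : ℝ × ℝ => -(1 / 2 * softLog ε (p.1 - p.2)) -
      1 / 2 * softLog ε (Real.exp p.1 - Real.exp p.2)) ((ν : Measure ℝ).prod (ν : Measure ℝ)) :=
    i1'.sub i2'
  have i34 : Integrable (fun p : ℝ × ℝ => 1 / 2 * V p.1 + 1 / 2 * V p.2)
      ((ν : Measure ℝ).prod (ν : Measure ℝ)) := i3.add i4
  have eR : regEnergy V ε (ν : Measure ℝ) = ∫ p : ℝ × ℝ, ((-(1 / 2 * softLog ε (p.1 - p.2)) -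
      1 / 2 * softLog ε (Real.exp p.1 - Real.exp p.2)) + (1 / 2 * V p.1 + 1 / 2 * V p.2))
      ∂((ν : Measure ℝ).prod (ν : Measure ℝ)) := by
    rw [integral_add i12 i34, integral_add i3 i4, e3, e4, integral_sub i1' i2', integral_neg,
      integral_const_mul, integral_const_mul, regEnergy, e2,
      mutualEnergy]
    ring
  rw [eR]
  refine integral_mono_ae (i12.add i34) hi ?_
  filter_upwards [hd] with p hp
  have h1 := softLog_add_log_inv_nonneg ε (sub_ne_zero.2 hp)
  have h2 := softLog_add_log_inv_nonneg ε (sub_ne_zero.2 (Real.exp_injective.ne hp))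
  simp only [realKernel, logKernel]
  linarith

lemma energy_eq (h : EulerLagrange V μ a b l) :
    energy V μ = ((1 / 2 * ((∫ t, V t ∂(μ : Measure ℝ)) - l) : ℝ) : EReal) := by
  have hV := h.integrable_of_continuous h.continuous
  have i3 : Integrable (fun p : ℝ × ℝ => 1 / 2 * V p.1) ((μ : Measure ℝ).prod (μ : Measure ℝ)) :=
    (hV.comp_fst _).const_mul _
  have i4 : Integrable (fun p : ℝ × ℝ => 1 / 2 * V p.2) ((μ : Measure ℝ).prod (μ : Measure ℝ)) :=
    (hV.comp_snd _).const_mul _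
  have i34 : Integrable (fun p : ℝ × ℝ => 1 / 2 * V p.1 + 1 / 2 * V p.2)
      ((μ : Measure ℝ).prod (μ : Measure ℝ)) := i3.add i4
  have ik := h.integrable_logKernel.const_mul (1 / 2)
  have := h.nullSingleton
  rw [energy_eq_coe_integral (ae_fst_ne_snd _) (ik.add i34)]
  congr 1
  have e : ∫ p, realKernel V p ∂((μ : Measure ℝ).prod (μ : Measure ℝ)) =
      (∫ p, 1 / 2 * logKernel p ∂((μ : Measure ℝ).prod (μ : Measure ℝ))) +
      ∫ p : ℝ × ℝ, (1 / 2 * V p.1 + 1 / 2 * V p.2) ∂((μ : Measure ℝ).prod (μ : Measure ℝ)) :=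
    integral_add ik i34
  rw [e, integral_const_mul, h.integral_logKernel, integral_add i3 i4, integral_const_mul,
    integral_const_mul, integral_fun_fst, integral_fun_snd]
  simp
  ring

/-- A measure whose energy is at most that of `μ` has everywhere a potential at most that of `μ`
off the real axis, so that it is `μ`. -/
theorem eq_of_energy_le (h : EulerLagrange V μ a b l) {ν : ProbabilityMeasure ℝ}
    (hle : energy V ν ≤ energy V μ) : ν = μ := by
  rw [h.energy_eq] at hle
  obtain ⟨hV, hreg⟩ := h.regEnergy_le_energy (hle.trans_lt (EReal.coe_lt_top _)).ne
  have hpot : ∀ y, 0 < y → ∀ x τ, 0 < τ →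
      softPotential y (ν : Measure ℝ) x ≤ softPotential y (μ : Measure ℝ) x + τ := by
    intro y hy x τ hτ
    obtain ⟨T, κ, ε, hT, hκ, hε, key⟩ := h.exists_regEnergy_ge (Or.inl rfl) hy x hτ
    have h1 := key ν inferInstance hV
    have h2 := EReal.coe_le_coe_iff.1 ((hreg ε hε).trans hle)
    rw [Measure.map_id, Measure.map_id] at h1
    have h3 : 0 ≤ κ * ∫ t, |t| ∂(ν : Measure ℝ) :=
      mul_nonneg hκ.le (integral_nonneg fun _ => abs_nonneg _)
    have h4 : T * (softPotential y (ν : Measure ℝ) x - softPotential y (μ : Measure ℝ) x - τ) ≤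
      T * 0 := by linarith
    linarith [le_of_mul_le_mul_left h4 hT]
  have hB : ∀ᵐ t ∂(μ : Measure ℝ), |t| ≤ max |a| |b| := by
    filter_upwards [h.ae_mem] with t ht using abs_le_max_abs_abs ht.1 ht.2
  have hlim : Tendsto (fun _ : ℕ => ν.toFiniteMeasure) atTop (𝓝 μ.toFiniteMeasure) := by
    refine tendsto_finiteMeasure_of_hasCompactSupport hB (fun _ => ?_) fun f hf hfc => ?_
    · exact measureReal_le_one (μ := (ν : Measure ℝ))
    · exact tendsto_integral_of_softPotential_le (ν := fun _ => (ν : Measure ℝ))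
        (le_max_of_le_left (abs_nonneg a)) hB h.hasLogMoment
        (fun _ => hasLogMoment_of_integrable_abs (h.integrable_abs hV))
        (fun y hy x τ hτ => Eventually.of_forall fun _ => hpot y hy x τ hτ) hf hfc
  have heq := tendsto_nhds_unique tendsto_const_nhds hlim
  exact (ProbabilityMeasure.toFiniteMeasure_isEmbedding ℝ).injective heq

end EulerLagrange

/-! ### One-cut regular fields -/

theorem corollary1p6 (V : ℝ → ℝ) (μ : ProbabilityMeasure ℝ) (hV : IsOneCutRegularWith V μ) :
    -- `μ` is the equilibrium measure, the unique minimizer of the energy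
    (∀ ν : ProbabilityMeasure ℝ, IsEquilibriumMeasure V ν ↔ ν = μ) ∧
    -- the polynomials are well defined
    (∀ n : ℕ, 1 ≤ n → (∃! P : ℝ[X], IsTypeTwoPolynomial V n n P) ∧
      (∃! Q : ℝ[X], IsDualPolynomial V n n Q)) ∧
    ∀ p q : ℕ → ℝ[X],
      (∀ n : ℕ, 1 ≤ n → IsTypeTwoPolynomial V n n (p n) ∧ IsDualPolynomial V n n (q n)) →
      -- each has `n` distinct real zeros
      (∀ n : ℕ, 1 ≤ n →
        (∃ z : Fin n → ℝ, EnumeratesZeros (fun x => (p n).eval x) z) ∧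
        (∃ z : Fin n → ℝ, EnumeratesZeros (fun x => (q n).eval (Real.exp x)) z)) ∧
      -- weak convergence of the normalized zero counting measures
      (∀ z : (n : ℕ) → Fin n → ℝ,
        (∀ n : ℕ, 1 ≤ n → EnumeratesZeros (fun x => (p n).eval x) (z n)) →
        Tendsto (fun n => countingMeasure (z n)) atTop (𝓝 μ.toFiniteMeasure)) ∧
      (∀ z : (n : ℕ) → Fin n → ℝ,
        (∀ n : ℕ, 1 ≤ n → EnumeratesZeros (fun x => (q n).eval (Real.exp x)) (z n)) →
        Tendsto (fun n => countingMeasure (z n)) atTop (𝓝 μ.toFiniteMeasure)) := by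
  obtain ⟨a, b, l, h⟩ := hV.exists_eulerLagrange
  obtain ⟨-, -, -, ψ, -, hψ, -, hμψ, -⟩ := hV.exists_density
  have hVc := h.continuous
  have hp : ∀ (n j : ℕ) (P : ℝ[X]), IsTypeTwoPolynomial V n j P ↔ P.Monic ∧ P.natDegree = j ∧
      ∀ k < j, ∫ t, P.eval (id t) * Real.exp t ^ k * Real.exp (-(n * V t)) = 0 := fun n j P => by
    simp only [IsTypeTwoPolynomial, Real.exp_nat_mul, id]
  have hq : ∀ (n j : ℕ) (Q : ℝ[X]), IsDualPolynomial V n j Q ↔ Q.Monic ∧ Q.natDegree = j ∧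
      ∀ k < j, ∫ t, Q.eval (Real.exp t) * id t ^ k * Real.exp (-(n * V t)) = 0 := fun n j Q => by
    simp only [IsDualPolynomial, mul_comm (Q.eval _), id]
  have hφχ : (id : ℝ → ℝ) = id ∧ Real.exp = Real.exp ∨ id = Real.exp ∧ Real.exp = id :=
    Or.inl ⟨rfl, rfl⟩
  have hχφ : Real.exp = id ∧ id = Real.exp ∨ Real.exp = Real.exp ∧ (id : ℝ → ℝ) = id :=
    Or.inr ⟨rfl, rfl⟩
  have hw : ∀ n : ℕ, Continuous fun t => Real.exp (-(n * V t)) := fun n => by fun_prop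
  refine ⟨fun ν => ⟨fun hν => h.eq_of_energy_le (hν μ), ?_⟩, fun n hn => ⟨?_, ?_⟩,
    fun p q hpq => ⟨fun n hn => ⟨?_, ?_⟩, fun z hz => ?_, fun z hz => ?_⟩⟩
  · rintro rfl ν'
    by_contra hlt
    exact hlt (h.eq_of_energy_le (not_le.1 hlt).le ▸ le_rfl)
  · simp only [hp]
    exact existsUnique_orthogonal strictMono_id Real.exp_strictMono continuous_id
      Real.continuous_exp (hw n) (fun t => Real.exp_pos _) (h.integrable_moment hφχ hn)
      (h.integral_ensembleDensity_pos hψ hμψ hφχ hn)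
  · simp only [hq]
    exact existsUnique_orthogonal Real.exp_strictMono strictMono_id Real.continuous_exp
      continuous_id (hw n) (fun t => Real.exp_pos _) (h.integrable_moment hχφ hn)
      (h.integral_ensembleDensity_pos hψ hμψ hχφ hn)
  · obtain ⟨hm, hd, ho⟩ := (hp _ _ _).1 (hpq n hn).1
    exact exists_enumeratesZeros strictMono_id Real.exp_strictMono continuous_id
      Real.continuous_exp (hw n) (fun t => Real.exp_pos _) (h.integrable_moment hφχ hn) hm hd ho
  · obtain ⟨hm, hd, ho⟩ := (hq _ _ _).1 (hpq n hn).2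
    exact exists_enumeratesZeros Real.exp_strictMono strictMono_id Real.continuous_exp
      continuous_id (hw n) (fun t => Real.exp_pos _) (h.integrable_moment hχφ hn) hm hd ho
  · exact h.tendsto_countingMeasure_zeros hψ hμψ hφχ
      (fun n hn => (hp _ _ _).1 (hpq n hn).1) hz
  · exact h.tendsto_countingMeasure_zeros hψ hμψ hχφ
      (fun n hn => (hq _ _ _).1 (hpq n hn).2) hz
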